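/- Let $B^n$ be the open Euclidean unit ball of $\mathbb C^n$ and let $A$ be a linear operator on $\mathbb C^n$ with $m(A):=\min\{\Re\langle Az,z\rangle:\|z\|=1\}>0$. Put $k_+(A):=\max\{\Re\lambda:\lambda\in\sigma(A)\}$ and $n_0:=\lfloor k_+(A)/m(A)\rfloor$. Let $h:B^n\times[0,\infty)\to\mathbb C^n$ be an infinitesimal generator, $h\in\mathcal H_A(B^n)$: for each $t\ge0$ the map $h(\cdot,t)$ is holomorphic on $B^n$ with $\Re\langle h(z,t),z\rangle>0$ for $z\in B^n\setminus\{0\}$ and $Dh(0,t)=A$, and $h(z,\cdot)$ is measurable on $[0,\infty)$ for each $z\in B^n$. A *solution* of the Loewner chain equation is a map $f:B^n\times[0,\infty)\to\mathbb C^n$ with all $f(\cdot,t)$ holomorphic, locally absolutely continuous in $t$ locally uniformly with respect to $z$, normalized by $f(0,0)=0$, $Df(0,0)=I$, such that for a.e. $t\ge0$ $$\frac{\partial f}{\partial t}(z,t)=Df(z,t)\,h(z,t)\qquad\text{for all } z\in B^n .$$ It is *polynomially bounded* (*bounded*) if for every compact $K\subset B^n$ there are a constant $C$ and a polynomial (constant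 polynomial) $P$ with $\|e^{-tA}f(z,t)\|\le C\,P(t)$ for $z\in K$, $t\ge0$. It is a *Loewner chain* if every $f(\cdot,t)$ is univalent and for $0\le s\le t$ there is a holomorphic $v:B^n\to B^n$ with $v(0)=0$ and $f(z,s)=f(v(z),t)$ on $B^n$. Write $f(z,t)=e^{tA}\bigl(z+\sum_{k\ge2}F_k(z,t)\bigr)$ with $F_k(\cdot,t)$ in the space $\mathcal P^k(\mathbb C^n)$ of homogeneous polynomial maps $\mathbb C^n\to\mathbb C^n$ of degree $k$. Let $B_k$ be the linear operator on $\mathcal P^k(\mathbb C^n)$ given by $(B_kQ)(z)=DQ(z)Az-AQ(z)$, let $P_k^{\le}$ be its spectral projection for the eigenvalues with nonpositive real part, and $F_k^{\le}:=P_k^{\le}F_k$. Then, for arbitrarily prescribed $Q_k\in P_k^{\le}(\mathcal P^k(\mathbb C^n))$, $k=2,\dots,n_0$, there is a polynomially bounded solution $f$ that is a Loewner chain, satisfies $f(0,t)=0$ and $Df(0,t)=e^{tA}$ for $t\ge0$, and has $F_k^{\le}(\cdot,0)=Q_k$ for $k=2,\dots,n_0$; and it is the only polynomially bounded solution with $F_k^{\le}(\cdot,0)=Q_k$,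 $k=2,\dots,n_0$. If moreover "$A+\bar A$ is nonresonant", i.e. the numbers $\lambda_i+\bar\lambda_i$, where $\lambda_1,\dots,\lambda_n$ are the eigenvalues of $A$, satisfy $\sum_i m_i(\lambda_i+\bar\lambda_i)\ne\lambda_s+\bar\lambda_s$ for all $s$ and all $(m_1,\dots,m_n)\in\mathbb N^n$ with $\sum_i m_i\ge2$, then this solution is bounded. -/

import Mathlib

noncomputable section

open Set MeasureTheory Module
open scoped Polynomial Nat

namespace Loewner

/-- `ℂⁿ` with the Euclidean norm and inner product. -/
abbrev Cn (n : ℕ) : Type := EuclideanSpace ℂ (Fin n)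

/-- The open unit ball `Bⁿ` of `ℂⁿ`. -/
def unitBall (n : ℕ) : Set (Cn n) := Metric.ball 0 1

/-! ### Numbers attached to a linear operator -/

/-- `m(A) = min {Re ⟨A z, z⟩ : ‖z‖ = 1}`. -/
def lowerIndex {n : ℕ} (A : Cn n →L[ℂ] Cn n) : ℝ :=
  sInf ((fun z : Cn n => (inner ℂ z (A z)).re) '' Metric.sphere 0 1)

/-- `k₊(A) = max {Re l : l ∈ σ(A)}`. -/
def upperIndex {n : ℕ} (A : Cn n →L[ℂ] Cn n) : ℝ :=
  sSup (Complex.re '' spectrum ℂ A)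

/-- `n₀ = [k₊(A) / m(A)]`. -/
def nZero {n : ℕ} (A : Cn n →L[ℂ] Cn n) : ℕ := ⌊upperIndex A / lowerIndex A⌋₊

/-- The operator `e^{tA}`. -/
def expOp {n : ℕ} (A : Cn n →L[ℂ] Cn n) (t : ℝ) : Cn n →L[ℂ] Cn n :=
  NormedSpace.exp ((t : ℂ) • A)

/-- A finite family of complex numbers is nonresonant if no member of it is equal to a combination
`∑ mᵢ lᵢ` with natural coefficients of order `∑ mᵢ ≥ 2`. -/
def IsNonresonant {ι : Type*} [Fintype ι] (l : ι → ℂ) : Prop :=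
  ∀ m : ι → ℕ, 2 ≤ ∑ i, m i → ∀ s, ∑ i, (m i : ℂ) * l i ≠ l s

/-- Nonresonance of "`A + Ā`": the family of the numbers `l + l̄`, where `l` runs through the
eigenvalues of `A`, is nonresonant. (Repeating eigenvalues according to their multiplicity would
not change the condition.) -/
def ConjSumNonresonant {n : ℕ} (A : Cn n →L[ℂ] Cn n) : Prop :=
  IsNonresonant (fun l : End.Eigenvalues (A : Cn n →ₗ[ℂ] Cn n) =>
    (l : ℂ) + (starRingEnd ℂ) (l : ℂ))

/-! ### Infinitesimal generators and Loewner chains -/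

/-- The class `𝒩_A`. -/
structure IsInN {n : ℕ} (A : Cn n →L[ℂ] Cn n) (h : Cn n → Cn n) : Prop where
  holomorphic : DifferentiableOn ℂ h (unitBall n)
  re_pos : ∀ z ∈ unitBall n, z ≠ 0 → 0 < (inner ℂ z (h z)).re
  fderiv_zero : fderiv ℂ h 0 = A

/-- The class `ℋ_A(Bⁿ)` of infinitesimal generators; only the values `h z t` with `z ∈ Bⁿ` and
`t ≥ 0` matter, and measurability is Lebesgue measurability on `[0, ∞)`. -/
structure IsGenerator {n : ℕ} (A : Cn n →L[ℂ] Cn n) (h : Cn n → ℝ → Cn n) : Prop where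
  mem_N : ∀ t : ℝ, 0 ≤ t → IsInN A (fun z => h z t)
  measurable : ∀ z ∈ unitBall n, AEMeasurable (h z) (volume.restrict (Ici (0 : ℝ)))

/-- `f` is a Loewner chain: every `f(·, t)` is univalent on `Bⁿ`, and `f(·, s)` is subordinate to
`f(·, t)` for `0 ≤ s ≤ t`. -/
structure IsLoewnerChain {n : ℕ} (f : Cn n → ℝ → Cn n) : Prop where
  holomorphic : ∀ t : ℝ, 0 ≤ t → DifferentiableOn ℂ (fun z => f z t) (unitBall n)
  injective : ∀ t : ℝ, 0 ≤ t → InjOn (fun z => f z t) (unitBall n)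
  subordinate : ∀ s t : ℝ, 0 ≤ s → s ≤ t → ∃ v : Cn n → Cn n,
    DifferentiableOn ℂ v (unitBall n) ∧ MapsTo v (unitBall n) (unitBall n) ∧ v 0 = 0 ∧
      ∀ z ∈ unitBall n, f z s = f (v z) t

/-- `f(z, t)` is locally absolutely continuous in `t ∈ [0, ∞)`, locally uniformly with respect to
`z ∈ Bⁿ`: on `[0, T]` the `δ` of absolute continuity can be chosen the same for all `z` in a given
compact subset of `Bⁿ`. (`disjWithin 0 T` is the set of finite families of non-overlapping intervals
with end points in `[0, T]`.) -/
def LocallyAC {n : ℕ} (f : Cn n → ℝ → Cn n) : Prop :=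
  ∀ K : Set (Cn n), IsCompact K → K ⊆ unitBall n → ∀ T : ℝ, 0 ≤ T → ∀ ε : ℝ, 0 < ε →
    ∃ δ : ℝ, 0 < δ ∧ ∀ z ∈ K, ∀ I ∈ AbsolutelyContinuousOnInterval.disjWithin 0 T,
      ∑ i ∈ Finset.range I.1, dist (I.2 i).1 (I.2 i).2 < δ →
      ∑ i ∈ Finset.range I.1, dist (f z (I.2 i).1) (f z (I.2 i).2) < ε

/-- `f` is a solution of the Loewner chain equation `∂f/∂t = Df h`, normalized by `f(0, 0) = 0` and
`Df(0, 0) = I`. -/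
structure IsSolution {n : ℕ} (h f : Cn n → ℝ → Cn n) : Prop where
  holomorphic : ∀ t : ℝ, 0 ≤ t → DifferentiableOn ℂ (fun z => f z t) (unitBall n)
  locallyAC : LocallyAC f
  equation : ∀ᵐ t ∂(volume.restrict (Ici (0 : ℝ))), ∀ z ∈ unitBall n,
    HasDerivAt (f z) (fderiv ℂ (fun w => f w t) z (h z t)) t
  zero_zero : f 0 0 = 0
  fderiv_zero : fderiv ℂ (fun z => f z 0) 0 = ContinuousLinearMap.id ℂ (Cn n)

/-- The family `{e^{-tA} f(·, t)}`, `t ≥ 0`, is locally polynomially bounded on `Bⁿ`. -/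
def PolynomiallyBounded {n : ℕ} (A : Cn n →L[ℂ] Cn n) (f : Cn n → ℝ → Cn n) : Prop :=
  ∀ K : Set (Cn n), IsCompact K → K ⊆ unitBall n → ∃ (C : ℝ) (P : ℝ[X]),
    ∀ z ∈ K, ∀ t : ℝ, 0 ≤ t → ‖expOp A (-t) (f z t)‖ ≤ C * P.eval t

/-- The family `{e^{-tA} f(·, t)}`, `t ≥ 0`, is locally bounded on `Bⁿ`. -/
def LocallyBounded {n : ℕ} (A : Cn n →L[ℂ] Cn n) (f : Cn n → ℝ → Cn n) : Prop :=
  ∀ K : Set (Cn n), IsCompact K → K ⊆ unitBall n → ∃ C : ℝ,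
    ∀ z ∈ K, ∀ t : ℝ, 0 ≤ t → ‖expOp A (-t) (f z t)‖ ≤ C

/-! ### Homogeneous polynomial mappings -/

/-- The restriction of a `k`-linear mapping to the diagonal. -/
def diagonal (n k : ℕ) :
    ContinuousMultilinearMap ℂ (fun _ : Fin k => Cn n) (Cn n) →ₗ[ℂ] (Cn n → Cn n) where
  toFun M := fun z => M (fun _ => z)
  map_add' _ _ := rfl
  map_smul' _ _ := rfl

/-- The space `𝒫ᵏ(ℂⁿ)` of homogeneous polynomial mappings of degree `k` from `ℂⁿ` to `ℂⁿ`. -/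
def HomPoly (n k : ℕ) : Submodule ℂ (Cn n → Cn n) := LinearMap.range (diagonal n k)

instance (n k : ℕ) : FiniteDimensional ℂ (HomPoly n k) := by
  have : FiniteDimensional ℂ (ContinuousMultilinearMap ℂ (fun _ : Fin k => Cn n) (Cn n)) :=
    Module.Finite.of_injective
      ({ toFun := fun M => M.toMultilinearMap
         map_add' := fun _ _ => rfl
         map_smul' := fun _ _ => rfl } :
        ContinuousMultilinearMap ℂ (fun _ : Fin k => Cn n) (Cn n) →ₗ[ℂ]
          MultilinearMap ℂ (fun _ : Fin k => Cn n) (Cn n))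
      ContinuousMultilinearMap.toMultilinearMap_injective
  exact LinearMap.finiteDimensional_range _

theorem hasFDerivAt_diagonal {n k : ℕ}
    (M : ContinuousMultilinearMap ℂ (fun _ : Fin k => Cn n) (Cn n)) (z : Cn n) :
    HasFDerivAt (diagonal n k M)
      ((M.linearDeriv (fun _ => z)).comp (ContinuousLinearMap.pi fun _ => .id ℂ (Cn n))) z :=
  (M.hasFDerivAt (fun _ => z)).comp z
    (ContinuousLinearMap.pi fun _ : Fin k => ContinuousLinearMap.id ℂ (Cn n)).hasFDerivAt

theorem differentiable_homPoly {n k : ℕ} (Q : HomPoly n k) :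
    Differentiable ℂ (Q : Cn n → Cn n) := by
  obtain ⟨_, M, rfl⟩ := Q
  exact fun z => (hasFDerivAt_diagonal M z).differentiableAt

theorem bracket_mem {n k : ℕ} (A : Cn n →L[ℂ] Cn n) (Q : HomPoly n k) :
    (fun z => fderiv ℂ (Q : Cn n → Cn n) z (A z) - A ((Q : Cn n → Cn n) z)) ∈ HomPoly n k := by
  obtain ⟨_, M, rfl⟩ := Q
  refine ⟨(∑ i, M.compContinuousLinearMap
    (Function.update (fun _ => ContinuousLinearMap.id ℂ (Cn n)) i A)) -
      A.compContinuousMultilinearMap M, ?_⟩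
  funext z
  rw [(hasFDerivAt_diagonal M z).fderiv]
  simp only [diagonal, LinearMap.coe_mk, AddHom.coe_mk, sub_apply,
    sum_apply, ContinuousLinearMap.comp_apply,
    ContinuousMultilinearMap.linearDeriv_apply,
    ContinuousMultilinearMap.compContinuousLinearMap_apply,
    ContinuousLinearMap.compContinuousMultilinearMap_coe, Function.comp_apply]
  congr 1
  refine Finset.sum_congr rfl fun i _ => congrArg M ?_
  funext j
  by_cases hj : j = i
  · subst hj; simp
  · simp [hj]

/-- The operator `B_k` on `𝒫ᵏ(ℂⁿ)`, `B_k(Q)(z) = k Q(Az, z^{k-1}) - A Q(z^k)`. The first term, written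
with the symmetric `k`-linear mapping of `Q`, is the derivative of `Q` at `z` in the direction
`A z`. -/
def opB {n : ℕ} (A : Cn n →L[ℂ] Cn n) (k : ℕ) : HomPoly n k →ₗ[ℂ] HomPoly n k where
  toFun Q := ⟨fun z => fderiv ℂ (Q : Cn n → Cn n) z (A z) - A ((Q : Cn n → Cn n) z),
    bracket_mem A Q⟩
  map_add' Q R := by
    ext1
    funext z
    have := fderiv_add (differentiable_homPoly Q z) (differentiable_homPoly R z)
    simp only [Submodule.coe_add, Pi.add_apply, this, add_apply, map_add]
    abel
  map_smul' c Q := by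
    ext1
    funext z
    have := fderiv_const_smul (differentiable_homPoly Q z) c
    simp only [Submodule.coe_smul, Pi.smul_apply, this, smul_apply, map_smul,
      RingHom.id_apply, smul_sub]

/-! ### Spectral projections -/

/-- The spectral subspace of `L` that belongs to the spectral values in `S`: the sum of the
generalized eigenspaces. -/
def spectralSubspace {V : Type*} [AddCommGroup V] [Module ℂ V] (L : End ℂ V) (S : Set ℂ) :
    Submodule ℂ V := ⨆ l ∈ S, L.maxGenEigenspace l

theorem isCompl_spectralSubspace {V : Type*} [AddCommGroup V] [Module ℂ V]
    [FiniteDimensional ℂ V] (L : End ℂ V) (S : Set ℂ) :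
    IsCompl (spectralSubspace L S) (spectralSubspace L Sᶜ) := by
  refine ⟨L.independent_maxGenEigenspace.disjoint_biSup_biSup disjoint_compl_right, ?_⟩
  rw [codisjoint_iff, spectralSubspace, spectralSubspace, ← iSup_union, union_compl_self]
  simpa using End.iSup_maxGenEigenspace_eq_top L

/-- The spectral projection of `L` that belongs to the spectral values in `S`: the projection onto
the spectral subspace of `S` along that of the complement of `S`. -/
def spectralProjection {V : Type*} [AddCommGroup V] [Module ℂ V] [FiniteDimensional ℂ V]
    (L : End ℂ V) (S : Set ℂ) : V →ₗ[ℂ] V :=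
  Submodule.projection _ _ (isCompl_spectralSubspace L S)

/-- The projection `P_k^≤`: the spectral projection of `B_k` that belongs to the spectral values with
nonpositive real part. -/
def projLE {n : ℕ} (A : Cn n →L[ℂ] Cn n) (k : ℕ) : HomPoly n k →ₗ[ℂ] HomPoly n k :=
  spectralProjection (opB A k) {l : ℂ | l.re ≤ 0}

/-! ### Taylor coefficients -/

/-- The homogeneous term of degree `k` of the Taylor expansion of `g` at `0`. -/
def taylorTerm {n : ℕ} (g : Cn n → Cn n) (k : ℕ) : HomPoly n k :=
  ⟨fun z => ((k ! : ℂ)⁻¹) • iteratedFDeriv ℂ k g 0 (fun _ => z),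
    ⟨((k ! : ℂ)⁻¹) • iteratedFDeriv ℂ k g 0, rfl⟩⟩

/-- The coefficient `F_k(·, t)` in `f(z, t) = e^{tA} (z + ∑_{k ≥ 2} F_k(z^k, t))`. -/
def coeffF {n : ℕ} (A : Cn n →L[ℂ] Cn n) (f : Cn n → ℝ → Cn n) (k : ℕ) (t : ℝ) : HomPoly n k :=
  taylorTerm (fun z => expOp A (-t) (f z t)) k

end Loewner

end

noncomputable section

open Set MeasureTheory Module
open scoped Polynomial Nat

namespace Loewner

set_option linter.unusedSectionVars false

open Filter Metric
open scoped Topology ContDiff NNReal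

/-! ### Holomorphic maps of several variables: Cauchy estimates, uniform limits, smoothness -/

section SeveralVariables

variable {E F : Type*} [NormedAddCommGroup E] [NormedSpace ℂ E]
  [NormedAddCommGroup F] [NormedSpace ℂ F]

/-! The equation is transported along the flow `w' = -h(w, t)`. Its transition maps `v_{s,t}` are
injective holomorphic self-maps of the ball fixing `0`. By the distortion estimates for functions of
positive real part they contract compact sets at the rate `e^{-m(A)(t-s)}` (`exists_decay`,
`exists_norm_transition_decay`). A locally bounded holomorphic family with `f(z,s) =
f(v_{s,t}(z),t)` satisfies the Loewner equation (`ae_equation_of_subordinate`), so it is enough to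
build such a family with controlled growth.

Comparing homogeneous terms of `e^{-tA} f` turns the equation into a triangular system `F_k' = B_k
F_k + N_k`, where `N_k` depends only on `h` and on the `F_j` with `j < k`. If `N_k` grows
polynomially, the part of `F_k` in the unstable spectral subspace has to be obtained by integrating
from infinity, while the part for eigenvalues of nonpositive real part may start anywhere. So
polynomially bounded solutions of one such equation correspond to stable initial values
(`exists_polyB_solution`, `eq_zero_of_polyB_solution`). The eigenvalues of `B_k` have the form `∑
l_i - ν` with `l_i, ν ∈ σ(A)` (`exists_eigenvalues_of_opB`). Their real parts are at least `k m(A) -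
k₊(A)`, which is positive for `k > n₀`: only the degrees `2, …, n₀` carry free data. Uniqueness
follows by induction on the degree.

For existence the expansion is cut off after degree `n₀`. The resulting polynomial `S_t` satisfies
the equation up to a defect of order `N = n₀ + 1` at the origin. The `t`-derivative of `e^{tA}
S_t(v_{s,t}(z))` is `e^{tA}` applied to the defect at `v_{s,t}(z)`. Up to polynomial factors and the
factor `e^{sA}` it has size `e^{(k₊ - N m)(t-s)}`. Since `N m > k₊`, the limit `t → ∞` exists
(`exists_norm_approxChain_sub_le`). The limit is compatible with the flow by construction, and
`e^{-sA}` times it differs from `S_s` only to order `N`, so it has the prescribed coefficients and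
polynomial growth. It is univalent because `e^{-tA} f(·,t)` is the identity plus a quadratic error
with polynomially growing constant. This is injective on the exponentially small ball into which
`v_{s,t}` moves two given points (`injOn_chain`).

Nonresonance of `A + Ā` keeps the spectrum of every `B_k`, `k ≥ 2`, off the imaginary axis. Stable
parts then decay exponentially and no powers of `t` arise. The proposition `p` in `PolyB` carries
this case through the same construction. -/

/-- Cauchy's estimate for the derivative of a bounded holomorphic map. -/
theorem norm_fderiv_le_of_bounded {f : E → F} {c : E} {r M : ℝ} (hr : 0 < r)
    (hf : DifferentiableOn ℂ f (ball c r)) (hM : ∀ z ∈ ball c r, ‖f z‖ ≤ M) :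
    ‖fderiv ℂ f c‖ ≤ 2 * M / r := by
  refine Complex.norm_fderiv_le_div_of_mapsTo_ball hf (fun z hz => ?_) hr
  rw [mem_closedBall, dist_eq_norm]
  calc ‖f z - f c‖ ≤ ‖f z‖ + ‖f c‖ := norm_sub_le _ _
    _ ≤ 2 * M := by linarith [hM z hz, hM c (mem_ball_self hr)]

/-- A uniform limit of holomorphic maps is holomorphic. -/
theorem differentiableAt_of_tendstoUniformlyOn_ball [CompleteSpace F] {ι : Type*}
    {l : Filter ι} [NeBot l] {f : ι → E → F} {g : E → F} {x : E} {R : ℝ} (hR : 0 < R)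
    (hf : ∀ᶠ i in l, DifferentiableOn ℂ (f i) (ball x R))
    (hfg : TendstoUniformlyOn f g l (ball x R)) : DifferentiableAt ℂ g x := by
  obtain ⟨r, hr, hrR⟩ : ∃ r > 0, R = 2 * r := ⟨R / 2, by positivity, by ring⟩
  subst hrR
  have hsub : ∀ y ∈ ball x r, ball y r ⊆ ball x (2 * r) := fun y hy => by
    apply ball_subset_ball'
    rw [mem_ball] at hy
    linarith
  have hdiff : ∀ᶠ i in l, ∀ y ∈ ball x r, HasFDerivAt (f i) (fderiv ℂ (f i) y) y := by
    filter_upwards [hf] with i hi y hy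
    exact (hi.differentiableAt (isOpen_ball.mem_nhds
      (hsub y hy (mem_ball_self hr)))).hasFDerivAt
  -- Cauchy's estimate on balls of radius `r` turns uniform closeness of the maps into uniform
  -- closeness of the derivatives; the tolerance `ε * r / 4` yields `ε / 2`.
  have hC : UniformCauchySeqOn (fun i => fderiv ℂ (f i)) l (ball x r) := by
    have h1 := hfg.uniformCauchySeqOn
    intro u hu
    obtain ⟨ε, hε, hεu⟩ := Metric.mem_uniformity_dist.1 hu
    have h2 := h1 _ (Metric.dist_mem_uniformity (show 0 < ε * r / 4 by positivity))
    have h3 : ∀ᶠ m : ι × ι in l ×ˢ l, DifferentiableOn ℂ (f m.1) (ball x (2 * r)) ∧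
        DifferentiableOn ℂ (f m.2) (ball x (2 * r)) := hf.prod_mk hf
    filter_upwards [h2, h3] with m hm hd y hy
    apply hεu
    have hyx := hsub y hy (mem_ball_self hr)
    rw [dist_eq_norm, ← fderiv_fun_sub (hd.1.differentiableAt (isOpen_ball.mem_nhds hyx))
      (hd.2.differentiableAt (isOpen_ball.mem_nhds hyx))]
    have := norm_fderiv_le_of_bounded (f := fun z => f m.1 z - f m.2 z) (M := ε * r / 4) hr
      ((hd.1.sub hd.2).mono (hsub y hy)) (fun z hz => by
        have := hm z (hsub y hy hz)
        rw [← dist_eq_norm]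
        exact le_of_lt this)
    calc _ ≤ _ := this
      _ = ε / 2 := by field_simp; ring
      _ < ε := by linarith
  have hlim : ∀ y ∈ ball x r, ∃ L, Tendsto (fun i => fderiv ℂ (f i) y) l (𝓝 L) := fun y hy =>
    cauchy_map_iff_exists_tendsto.1 (hC.cauchy_map hy)
  choose! g' hg' using hlim
  have hu := hC.tendstoUniformlyOn_of_tendsto hg'
  refine (hasFDerivAt_of_tendstoUniformlyOnFilter (l := l) (f := f) (𝕜 := ℂ)
    (f' := fun i => fderiv ℂ (f i)) (g' := g') ?_ ?_ ?_).differentiableAt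
  · exact (tendstoUniformlyOn_iff_tendstoUniformlyOnFilter.1 hu).mono_right
      (le_principal_iff.2 (ball_mem_nhds x hr))
  · exact (hdiff.prod_mk (ball_mem_nhds x hr)).mono fun p hp => hp.1 _ hp.2
  · filter_upwards [ball_mem_nhds x hr] with y hy
    exact hfg.tendsto_at (hsub y hy (mem_ball_self hr))

/-- Second order Taylor estimate for a bounded holomorphic map. -/
theorem norm_sub_sub_fderiv_le {f : E → F} {c : E} {r M : ℝ} (hr : 0 < r)
    (hf : DifferentiableOn ℂ f (ball c r)) (hM : ∀ z ∈ ball c r, ‖f z‖ ≤ M) {z : E}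
    (hz : z ∈ ball c r) :
    ‖f z - f c - fderiv ℂ f c (z - c)‖ ≤ 4 * M * (‖z - c‖ / r) ^ 2 := by
  have hcd : DifferentiableAt ℂ f c := hf.differentiableAt (ball_mem_nhds c hr)
  have hM0 : 0 ≤ M := (norm_nonneg _).trans (hM c (mem_ball_self hr))
  -- Second order Schwarz lemma: the Taylor remainder is `o(‖z - c‖)` and is bounded by `M + M + 2 *
  -- M`.
  have := Complex.dist_le_mul_div_pow_of_mapsTo_ball_of_isLittleO (n := 1)
    (f := fun z => f z - f c - fderiv ℂ f c (z - c)) (R₂ := 4 * M) (c := c) (R₁ := r) (z := z)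
    (by
      refine (hf.sub_const _).sub ?_
      exact ((fderiv ℂ f c).differentiable.comp (differentiable_id.sub_const c)).differentiableOn)
    (fun w hw => by
      simp only [mem_closedBall, sub_self, map_zero, dist_zero_right]
      have h1 := norm_fderiv_le_of_bounded hr hf hM
      have h2 : ‖fderiv ℂ f c (w - c)‖ ≤ 2 * M / r * r := by
        refine (ContinuousLinearMap.le_opNorm _ _).trans ?_
        have : ‖w - c‖ ≤ r := by rw [← dist_eq_norm]; exact (mem_ball.1 hw).le
        gcongr
      rw [div_mul_cancel₀ _ hr.ne'] at h2
      calc _ ≤ ‖f w‖ + ‖f c‖ + ‖fderiv ℂ f c (w - c)‖ :=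
            (norm_sub_le _ _).trans (by gcongr; exact norm_sub_le _ _)
        _ ≤ 4 * M := by linarith [hM w hw, hM c (mem_ball_self hr)])
    (by
      have := hcd.hasFDerivAt.isLittleO
      simpa using this.norm_right)
    hz
  simpa [dist_eq_norm] using this

/-- The difference quotients in the direction `w` are holomorphic, and by the second order Taylor
estimate they converge uniformly on a small ball. So the directional derivative is a uniform limit
of holomorphic maps. -/
theorem differentiableAt_fderiv_apply [CompleteSpace F] {f : E → F} {c : E} {r : ℝ} (hr : 0 < r)
    (hf : DifferentiableOn ℂ f (ball c r)) (w : E) :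
    DifferentiableAt ℂ (fun z => fderiv ℂ f z w) c := by
  obtain ⟨δ, hδ, M, hM⟩ : ∃ δ > 0, ∃ M, ∀ z ∈ ball c δ, ‖f z‖ ≤ M := by
    have h1 : ContinuousAt f c := hf.continuousOn.continuousAt (ball_mem_nhds c hr)
    obtain ⟨δ, hδ, h⟩ := Metric.continuousAt_iff.1 h1 1 one_pos
    refine ⟨δ, hδ, ‖f c‖ + 1, fun z hz => ?_⟩
    have := h hz
    rw [dist_eq_norm] at this
    linarith [norm_le_norm_add_norm_sub' (f z) (f c)]
  obtain ⟨ρ, hρ, hρr, hρδ⟩ : ∃ ρ > 0, 2 * ρ ≤ r ∧ 2 * ρ ≤ δ :=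
    ⟨min r δ / 2, by positivity, by linarith [min_le_left r δ], by linarith [min_le_right r δ]⟩
  have hsub : ∀ y ∈ ball c ρ, ball y ρ ⊆ ball c (2 * ρ) := fun y hy => by
    apply ball_subset_ball'
    rw [mem_ball] at hy
    linarith
  have hfd : DifferentiableOn ℂ f (ball c (2 * ρ)) := hf.mono (ball_subset_ball hρr)
  have hM' : ∀ z ∈ ball c (2 * ρ), ‖f z‖ ≤ M := fun z hz => hM z (ball_subset_ball hρδ hz)
  have hM0 : 0 ≤ M := (norm_nonneg _).trans (hM c (mem_ball_self hδ))
  have hsmall : ∀ᶠ ε : ℂ in 𝓝[≠] 0, ‖ε • w‖ < ρ := by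
    have h0 : Tendsto (fun ε : ℂ => ‖ε • w‖) (𝓝 0) (𝓝 0) := by
      have : Continuous fun ε : ℂ => ‖ε • w‖ := by fun_prop
      simpa using this.tendsto 0
    exact (h0.eventually (gt_mem_nhds hρ)).filter_mono nhdsWithin_le_nhds
  refine differentiableAt_of_tendstoUniformlyOn_ball (l := 𝓝[≠] (0 : ℂ)) hρ
    (f := fun ε z => ε⁻¹ • (f (z + ε • w) - f z)) ?_ ?_
  · filter_upwards [hsmall] with ε hε
    refine DifferentiableOn.const_smul (DifferentiableOn.sub ?_
      (hfd.mono (ball_subset_ball (by linarith)))) _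
    refine hfd.comp (by fun_prop) fun z hz => hsub z hz ?_
    simpa [mem_ball, dist_eq_norm] using hε
  · rw [Metric.tendstoUniformlyOn_iff]
    intro η hη
    have h0 : Tendsto (fun ε : ℂ => 4 * M * (‖w‖ / ρ) ^ 2 * ‖ε‖) (𝓝 0) (𝓝 0) := by
      have : Continuous fun ε : ℂ => 4 * M * (‖w‖ / ρ) ^ 2 * ‖ε‖ := by fun_prop
      simpa using this.tendsto 0
    filter_upwards [hsmall, (h0.eventually (gt_mem_nhds hη)).filter_mono nhdsWithin_le_nhds,
      self_mem_nhdsWithin] with ε hε1 hε2 hε0 z hz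
    have hε0 : ε ≠ 0 := hε0
    have hm : z + ε • w ∈ ball z ρ := by simpa [mem_ball, dist_eq_norm] using hε1
    have := norm_sub_sub_fderiv_le hρ (hfd.mono (hsub z hz))
      (fun y hy => hM' y (hsub z hz hy)) hm
    rw [dist_eq_norm, norm_sub_rev]
    have h3 : ε⁻¹ • (f (z + ε • w) - f z) - fderiv ℂ f z w =
        ε⁻¹ • (f (z + ε • w) - f z - fderiv ℂ f z (z + ε • w - z)) := by
      rw [add_sub_cancel_left, map_smul, smul_sub ε⁻¹ (f (z + ε • w) - f z), smul_smul,
        inv_mul_cancel₀ hε0, one_smul]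
    rw [h3, norm_smul, norm_inv]
    refine lt_of_le_of_lt ?_ hε2
    calc ‖ε‖⁻¹ * _ ≤ ‖ε‖⁻¹ * (4 * M * (‖z + ε • w - z‖ / ρ) ^ 2) := by gcongr
      _ = 4 * M * (‖w‖ / ρ) ^ 2 * ‖ε‖ := by
        have : ‖ε‖ ≠ 0 := norm_ne_zero_iff.2 hε0
        rw [add_sub_cancel_left, norm_smul]
        field_simp

/-- Induction on the order of smoothness: each directional derivative is again holomorphic, and in
finite dimension these determine the smoothness of `fderiv`. -/
theorem contDiffOn_of_differentiableOn_complex [FiniteDimensional ℂ E] [CompleteSpace F]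
    {f : E → F} {s : Set E} (hs : IsOpen s) (hf : DifferentiableOn ℂ f s) :
    ContDiffOn ℂ ∞ f s := by
  rw [contDiffOn_infty]
  intro k
  induction k generalizing f with
  | zero => exact contDiffOn_zero.2 hf.continuousOn
  | succ k ih =>
    rw [Nat.cast_succ, contDiffOn_succ_iff_fderiv_of_isOpen hs]
    refine ⟨hf, by simp, contDiffOn_clm_apply.2 fun y => ih fun z hz => ?_⟩
    obtain ⟨r, hr, hrs⟩ := Metric.isOpen_iff.1 hs z hz
    exact (differentiableAt_fderiv_apply hr (hf.mono hrs) y).differentiableWithinAt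

theorem differentiableOn_fderiv [FiniteDimensional ℂ E] [CompleteSpace F]
    {f : E → F} {s : Set E} (hs : IsOpen s) (hf : DifferentiableOn ℂ f s) :
    DifferentiableOn ℂ (fderiv ℂ f) s :=
  ((contDiffOn_infty_iff_fderiv_of_isOpen hs).1
    (contDiffOn_of_differentiableOn_complex hs hf)).2.differentiableOn (by simp)

end SeveralVariables

/-! ### Schwarz's lemma of higher order on a disc -/

section OneVariable

variable {F : Type*} [NormedAddCommGroup F] [NormedSpace ℂ F]

/-- Schwarz's lemma for a function whose derivatives of order `< N` vanish at the origin. -/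
theorem norm_le_of_iteratedDeriv_eq_zero [CompleteSpace F] {p : ℂ → F} {R M : ℝ} {N : ℕ} (hR : 0 < R)
    (hp : DifferentiableOn ℂ p (ball 0 R)) (hM : ∀ ζ ∈ ball (0 : ℂ) R, ‖p ζ‖ ≤ M)
    (h0 : ∀ j < N, iteratedDeriv j p 0 = 0) {ζ : ℂ} (hζ : ζ ∈ ball 0 R) :
    ‖p ζ‖ ≤ M * (‖ζ‖ / R) ^ N := by
  rcases N with _ | N
  · simpa using hM ζ hζ
  have hp0 : p 0 = 0 := by simpa using h0 0 (Nat.succ_pos _)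
  have han : AnalyticAt ℂ p 0 := hp.analyticAt (ball_mem_nhds 0 hR)
  have hord : ((N + 1 : ℕ) : ℕ∞) ≤ analyticOrderAt p 0 :=
    (natCast_le_analyticOrderAt_iff_iteratedDeriv_eq_zero han).2 h0
  obtain ⟨g, hg, hpg⟩ := (natCast_le_analyticOrderAt han).1 hord
  have := Complex.dist_le_mul_div_pow_of_mapsTo_ball_of_isLittleO (n := N) hp (R₂ := M)
    (fun w hw => by simpa [hp0] using hM w hw) (by
      have h1 : (fun w => p w - p 0) =ᶠ[𝓝 0] fun w => w ^ (N + 1) • g w := by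
        filter_upwards [hpg] with w hw
        rw [hw, hp0]; simp
      refine h1.trans_isLittleO ?_
      have h2 : (fun w : ℂ => g w) =O[𝓝 0] fun _ => (1 : ℝ) := hg.continuousAt.isBigO_one ℝ
      have h3 : (fun w : ℂ => w ^ (N + 1)) =o[𝓝 0] fun w => ‖w - 0‖ ^ N := by
        have : (fun w : ℂ => w ^ (N + 1)) =o[𝓝 0] fun w => w ^ N :=
          Asymptotics.isLittleO_pow_pow (Nat.lt_succ_self N)
        simpa [norm_pow] using this.norm_right
      simpa using h3.smul_isBigO h2) hζ
  simpa [hp0] using this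

end OneVariable

/-! ### Homogeneous Taylor terms on the unit ball -/

section Taylor

variable {n : ℕ}

theorem isOpen_unitBall : IsOpen (unitBall n) := isOpen_ball

theorem mem_unitBall {z : Cn n} : z ∈ unitBall n ↔ ‖z‖ < 1 := mem_ball_zero_iff

theorem zero_mem_unitBall : (0 : Cn n) ∈ unitBall n := by simp [mem_unitBall]

theorem unitBall_mem_nhds : unitBall n ∈ 𝓝 (0 : Cn n) :=
  isOpen_unitBall.mem_nhds zero_mem_unitBall

theorem contDiffAt_zero {g : Cn n → Cn n} (hg : DifferentiableOn ℂ g (unitBall n)) (k : ℕ) :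
    ContDiffAt ℂ k g 0 :=
  ((contDiffOn_of_differentiableOn_complex isOpen_unitBall hg).contDiffAt
    unitBall_mem_nhds).of_le (by exact_mod_cast le_top)

theorem homPoly_smul {k : ℕ} (Q : HomPoly n k) (c : ℂ) (z : Cn n) :
    (Q : Cn n → Cn n) (c • z) = c ^ k • (Q : Cn n → Cn n) z := by
  obtain ⟨_, M, rfl⟩ := Q
  simp [diagonal, M.map_smul_univ (fun _ => c)]

/-- Restriction to the complex line through `z`: this is the bridge by which the one-variable Cauchy
and Schwarz estimates reach the homogeneous terms. -/
theorem taylorTerm_apply {g : Cn n → Cn n} (hg : DifferentiableOn ℂ g (unitBall n)) (k : ℕ)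
    (z : Cn n) : (taylorTerm g k : Cn n → Cn n) z =
      ((k ! : ℂ)⁻¹) • iteratedDeriv k (fun ζ : ℂ => g (ζ • z)) 0 := by
  set L : ℂ →L[ℂ] Cn n := ContinuousLinearMap.toSpanSingleton ℂ z
  have hL : IsOpen (L ⁻¹' unitBall n) := isOpen_unitBall.preimage L.continuous
  have h0 : L 0 ∈ unitBall n := by simpa using zero_mem_unitBall
  have h1 := L.iteratedFDerivWithin_comp_right (n := ∞) (i := k)
    (contDiffOn_of_differentiableOn_complex isOpen_unitBall hg) isOpen_unitBall.uniqueDiffOn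
    hL.uniqueDiffOn h0 (by exact_mod_cast le_top)
  rw [iteratedFDerivWithin_of_isOpen _ hL h0, iteratedFDerivWithin_of_isOpen _ isOpen_unitBall h0]
    at h1
  have h2 : (fun ζ : ℂ => g (ζ • z)) = g ∘ L := rfl
  rw [h2, iteratedDeriv_eq_iteratedFDeriv, h1]
  simp [taylorTerm, L]

theorem taylorTerm_congr {g₁ g₂ : Cn n → Cn n} (h : ∀ᶠ z in 𝓝 0, g₁ z = g₂ z) (k : ℕ) :
    taylorTerm g₁ k = taylorTerm g₂ k := by
  ext1
  funext z
  have h1 : iteratedFDeriv ℂ k g₁ 0 = iteratedFDeriv ℂ k g₂ 0 :=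
    (Filter.EventuallyEq.iteratedFDeriv ℂ (f₁ := g₁) (f₂ := g₂) h k).eq_of_nhds
  simp [taylorTerm, h1]

theorem taylorTerm_add {g₁ g₂ : Cn n → Cn n} (h₁ : DifferentiableOn ℂ g₁ (unitBall n))
    (h₂ : DifferentiableOn ℂ g₂ (unitBall n)) (k : ℕ) :
    taylorTerm (fun z => g₁ z + g₂ z) k = taylorTerm g₁ k + taylorTerm g₂ k := by
  ext1
  funext z
  have h : iteratedFDeriv ℂ k (fun z => g₁ z + g₂ z) 0 = _ :=
    iteratedFDeriv_add_apply (contDiffAt_zero h₁ k) (contDiffAt_zero h₂ k)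
  simp [taylorTerm, h]

theorem taylorTerm_clm {g : Cn n → Cn n} (hg : DifferentiableOn ℂ g (unitBall n))
    (L : Cn n →L[ℂ] Cn n) (k : ℕ) (z : Cn n) :
    (taylorTerm (fun z => L (g z)) k : Cn n → Cn n) z = L ((taylorTerm g k : Cn n → Cn n) z) := by
  have h : iteratedFDeriv ℂ k (fun z => L (g z)) 0 = _ :=
    L.iteratedFDeriv_comp_left (contDiffAt_zero hg k) le_rfl
  simp [taylorTerm, h]

theorem taylorTerm_sub {g₁ g₂ : Cn n → Cn n} (h₁ : DifferentiableOn ℂ g₁ (unitBall n))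
    (h₂ : DifferentiableOn ℂ g₂ (unitBall n)) (k : ℕ) :
    taylorTerm (fun z => g₁ z - g₂ z) k = taylorTerm g₁ k - taylorTerm g₂ k := by
  ext1
  funext z
  have h : iteratedFDeriv ℂ k (fun z => g₁ z - g₂ z) 0 = _ :=
    iteratedFDeriv_sub_apply (contDiffAt_zero h₁ k) (contDiffAt_zero h₂ k)
  simp [taylorTerm, h, smul_sub]

theorem taylorTerm_sum {ι : Type*} (s : Finset ι) {g : ι → Cn n → Cn n}
    (h : ∀ i ∈ s, DifferentiableOn ℂ (g i) (unitBall n)) (k : ℕ) :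
    taylorTerm (fun z => ∑ i ∈ s, g i z) k = ∑ i ∈ s, taylorTerm (g i) k := by
  classical
  induction s using Finset.induction_on with
  | empty =>
    ext1
    funext z
    have : iteratedFDeriv ℂ k (fun _ : Cn n => (0 : Cn n)) 0 = 0 := by
      simp
    simp [taylorTerm, this]
  | insert a s ha ih =>
    simp_rw [Finset.sum_insert ha]
    rw [taylorTerm_add (h a (Finset.mem_insert_self a s)), ih]
    · exact fun i hi => h i (Finset.mem_insert_of_mem hi)
    · exact DifferentiableOn.fun_sum fun i hi => h i (Finset.mem_insert_of_mem hi)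

theorem taylorTerm_homPoly {j : ℕ} (Q : HomPoly n j) (k : ℕ) (z : Cn n) :
    (taylorTerm (Q : Cn n → Cn n) k : Cn n → Cn n) z =
      if k = j then (Q : Cn n → Cn n) z else 0 := by
  rw [taylorTerm_apply (differentiable_homPoly Q).differentiableOn]
  simp_rw [homPoly_smul]
  rw [iteratedDeriv_smul_const (by fun_prop)]
  rw [iteratedDeriv_fun_pow_zero]
  split_ifs with h
  · subst h
    rw [smul_smul, inv_mul_cancel₀ (by exact_mod_cast k.factorial_ne_zero), one_smul]
  · simp

theorem taylorTerm_homPoly_self {j : ℕ} (Q : HomPoly n j) :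
    taylorTerm (Q : Cn n → Cn n) j = Q := by
  ext1; funext z; simp [taylorTerm_homPoly]

theorem taylorTerm_homPoly_of_ne {j k : ℕ} (Q : HomPoly n j) (h : k ≠ j) :
    taylorTerm (Q : Cn n → Cn n) k = 0 := by
  ext1; funext z; simp [taylorTerm_homPoly, h]

theorem differentiableOn_slice {g : Cn n → Cn n} {r : ℝ}
    (hg : DifferentiableOn ℂ g (ball 0 r)) {z : Cn n} (hz : z ≠ 0) :
    DifferentiableOn ℂ (fun ζ : ℂ => g (ζ • z)) (ball 0 (r / ‖z‖)) := by
  refine hg.comp (by fun_prop) fun ζ hζ => ?_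
  rw [mem_ball_zero_iff, lt_div_iff₀ (norm_pos_iff.2 hz)] at hζ
  rwa [mem_ball_zero_iff, norm_smul]

/-- Cauchy's estimate for the homogeneous terms. -/
theorem norm_taylorTerm_le {g : Cn n → Cn n} (hg : DifferentiableOn ℂ g (unitBall n)) {r M : ℝ}
    (hr : 0 < r) (hr1 : r < 1) (hM : ∀ z, ‖z‖ ≤ r → ‖g z‖ ≤ M) (k : ℕ) (z : Cn n) :
    ‖(taylorTerm g k : Cn n → Cn n) z‖ ≤ M * (‖z‖ / r) ^ k := by
  have hM0 : 0 ≤ M := (norm_nonneg _).trans (hM 0 (by simpa using hr.le))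
  rw [taylorTerm_apply hg]
  rcases eq_or_ne z 0 with rfl | hz
  · rcases k with _ | k
    · simpa using hM 0 (by simpa using hr.le)
    · simp [iteratedDeriv_const]
  have hz' := norm_pos_iff.2 hz
  have hd : DiffContOnCl ℂ (fun ζ : ℂ => g (ζ • z)) (ball 0 (r / ‖z‖)) := by
    refine (DifferentiableOn.diffContOnCl ?_)
    refine (differentiableOn_slice hg hz).mono ?_
    rw [closure_ball _ (by positivity)]
    exact closedBall_subset_ball (by gcongr)
  have := Complex.norm_iteratedDeriv_le_of_forall_mem_sphere_norm_le k (by positivity) hd (C := M)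
    (fun ζ hζ => hM _ (by
      rw [mem_sphere_zero_iff_norm] at hζ
      rw [norm_smul, hζ, div_mul_cancel₀ _ hz'.ne']))
  rw [norm_smul, norm_inv, Complex.norm_natCast]
  have hk : (0 : ℝ) < k ! := by exact_mod_cast k.factorial_pos
  calc _ ≤ (k ! : ℝ)⁻¹ * (k ! * M / (r / ‖z‖) ^ k) := by gcongr
    _ = M * (‖z‖ / r) ^ k := by
      rw [div_pow, div_pow]; field_simp

/-- Schwarz's lemma for a map whose homogeneous terms of degree `< N` vanish. -/
theorem norm_le_of_taylorTerm_eq_zero {g : Cn n → Cn n} (hg : DifferentiableOn ℂ g (unitBall n))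
    {r M : ℝ} (hr : 0 < r) (hr1 : r ≤ 1) (hM : ∀ z, ‖z‖ < r → ‖g z‖ ≤ M) {N : ℕ}
    (h0 : ∀ j < N, taylorTerm g j = 0) {z : Cn n} (hz : ‖z‖ < r) :
    ‖g z‖ ≤ M * (‖z‖ / r) ^ N := by
  rcases eq_or_ne z 0 with rfl | hz0
  · rcases N with _ | N
    · simpa using hM 0 (by simpa using hr)
    · have := congrArg (fun q : HomPoly n 0 => (q : Cn n → Cn n) 0) (h0 0 (Nat.succ_pos _))
      simp [taylorTerm] at this
      simp [this]
  have hz' := norm_pos_iff.2 hz0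
  -- The slice through `z` lives on the disc of radius `r / ‖z‖ > 1` and is evaluated at `1`.
  have h := norm_le_of_iteratedDeriv_eq_zero (R := r / ‖z‖) (M := M) (N := N) (ζ := 1)
    (by positivity) (differentiableOn_slice (hg.mono (ball_subset_ball hr1)) hz0)
    (fun ζ hζ => hM _ (by
      rw [mem_ball_zero_iff, lt_div_iff₀ hz'] at hζ
      rwa [norm_smul])) (fun j hj => by
        have := congrArg (fun q : HomPoly n j => (q : Cn n → Cn n) z) (h0 j hj)
        simp only [taylorTerm_apply hg] at this
        have hj0 : ((j ! : ℂ)⁻¹) ≠ 0 := inv_ne_zero (by exact_mod_cast j.factorial_ne_zero)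
        exact (smul_eq_zero_iff_right hj0).1 this)
    (by rw [mem_ball_zero_iff, norm_one, lt_div_iff₀ hz', one_mul]; exact hz)
  simpa [div_div_eq_mul_div] using h

theorem norm_homPoly_le {k : ℕ} (Q : HomPoly n k) :
    ∃ C, 0 ≤ C ∧ ∀ z, ‖(Q : Cn n → Cn n) z‖ ≤ C * ‖z‖ ^ k := by
  obtain ⟨_, M, rfl⟩ := Q
  exact ⟨‖M‖, norm_nonneg _, fun z => by simpa [diagonal] using M.le_opNorm (fun _ => z)⟩

/-- The Taylor formula with the remainder estimated by Schwarz's lemma. -/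
theorem norm_sub_sum_taylorTerm_le {g : Cn n → Cn n} (hg : DifferentiableOn ℂ g (unitBall n))
    {r M : ℝ} (hr : 0 < r) (hr1 : r < 1) (hM : ∀ z, ‖z‖ ≤ r → ‖g z‖ ≤ M) (N : ℕ) {z : Cn n}
    (hz : ‖z‖ < r) :
    ‖g z - ∑ j ∈ Finset.range N, (taylorTerm g j : Cn n → Cn n) z‖ ≤
      (M + N * M) * (‖z‖ / r) ^ N := by
  have hM0 : 0 ≤ M := (norm_nonneg _).trans (hM 0 (by simpa using hr.le))
  have hs : DifferentiableOn ℂ (fun z => ∑ j ∈ Finset.range N, (taylorTerm g j : Cn n → Cn n) z)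
      (unitBall n) :=
    DifferentiableOn.fun_sum fun j _ => (differentiable_homPoly _).differentiableOn
  refine norm_le_of_taylorTerm_eq_zero (hg.sub hs) hr hr1.le (fun w hw => ?_) (fun k hk => ?_) hz
  -- By Cauchy's estimate each of the `N` subtracted terms is at most `M` on the ball of radius `r`;
  -- hence `M + N * M`.
  · refine (norm_sub_le _ _).trans (add_le_add (hM w hw.le) ((norm_sum_le _ _).trans ?_))
    refine (Finset.sum_le_card_nsmul _ _ M fun j _ => ?_).trans (by simp)
    refine (norm_taylorTerm_le hg hr hr1 hM j w).trans ?_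
    refine mul_le_of_le_one_right hM0 (pow_le_one₀ (by positivity) ?_)
    rw [div_le_one hr]; exact hw.le
  · change taylorTerm (fun z => g z - ∑ j ∈ Finset.range N, (taylorTerm g j : Cn n → Cn n) z) k = 0
    rw [taylorTerm_sub hg hs, taylorTerm_sum _
      (fun j _ => (differentiable_homPoly _).differentiableOn), sub_eq_zero]
    rw [Finset.sum_eq_single_of_mem k (Finset.mem_range.2 hk), taylorTerm_homPoly_self]
    exact fun j _ hj => taylorTerm_homPoly_of_ne _ hj.symm

/-- A map that is `O(‖z‖ ^ N)` has no homogeneous terms of degree `< N`. -/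
theorem taylorTerm_eq_zero_of_norm_le {g : Cn n → Cn n} (hg : DifferentiableOn ℂ g (unitBall n))
    {r C : ℝ} (hr : 0 < r) {N : ℕ} (hC : ∀ z, ‖z‖ < r → ‖g z‖ ≤ C * ‖z‖ ^ N) {k : ℕ}
    (hk : k < N) : taylorTerm g k = 0 := by
  ext1
  funext z
  -- Cauchy's estimate on the ball of radius `ρ` gains the factor `ρ ^ (N - k)`, which tends to `0`
  -- with `ρ`.
  have hev : ∀ᶠ ρ : ℝ in 𝓝[>] 0, ‖(taylorTerm g k : Cn n → Cn n) z‖ ≤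
      (|C| * ‖z‖ ^ k) * ρ ^ (N - k) := by
    filter_upwards [self_mem_nhdsWithin, nhdsWithin_le_nhds (gt_mem_nhds hr),
      nhdsWithin_le_nhds (gt_mem_nhds one_pos)] with ρ hρ hρr hρ1
    have hρ : 0 < ρ := hρ
    refine (norm_taylorTerm_le hg hρ hρ1 (M := |C| * ρ ^ N) (fun w hw => ?_) k z).trans_eq ?_
    · refine (hC w (hw.trans_lt hρr)).trans ?_
      gcongr
      exact le_abs_self C
    · rw [div_pow]
      have : ρ ^ N = ρ ^ (N - k) * ρ ^ k := by rw [← pow_add]; congr 1; omega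
      rw [this]; field_simp
  have hlim : Tendsto (fun ρ : ℝ => (|C| * ‖z‖ ^ k) * ρ ^ (N - k)) (𝓝[>] 0) (𝓝 0) := by
    have : Continuous fun ρ : ℝ => (|C| * ‖z‖ ^ k) * ρ ^ (N - k) := by fun_prop
    have h0 := this.tendsto 0
    rw [zero_pow (by omega), mul_zero] at h0
    exact h0.mono_left nhdsWithin_le_nhds
  have := ge_of_tendsto hlim hev
  simpa using this

/-- Two holomorphic maps on the ball with the same homogeneous terms agree. -/
theorem eqOn_of_taylorTerm_eq {g₁ g₂ : Cn n → Cn n} (h₁ : DifferentiableOn ℂ g₁ (unitBall n))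
    (h₂ : DifferentiableOn ℂ g₂ (unitBall n)) (h : ∀ k, taylorTerm g₁ k = taylorTerm g₂ k) :
    EqOn g₁ g₂ (unitBall n) := by
  intro z hz
  rw [mem_unitBall] at hz
  obtain ⟨r, hzr, hr1⟩ := exists_between hz
  have hr : 0 < r := (norm_nonneg z).trans_lt hzr
  have hd := h₁.sub h₂
  obtain ⟨M, hM⟩ : ∃ M, ∀ w ∈ closedBall (0 : Cn n) r, ‖(g₁ - g₂) w‖ ≤ M :=
    (isCompact_closedBall 0 r).exists_bound_of_continuousOn
      (hd.continuousOn.mono (closedBall_subset_ball hr1))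
  have hle : ∀ N : ℕ, ‖(g₁ - g₂) z‖ ≤ M * (‖z‖ / r) ^ N := fun N =>
    norm_le_of_taylorTerm_eq_zero hd hr hr1.le
      (fun w hw => hM w (mem_closedBall_zero_iff.2 hw.le)) (fun j _ => by
        have := taylorTerm_sub h₁ h₂ j
        rw [h j, sub_self] at this
        exact this) hzr
  have hlim : Tendsto (fun N : ℕ => M * (‖z‖ / r) ^ N) atTop (𝓝 0) := by
    simpa using (tendsto_pow_atTop_nhds_zero_of_lt_one (by positivity)
      ((div_lt_one hr).2 hzr)).const_mul M
  have := ge_of_tendsto' hlim hle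
  rw [← sub_eq_zero]
  simpa using this

/-- Homogeneous terms converge along with a bounded pointwise convergent family. -/
theorem tendsto_taylorTerm_zero {ι : Type*} {l : Filter ι} {g : ι → Cn n → Cn n} {r M : ℝ}
    (hr : 0 < r) (hr1 : r < 1) (hg : ∀ᶠ i in l, DifferentiableOn ℂ (g i) (unitBall n))
    (hM : ∀ᶠ i in l, ∀ z, ‖z‖ ≤ r → ‖g i z‖ ≤ M)
    (hlim : ∀ z ∈ unitBall n, Tendsto (fun i => g i z) l (𝓝 0)) (k : ℕ) (z : Cn n) :
    Tendsto (fun i => (taylorTerm (g i) k : Cn n → Cn n) z) l (𝓝 0) := by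
  induction k using Nat.strong_induction_on with
  | _ k ih =>
  rw [Metric.tendsto_nhds]
  intro ε hε
  -- The term of degree `k` is recovered from the value at `η z` by removing the lower terms and
  -- dividing by `η ^ k`. The remainder is `O(η)` uniformly in `i`, so `η` is fixed before passing
  -- to the limit in `i`.
  obtain ⟨η, hη, hηz, hηε⟩ : ∃ η : ℝ, 0 < η ∧ η * ‖z‖ < r ∧
      (M + (k + 1 : ℕ) * M) * (‖z‖ / r) ^ (k + 1) * η < ε := by
    have h1 : Tendsto (fun η : ℝ => η * ‖z‖) (𝓝[>] 0) (𝓝 0) := by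
      have : Continuous fun η : ℝ => η * ‖z‖ := by fun_prop
      simpa using (this.tendsto 0).mono_left nhdsWithin_le_nhds
    have h2 : Tendsto (fun η : ℝ => (M + (k + 1 : ℕ) * M) * (‖z‖ / r) ^ (k + 1) * η)
        (𝓝[>] 0) (𝓝 0) := by
      have : Continuous fun η : ℝ => (M + (k + 1 : ℕ) * M) * (‖z‖ / r) ^ (k + 1) * η := by fun_prop
      simpa using (this.tendsto 0).mono_left nhdsWithin_le_nhds
    obtain ⟨η, h3, h4, h5⟩ := ((h1.eventually (gt_mem_nhds hr)).and
      ((h2.eventually (gt_mem_nhds hε)).and self_mem_nhdsWithin)).exists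
    exact ⟨η, h5, h3, h4⟩
  have hmem : (η : ℂ) • z ∈ unitBall n := by
    rw [mem_unitBall, norm_smul, Complex.norm_real, Real.norm_of_nonneg hη.le]; linarith
  have hsum : Tendsto (fun i => ((η : ℂ) ^ k)⁻¹ • (g i ((η : ℂ) • z) -
      ∑ j ∈ Finset.range k, (taylorTerm (g i) j : Cn n → Cn n) ((η : ℂ) • z))) l (𝓝 0) := by
    have h1 : Tendsto (fun i => ∑ j ∈ Finset.range k,
        (taylorTerm (g i) j : Cn n → Cn n) ((η : ℂ) • z)) l (𝓝 0) := by
      rw [← Finset.sum_const_zero (s := Finset.range k)]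
      refine tendsto_finsetSum _ fun j hj => ?_
      simp_rw [homPoly_smul]
      simpa using (ih j (Finset.mem_range.1 hj)).const_smul ((η : ℂ) ^ j)
    simpa using ((hlim _ hmem).sub h1).const_smul (((η : ℂ) ^ k)⁻¹)
  have hδ : 0 < ε - (M + (k + 1 : ℕ) * M) * (‖z‖ / r) ^ (k + 1) * η := by linarith
  filter_upwards [hg, hM, Metric.tendsto_nhds.1 hsum _ hδ] with i hgi hMi hi
  have hrem := norm_sub_sum_taylorTerm_le hgi hr hr1 hMi (k + 1) (z := (η : ℂ) • z) (by
    rwa [norm_smul, Complex.norm_real, Real.norm_of_nonneg hη.le])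
  rw [dist_zero_right] at hi ⊢
  have hηk : ((η : ℂ) ^ k) ≠ 0 := pow_ne_zero _ (by exact_mod_cast hη.ne')
  have heq : (taylorTerm (g i) k : Cn n → Cn n) z =
      ((η : ℂ) ^ k)⁻¹ • (g i ((η : ℂ) • z) -
        ∑ j ∈ Finset.range k, (taylorTerm (g i) j : Cn n → Cn n) ((η : ℂ) • z)) -
      ((η : ℂ) ^ k)⁻¹ • (g i ((η : ℂ) • z) -
        ∑ j ∈ Finset.range (k + 1), (taylorTerm (g i) j : Cn n → Cn n) ((η : ℂ) • z)) := by
    rw [← smul_sub, Finset.sum_range_succ, sub_sub_sub_cancel_left, add_sub_cancel_left,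
      homPoly_smul, smul_smul, inv_mul_cancel₀ hηk, one_smul]
  rw [heq]
  refine (norm_sub_le _ _).trans_lt ?_
  have h2 : ‖((η : ℂ) ^ k)⁻¹ • (g i ((η : ℂ) • z) -
        ∑ j ∈ Finset.range (k + 1), (taylorTerm (g i) j : Cn n → Cn n) ((η : ℂ) • z))‖ ≤
      (M + (k + 1 : ℕ) * M) * (‖z‖ / r) ^ (k + 1) * η := by
    rw [norm_smul, norm_inv, norm_pow, Complex.norm_real, Real.norm_of_nonneg hη.le]
    calc _ ≤ (η ^ k)⁻¹ * ((M + (k + 1 : ℕ) * M) * (‖(η : ℂ) • z‖ / r) ^ (k + 1)) := by gcongr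
      _ = _ := by
        rw [norm_smul, Complex.norm_real, Real.norm_of_nonneg hη.le, mul_div_assoc, mul_pow]
        field_simp
        ring
  linarith

end Taylor

/-! ### Almost everywhere differential inequalities for absolutely continuous functions -/

section AbsolutelyContinuous

variable {F : Type*} [NormedAddCommGroup F] [NormedSpace ℝ F]

theorem lipschitz_comp_absolutelyContinuous {X Y : Type*} [PseudoMetricSpace X]
    [PseudoMetricSpace Y] {g : X → Y} {K : ℝ≥0} (hg : LipschitzWith K g) {u : ℝ → X} {a b : ℝ}
    (hu : AbsolutelyContinuousOnInterval u a b) :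
    AbsolutelyContinuousOnInterval (fun x => g (u x)) a b := by
  rw [absolutelyContinuousOnInterval_iff] at hu ⊢
  intro ε hε
  obtain ⟨δ, hδ, h⟩ := hu (ε / (K + 1)) (by positivity)
  refine ⟨δ, hδ, fun I hI hI' => ?_⟩
  calc _ ≤ ∑ i ∈ Finset.range I.1, (K + 1) * dist (u (I.2 i).1) (u (I.2 i).2) := by
        refine Finset.sum_le_sum fun i _ => (hg.dist_le_mul _ _).trans ?_
        gcongr
        simp
    _ < ε := by
      rw [← Finset.mul_sum]
      have := h I hI hI'
      rw [lt_div_iff₀ (by positivity)] at this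
      linarith

theorem le_of_ae_hasDerivAt_nonneg {f f' : ℝ → ℝ} {a b : ℝ} (hab : a ≤ b)
    (hf : AbsolutelyContinuousOnInterval f a b)
    (hf' : ∀ᵐ x, x ∈ Ioo a b → HasDerivAt f (f' x) x ∧ 0 ≤ f' x) : f a ≤ f b := by
  have h := hf.integral_deriv_eq_sub
  have h0 : 0 ≤ ∫ x in a..b, deriv f x := by
    refine intervalIntegral.integral_nonneg_of_ae_restrict hab ?_
    have h1 : ∀ᵐ x ∂(volume.restrict (Ioo a b)), 0 ≤ deriv f x := by
      rw [ae_restrict_iff' measurableSet_Ioo]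
      filter_upwards [hf'] with x hx hxab
      rw [(hx hxab).1.deriv]
      exact (hx hxab).2
    rwa [Measure.restrict_congr_set Ioo_ae_eq_Icc] at h1
  linarith

/-- Testing with a functional that norms the increment `u b - u a` reduces this mean value
inequality to the monotonicity of a scalar function. -/
theorem norm_sub_le_of_ae_hasDerivAt {u u' : ℝ → F} {B B' : ℝ → ℝ} {a b : ℝ} (hab : a ≤ b)
    (hu : AbsolutelyContinuousOnInterval u a b) (hB : AbsolutelyContinuousOnInterval B a b)
    (h : ∀ᵐ x, x ∈ Ioo a b → HasDerivAt u (u' x) x ∧ HasDerivAt B (B' x) x ∧ ‖u' x‖ ≤ B' x) :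
    ‖u b - u a‖ ≤ B b - B a := by
  obtain ⟨g, hg, hgu⟩ := exists_dual_vector'' ℝ (u b - u a)
  have hgac : AbsolutelyContinuousOnInterval (fun x => g (u x)) a b :=
    lipschitz_comp_absolutelyContinuous g.lipschitz hu
  have := le_of_ae_hasDerivAt_nonneg (f := fun x => B x - g (u x)) (f' := fun x => B' x - g (u' x))
    hab (hB.sub hgac) (by
      filter_upwards [h] with x hx hxab
      obtain ⟨h1, h2, h3⟩ := hx hxab
      refine ⟨h2.sub (g.hasFDerivAt.comp_hasDerivAt x h1), ?_⟩
      have : g (u' x) ≤ ‖u' x‖ := by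
        refine (le_abs_self _).trans ((g.le_opNorm _).trans ?_)
        exact mul_le_of_le_one_left (norm_nonneg _) hg
      linarith)
  have h2 : g (u b) - g (u a) = ‖u b - u a‖ := by rw [← map_sub]; exact hgu
  linarith

/-- Gronwall's inequality for absolutely continuous functions. -/
theorem le_mul_exp_of_ae_hasDerivAt_le {u u' A A' : ℝ → ℝ} {a b : ℝ} (hab : a ≤ b)
    (hu : AbsolutelyContinuousOnInterval u a b) (hA : ContDiff ℝ 1 A)
    (hA' : ∀ x, HasDerivAt A (A' x) x)
    (h : ∀ᵐ x, x ∈ Ioo a b → HasDerivAt u (u' x) x ∧ u' x ≤ A' x * u x) :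
    u b ≤ u a * Real.exp (A b - A a) := by
  have hexp : AbsolutelyContinuousOnInterval (fun x => Real.exp (-A x)) a b :=
    ContDiffOn.absolutelyContinuousOnInterval (by fun_prop)
  have := le_of_ae_hasDerivAt_nonneg (f := fun x => -(Real.exp (-A x) • u x))
    (f' := fun x => -(Real.exp (-A x) • u' x + (Real.exp (-A x) * -A' x) • u x)) hab
    (hexp.smul hu).neg (by
      filter_upwards [h] with x hx hxab
      obtain ⟨h1, h2⟩ := hx hxab
      refine ⟨((hA' x).neg.exp.smul h1).neg, ?_⟩
      have := Real.exp_pos (-A x)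
      simp only [smul_eq_mul]
      nlinarith)
  simp only [smul_eq_mul] at this
  rw [Real.exp_sub]
  have hpos := Real.exp_pos (-A b)
  have h3 : Real.exp (-A b) * u b ≤ Real.exp (-A a) * u a := by linarith
  rw [Real.exp_neg, Real.exp_neg, inv_mul_le_iff₀ (Real.exp_pos _)] at h3
  refine h3.trans_eq ?_
  field_simp

end AbsolutelyContinuous

/-! ### Lipschitz functions on intervals: a class closed under products and compositions that
implies absolute continuity -/

section LipschitzOnInterval

variable {F : Type*} [NormedAddCommGroup F]

/-- The function `u` is Lipschitz continuous on `[a, b]`. -/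
def LipOn (u : ℝ → F) (a b : ℝ) : Prop := ∃ K : ℝ≥0, LipschitzOnWith K u (Icc a b)

theorem LipOn.absolutelyContinuous {u : ℝ → F} {a b : ℝ} (hab : a ≤ b) (h : LipOn u a b) :
    AbsolutelyContinuousOnInterval u a b := by
  obtain ⟨K, hK⟩ := h
  rw [← uIcc_of_le hab] at hK
  exact hK.absolutelyContinuousOnInterval

theorem LipOn.mono {u : ℝ → F} {a b c d : ℝ} (h : LipOn u a b) (hs : Icc c d ⊆ Icc a b) :
    LipOn u c d := by
  obtain ⟨K, hK⟩ := h
  exact ⟨K, hK.mono hs⟩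

theorem LipOn.of_dist_le {u : ℝ → F} {a b C : ℝ}
    (h : ∀ x ∈ Icc a b, ∀ y ∈ Icc a b, x ≤ y → ‖u y - u x‖ ≤ C * (y - x)) : LipOn u a b := by
  refine ⟨Real.toNNReal |C|, LipschitzOnWith.of_dist_le_mul fun x hx y hy => ?_⟩
  rw [Real.coe_toNNReal _ (abs_nonneg _)]
  wlog hxy : x ≤ y generalizing x y
  · rw [dist_comm, dist_comm x y]
    exact this y hy x hx (le_of_not_ge hxy)
  rw [dist_comm, dist_eq_norm, dist_comm, Real.dist_eq, abs_of_nonneg (sub_nonneg.2 hxy)]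
  exact (h x hx y hy hxy).trans (mul_le_mul_of_nonneg_right (le_abs_self C) (sub_nonneg.2 hxy))

theorem LipOn.exists_bound {u : ℝ → F} {a b : ℝ} (h : LipOn u a b) :
    ∃ C, 0 ≤ C ∧ ∀ x ∈ Icc a b, ‖u x‖ ≤ C := by
  obtain ⟨K, hK⟩ := h
  obtain ⟨C, hC⟩ := isCompact_Icc.exists_bound_of_continuousOn hK.continuousOn
  exact ⟨max C 0, le_max_right _ _, fun x hx => (hC x hx).trans (le_max_left _ _)⟩

theorem LipOn.exists_const {u : ℝ → F} {a b : ℝ} (h : LipOn u a b) :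
    ∃ C, 0 ≤ C ∧ ∀ x ∈ Icc a b, ∀ y ∈ Icc a b, x ≤ y → ‖u y - u x‖ ≤ C * (y - x) := by
  obtain ⟨K, hK⟩ := h
  refine ⟨K, K.2, fun x hx y hy hxy => ?_⟩
  have := hK.dist_le_mul y hy x hx
  rwa [dist_eq_norm, Real.dist_eq, abs_of_nonneg (sub_nonneg.2 hxy)] at this

theorem LipOn.bilinear {E G : Type*} [NormedAddCommGroup E] [NormedSpace ℝ E] [NormedSpace ℝ F]
    [NormedAddCommGroup G] [NormedSpace ℝ G] (L : E →L[ℝ] F →L[ℝ] G) {u : ℝ → E} {v : ℝ → F} {a b : ℝ}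
    (hu : LipOn u a b) (hv : LipOn v a b) : LipOn (fun x => L (u x) (v x)) a b := by
  obtain ⟨Cu, hCu, hbu⟩ := hu.exists_bound
  obtain ⟨Cv, hCv, hbv⟩ := hv.exists_bound
  obtain ⟨Ku, hKu, hlu⟩ := hu.exists_const
  obtain ⟨Kv, hKv, hlv⟩ := hv.exists_const
  refine LipOn.of_dist_le (C := ‖L‖ * Ku * Cv + ‖L‖ * Cu * Kv) fun x hx y hy hxy => ?_
  have h1 : L (u y) (v y) - L (u x) (v x) = L (u y - u x) (v y) + L (u x) (v y - v x) := by
    simp [map_sub]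
  have hd : 0 ≤ y - x := sub_nonneg.2 hxy
  rw [h1]
  calc _ ≤ ‖L‖ * ‖u y - u x‖ * ‖v y‖ + ‖L‖ * ‖u x‖ * ‖v y - v x‖ :=
        (norm_add_le _ _).trans (add_le_add (L.le_opNorm₂ _ _) (L.le_opNorm₂ _ _))
    _ ≤ ‖L‖ * (Ku * (y - x)) * Cv + ‖L‖ * Cu * (Kv * (y - x)) := by
      gcongr
      · exact hlu x hx y hy hxy
      · exact hbv y hy
      · exact hbu x hx
      · exact hlv x hx y hy hxy
    _ = _ := by ring

theorem LipOn.add {u v : ℝ → F} {a b : ℝ} (hu : LipOn u a b) (hv : LipOn v a b) :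
    LipOn (fun x => u x + v x) a b := by
  obtain ⟨K, hK⟩ := hu
  obtain ⟨K', hK'⟩ := hv
  exact ⟨K + K', hK.add hK'⟩

theorem LipOn.sub {u v : ℝ → F} {a b : ℝ} (hu : LipOn u a b) (hv : LipOn v a b) :
    LipOn (fun x => u x - v x) a b := by
  obtain ⟨K, hK⟩ := hu
  obtain ⟨K', hK'⟩ := hv
  exact ⟨K + K', hK.sub hK'⟩

theorem LipOn.const (c : F) (a b : ℝ) : LipOn (fun _ => c) a b :=
  ⟨0, (LipschitzWith.const c).lipschitzOnWith⟩

theorem LipOn.sum {ι : Type*} (s : Finset ι) {u : ι → ℝ → F} {a b : ℝ}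
    (h : ∀ i ∈ s, LipOn (u i) a b) : LipOn (fun x => ∑ i ∈ s, u i x) a b := by
  classical
  induction s using Finset.induction_on with
  | empty => simpa using LipOn.const 0 a b
  | insert i s hi ih =>
    simp_rw [Finset.sum_insert hi]
    exact (h i (Finset.mem_insert_self i s)).add
      (ih fun j hj => h j (Finset.mem_insert_of_mem hj))

theorem LipOn.of_contDiff [NormedSpace ℝ F] {u : ℝ → F} (hu : ContDiff ℝ 1 u) (a b : ℝ) : LipOn u a b :=
  hu.contDiffOn.exists_lipschitzOnWith (by decide) (convex_Icc a b) isCompact_Icc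

theorem LipOn.comp_lipschitzOn {X : Type*} [NormedAddCommGroup X] {q : F → X}
    {s : Set F} {K : ℝ≥0} (hq : LipschitzOnWith K q s)
    {u : ℝ → F} {a b : ℝ} (hu : LipOn u a b) (hs : ∀ x ∈ Icc a b, u x ∈ s) :
    LipOn (fun x => q (u x)) a b := by
  obtain ⟨K', hK'⟩ := hu
  exact ⟨K * K', hq.comp hK' hs⟩

end LipschitzOnInterval

/-! ### Distortion of functions with positive real part -/

section PositiveRealPart

/-- The distortion estimates for holomorphic functions with positive real part on the unit disc. -/
theorem distortion_of_re_pos {p : ℂ → ℂ} (hp : DifferentiableOn ℂ p (ball 0 1))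
    (hpos : ∀ ζ ∈ ball (0 : ℂ) 1, 0 < (p ζ).re) {ζ : ℂ} (hζ : ζ ∈ ball 0 1) :
    (p 0).re * (1 - ‖ζ‖) ≤ (p ζ).re * (1 + ‖ζ‖) ∧ ‖p ζ‖ * (1 - ‖ζ‖) ≤ ‖p 0‖ * (1 + ‖ζ‖) := by
  have h0 := hpos 0 (mem_ball_self one_pos)
  set c := p 0 with hc
  have hden : ∀ w ∈ ball (0 : ℂ) 1, p w + (starRingEnd ℂ) c ≠ 0 := fun w hw h => by
    have := congrArg Complex.re h
    simp at this
    linarith [hpos w hw]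
  -- The Cayley transform of `p` sends the disc to the disc and `0` to `0`, so Schwarz's lemma gives
  -- `‖κ ζ‖ ≤ ‖ζ‖`.
  set κ : ℂ → ℂ := fun w => (p w - c) / (p w + (starRingEnd ℂ) c) with hκ
  have hκd : DifferentiableOn ℂ κ (ball 0 1) :=
    (hp.sub_const c).div (hp.add_const _) hden
  have hκ1 : ∀ w ∈ ball (0 : ℂ) 1, ‖κ w‖ ≤ 1 := fun w hw => by
    rw [hκ]
    simp only [norm_div]
    rw [div_le_one (norm_pos_iff.2 (hden w hw)), ← sq_le_sq₀ (norm_nonneg _) (norm_nonneg _),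
      Complex.sq_norm, Complex.sq_norm, Complex.normSq_apply, Complex.normSq_apply]
    have h1 := hpos w hw
    simp
    nlinarith
  have hκ0 : κ 0 = 0 := by simp [hκ, ← hc]
  have hκζ : ‖κ ζ‖ ≤ ‖ζ‖ :=
    Complex.norm_le_norm_of_mapsTo_ball hκd (fun w hw => by simpa using hκ1 w hw) hκ0
      (mem_ball_zero_iff.1 hζ)
  have hζ1 : ‖ζ‖ < 1 := mem_ball_zero_iff.1 hζ
  -- Solving back for `p`: both estimates are read off from `p = (c + κ c̄) / (1 - κ)`.
  have heq : p ζ * (1 - κ ζ) = c + κ ζ * (starRingEnd ℂ) c := by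
    have : κ ζ * (p ζ + (starRingEnd ℂ) c) = p ζ - c := div_mul_cancel₀ _ (hden ζ hζ)
    linear_combination -this
  constructor
  · have hre : (p ζ).re * Complex.normSq (1 - κ ζ) = c.re * (1 - Complex.normSq (κ ζ)) := by
      have h2 := congrArg (fun x : ℂ => (x * (starRingEnd ℂ) (1 - κ ζ)).re) heq
      simp [Complex.normSq_apply] at h2 ⊢
      linear_combination h2
    rw [← Complex.sq_norm, ← Complex.sq_norm] at hre
    have h3 : ‖1 - κ ζ‖ ≤ 1 + ‖κ ζ‖ := by simpa using norm_sub_le (1 : ℂ) (κ ζ)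
    have h4 := hpos ζ hζ
    have h5 : ‖1 - κ ζ‖ ^ 2 ≤ (1 + ‖κ ζ‖) ^ 2 := by gcongr
    have h6 : c.re * (1 - ‖κ ζ‖) * (1 + ‖κ ζ‖) ≤ (p ζ).re * (1 + ‖κ ζ‖) * (1 + ‖κ ζ‖) := by
      nlinarith
    have h7 := le_of_mul_le_mul_right h6 (by positivity)
    nlinarith
  · have h2 := congrArg norm heq
    rw [norm_mul] at h2
    have h3 : 1 - ‖κ ζ‖ ≤ ‖1 - κ ζ‖ := by simpa using norm_sub_norm_le (1 : ℂ) (κ ζ)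
    have h4 : ‖c + κ ζ * (starRingEnd ℂ) c‖ ≤ ‖c‖ + ‖κ ζ‖ * ‖c‖ := by
      refine (norm_add_le _ _).trans_eq ?_
      rw [norm_mul, RCLike.norm_conj]
    have h5 := norm_nonneg (p ζ)
    have h6 := norm_nonneg c
    nlinarith

end PositiveRealPart

/-! ### Uniform estimates for the class `𝒩_A` -/

section Generator

variable {n : ℕ} {A : Cn n →L[ℂ] Cn n}

theorem lowerIndex_le {u : Cn n} (hu : ‖u‖ = 1) : lowerIndex A ≤ (inner ℂ u (A u)).re := by
  refine csInf_le ⟨-‖A‖, ?_⟩ ⟨u, by simpa using hu, rfl⟩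
  rintro _ ⟨z, hz, rfl⟩
  have hz : ‖z‖ = 1 := by simpa using hz
  have h1 : |(inner ℂ z (A z)).re| ≤ ‖A‖ := by
    refine (Complex.abs_re_le_norm _).trans ((norm_inner_le_norm _ _).trans ?_)
    have := A.le_opNorm z
    rw [hz] at this ⊢
    linarith
  exact (abs_le.1 h1).1

variable {g : Cn n → Cn n}

/-- Dividing `Re ⟨ε w, g(ε w)⟩ > 0` by `ε` and letting `ε → 0` gives `Re ⟨w, g 0⟩ ≥ 0` for all `w`;
the choice `w = -g 0` forces `g 0 = 0`. -/
theorem IsInN.map_zero (hg : IsInN A g) : g 0 = 0 := by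
  have hcont : ContinuousAt g 0 := hg.holomorphic.continuousOn.continuousAt unitBall_mem_nhds
  have key : ∀ w : Cn n, 0 ≤ (inner ℂ w (g 0)).re := fun w => by
    rcases eq_or_ne w 0 with rfl | hw
    · simp
    have hlim : Tendsto (fun ε : ℝ => (inner ℂ w (g ((ε : ℂ) • w))).re) (𝓝[>] 0)
        (𝓝 (inner ℂ w (g 0)).re) := by
      have h1 : Tendsto (fun ε : ℝ => (ε : ℂ) • w) (𝓝[>] 0) (𝓝 0) := by
        have : Continuous fun ε : ℝ => (ε : ℂ) • w := by fun_prop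
        simpa using (this.tendsto 0).mono_left nhdsWithin_le_nhds
      have h2 := (hcont.tendsto.comp h1)
      have h3 : Continuous fun x : Cn n => (inner ℂ w x).re := by fun_prop
      exact (h3.tendsto _).comp h2
    refine ge_of_tendsto hlim ?_
    have h4 : Tendsto (fun ε : ℝ => ε * ‖w‖) (𝓝[>] 0) (𝓝 0) := by
      have : Continuous fun ε : ℝ => ε * ‖w‖ := by fun_prop
      simpa using (this.tendsto 0).mono_left nhdsWithin_le_nhds
    filter_upwards [self_mem_nhdsWithin, h4.eventually (gt_mem_nhds one_pos)] with ε hε hε1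
    have hε : 0 < ε := hε
    have h5 := hg.re_pos ((ε : ℂ) • w) (by
      rw [mem_unitBall, norm_smul, Complex.norm_real, Real.norm_of_nonneg hε.le]; exact hε1)
      (smul_ne_zero (by exact_mod_cast hε.ne') hw)
    rw [inner_smul_left, Complex.conj_ofReal, Complex.re_ofReal_mul] at h5
    exact (pos_of_mul_pos_right h5 hε.le).le
  have h := key (-g 0)
  rw [inner_neg_left, Complex.neg_re] at h
  have h2 : (inner ℂ (g 0) (g 0)).re = ‖g 0‖ ^ 2 := by
    rw [inner_self_eq_norm_sq_to_K]; norm_cast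
  rw [h2] at h
  have : ‖g 0‖ = 0 := by nlinarith [norm_nonneg (g 0)]
  exact norm_eq_zero.1 this

/-- For a unit vector `u` the slice function `⟨u, g(ζ u)⟩ / ζ` has positive real part on the disc
and the value `⟨u, A u⟩` at `0`, so the distortion estimates apply to it. -/
theorem IsInN.inner_estimates (hA : 0 < lowerIndex A) (hg : IsInN A g) {z : Cn n}
    (hz : z ∈ unitBall n) :
    lowerIndex A * ‖z‖ ^ 2 * (1 - ‖z‖) ≤ (inner ℂ z (g z)).re * (1 + ‖z‖) ∧
      ‖inner ℂ z (g z)‖ * (1 - ‖z‖) ≤ ‖A‖ * ‖z‖ ^ 2 * (1 + ‖z‖) := by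
  rcases eq_or_ne z 0 with rfl | hz0
  · simp
  have hz1 : ‖z‖ < 1 := mem_unitBall.1 hz
  have hzp : 0 < ‖z‖ := norm_pos_iff.2 hz0
  set u : Cn n := ((‖z‖⁻¹ : ℝ) : ℂ) • z with hu
  have hu1 : ‖u‖ = 1 := by
    rw [hu, norm_smul, Complex.norm_real, norm_inv, norm_norm, inv_mul_cancel₀ hzp.ne']
  have hmem : ∀ ζ ∈ ball (0 : ℂ) 1, ζ • u ∈ unitBall n := fun ζ hζ => by
    rw [mem_unitBall, norm_smul, hu1, mul_one]; exact mem_ball_zero_iff.1 hζ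
  set q : ℂ → ℂ := fun ζ => inner ℂ u (g (ζ • u)) with hq
  have hqd : DifferentiableOn ℂ q (ball 0 1) := by
    have h1 : DifferentiableOn ℂ (fun ζ : ℂ => g (ζ • u)) (ball 0 1) :=
      hg.holomorphic.comp (by fun_prop) hmem
    exact (innerSL ℂ u).differentiable.comp_differentiableOn h1
  have hq0 : q 0 = 0 := by simp [hq, hg.map_zero]
  have hderiv : deriv q 0 = inner ℂ u (A u) := by
    have h1 : HasFDerivAt g A 0 := by
      have := (hg.holomorphic.differentiableAt unitBall_mem_nhds).hasFDerivAt
      rwa [hg.fderiv_zero] at this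
    have h2 : HasDerivAt (fun ζ : ℂ => ζ • u) u 0 := by
      simpa using (hasDerivAt_id (0 : ℂ)).smul_const u
    have h3 : HasDerivAt (fun ζ : ℂ => g (ζ • u)) (A u) 0 := by
      refine HasFDerivAt.comp_hasDerivAt (0 : ℂ) (f := fun ζ : ℂ => ζ • u) ?_ h2
      simpa using h1
    exact ((innerSL ℂ u).hasFDerivAt.comp_hasDerivAt (0 : ℂ) h3).deriv
  set p : ℂ → ℂ := dslope q 0 with hp
  have hpd : DifferentiableOn ℂ p (ball 0 1) :=
    (Complex.differentiableOn_dslope (ball_mem_nhds 0 one_pos)).2 hqd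
  have hp0 : p 0 = inner ℂ u (A u) := by rw [hp, dslope_same, hderiv]
  have hinner : ∀ ζ ∈ ball (0 : ℂ) 1, inner ℂ (ζ • u) (g (ζ • u)) = (‖ζ‖ ^ 2 : ℝ) * p ζ := by
    intro ζ hζ
    rcases eq_or_ne ζ 0 with rfl | hζ0
    · simp
    rw [hp, dslope_of_ne _ hζ0, slope_def_field, hq0, sub_zero, sub_zero, inner_smul_left]
    have : ((‖ζ‖ ^ 2 : ℝ) : ℂ) = (starRingEnd ℂ) ζ * ζ := by
      rw [← Complex.normSq_eq_conj_mul_self, Complex.normSq_eq_norm_sq]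
    rw [this]
    field_simp
    rfl
  have hpos : ∀ ζ ∈ ball (0 : ℂ) 1, 0 < (p ζ).re := fun ζ hζ => by
    rcases eq_or_ne ζ 0 with rfl | hζ0
    · rw [hp0]; exact hA.trans_le (lowerIndex_le hu1)
    have h1 := hg.re_pos _ (hmem ζ hζ) (smul_ne_zero hζ0 (by
      rw [← norm_pos_iff, hu1]; exact one_pos))
    rw [hinner ζ hζ, Complex.re_ofReal_mul] at h1
    exact pos_of_mul_pos_right h1 (by positivity)
  have hζ : ((‖z‖ : ℝ) : ℂ) ∈ ball (0 : ℂ) 1 := by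
    rw [mem_ball_zero_iff, Complex.norm_real, norm_norm]; exact hz1
  obtain ⟨h1, h2⟩ := distortion_of_re_pos hpd hpos hζ
  have hzu : ((‖z‖ : ℝ) : ℂ) • u = z := by
    rw [hu, smul_smul, ← Complex.ofReal_mul, mul_inv_cancel₀ hzp.ne', Complex.ofReal_one, one_smul]
  have h3 := hinner _ hζ
  rw [hzu, Complex.norm_real, norm_norm] at h3
  rw [Complex.norm_real, norm_norm, hp0] at h1 h2
  have h4 : ‖inner ℂ u (A u)‖ ≤ ‖A‖ := by
    refine (norm_inner_le_norm _ _).trans ?_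
    have := A.le_opNorm u
    rw [hu1] at this ⊢
    linarith
  have h5 := lowerIndex_le (A := A) hu1
  have h6 : 0 < 1 - ‖z‖ := by linarith
  have h7 : 0 < ‖z‖ ^ 2 := by positivity
  rw [h3, Complex.re_ofReal_mul, norm_mul, Complex.norm_real, Real.norm_of_nonneg h7.le]
  constructor
  · have : lowerIndex A * (1 - ‖z‖) ≤ (inner ℂ u (A u)).re * (1 - ‖z‖) := by gcongr
    nlinarith
  · have : ‖inner ℂ u (A u)‖ * (1 + ‖z‖) ≤ ‖A‖ * (1 + ‖z‖) := by gcongr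
    nlinarith

/-- The maps of the class `𝒩_A` are locally uniformly bounded. -/
theorem exists_bound_isInN (hA : 0 < lowerIndex A) {r : ℝ} (hr : r < 1) :
    ∃ C, 0 ≤ C ∧ ∀ g, IsInN A g → ∀ z, ‖z‖ ≤ r → ‖g z‖ ≤ C := by
  rcases lt_or_ge r 0 with hr0 | hr0
  · exact ⟨0, le_rfl, fun g _ z hz => absurd (norm_nonneg z) (by linarith)⟩
  set ρ : ℝ := (1 - r) / 2 with hρ
  have hρ0 : 0 < ρ := by rw [hρ]; linarith
  set M : ℝ := ‖A‖ * 2 / ρ with hM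
  have hM0 : 0 ≤ M := by positivity
  refine ⟨M / ρ, by positivity, fun g hg z hz => ?_⟩
  have hnum : ∀ w : Cn n, ‖w‖ ≤ r + ρ → ‖inner ℂ w (g w)‖ ≤ M := fun w hw => by
    have hw1 : ‖w‖ ≤ 1 - ρ := by rw [hρ] at hw ⊢; linarith
    have h1 := (hg.inner_estimates hA (z := w) (by rw [mem_unitBall]; linarith)).2
    rw [hM, le_div_iff₀ hρ0]
    have h2 : ‖w‖ ^ 2 * (1 + ‖w‖) ≤ 2 := by
      have h3 : ‖w‖ ^ 2 ≤ 1 := by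
        apply pow_le_one₀ (norm_nonneg _); linarith
      nlinarith [norm_nonneg w]
    calc ‖inner ℂ w (g w)‖ * ρ ≤ ‖inner ℂ w (g w)‖ * (1 - ‖w‖) := by gcongr; linarith
      _ ≤ ‖A‖ * (‖w‖ ^ 2 * (1 + ‖w‖)) := by linarith
      _ ≤ ‖A‖ * 2 := by gcongr
  rcases eq_or_ne (g z) 0 with h0 | h0
  · rw [h0, norm_zero]; positivity
  have hgz : 0 < ‖g z‖ := norm_pos_iff.2 h0
  set w : Cn n := ((‖g z‖⁻¹ : ℝ) : ℂ) • g z with hw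
  have hw1 : ‖w‖ = 1 := by
    rw [hw, norm_smul, Complex.norm_real, norm_inv, norm_norm, inv_mul_cancel₀ hgz.ne']
  have hnorm : ∀ ζ : ℂ, ‖ζ‖ ≤ ρ → ‖z + ζ • w‖ ≤ r + ρ := fun ζ hζ => by
    refine (norm_add_le _ _).trans ?_
    rw [norm_smul, hw1]; linarith
  -- A bound for `⟨x, g x⟩` must be converted into one for `‖g z‖`. On `‖ζ‖ = ρ` one has `ζ ζ̄ =
  -- ρ²`, so there `ψ` agrees with `ζ ⟨z + ζ w, g(z + ζ w)⟩`. But `ψ` is holomorphic, and by the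
  -- maximum principle the bound passes to `ψ 0 = ρ² ‖g z‖`.
  set ψ : ℂ → ℂ := fun ζ =>
    ζ * inner ℂ z (g (z + ζ • w)) + (ρ ^ 2 : ℝ) * inner ℂ w (g (z + ζ • w)) with hψ
  have hgd : DifferentiableOn ℂ (fun ζ : ℂ => g (z + ζ • w)) (closedBall 0 ρ) := by
    refine hg.holomorphic.comp (by fun_prop) fun ζ hζ => ?_
    have := hnorm ζ (mem_closedBall_zero_iff.1 hζ)
    rw [mem_unitBall]
    rw [hρ] at this; linarith
  have hψd : DifferentiableOn ℂ ψ (closedBall 0 ρ) := by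
    refine DifferentiableOn.add (differentiableOn_id.mul ?_) (DifferentiableOn.const_mul ?_ _)
    · exact (innerSL ℂ z).differentiable.comp_differentiableOn hgd
    · exact (innerSL ℂ w).differentiable.comp_differentiableOn hgd
  have hbd : ∀ ζ ∈ frontier (ball (0 : ℂ) ρ), ‖ψ ζ‖ ≤ ρ * M := fun ζ hζ => by
    rw [frontier_ball _ hρ0.ne', mem_sphere_zero_iff_norm] at hζ
    have h1 : ψ ζ = ζ * inner ℂ (z + ζ • w) (g (z + ζ • w)) := by
      rw [inner_add_left, inner_smul_left, mul_add, ← mul_assoc ζ ((starRingEnd ℂ) ζ),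
        Complex.mul_conj, Complex.normSq_eq_norm_sq, hζ]
    rw [h1, norm_mul, hζ]
    gcongr
    exact hnum _ (hnorm ζ hζ.le)
  have h1 := Complex.norm_le_of_forall_mem_frontier_norm_le isBounded_ball
    (DifferentiableOn.diffContOnCl (by rwa [closure_ball _ hρ0.ne'])) hbd
    (subset_closure (mem_ball_self hρ0))
  have h2 : ψ 0 = (ρ ^ 2 * ‖g z‖ : ℝ) := by
    simp only [hψ, zero_mul, zero_smul, add_zero, zero_add]
    rw [hw, inner_smul_left, inner_self_eq_norm_sq_to_K, Complex.conj_ofReal]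
    have : (‖g z‖ : ℂ) ≠ 0 := by exact_mod_cast hgz.ne'
    push_cast
    field_simp
    simp
  rw [h2, Complex.norm_real, Real.norm_of_nonneg (by positivity)] at h1
  rw [le_div_iff₀ hρ0]
  nlinarith

/-- Mean value inequality on the closed ball of radius `r`, with the derivative bounded by Cauchy's
estimate on balls of radius `r' - r`. -/
theorem norm_sub_le_of_bounded {g : Cn n → Cn n} (hg : DifferentiableOn ℂ g (unitBall n))
    {r r' M : ℝ} (hrr' : r < r') (hr' : r' ≤ 1) (hM : ∀ z, ‖z‖ < r' → ‖g z‖ ≤ M) {z w : Cn n}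
    (hz : ‖z‖ ≤ r) (hw : ‖w‖ ≤ r) : ‖g z - g w‖ ≤ 2 * M / (r' - r) * ‖z - w‖ := by
  have hpos : 0 < r' - r := by linarith
  have hsub : ∀ x ∈ closedBall (0 : Cn n) r, ball x (r' - r) ⊆ ball 0 r' := fun x hx => by
    apply ball_subset_ball'
    rw [mem_closedBall] at hx
    linarith
  refine (convex_closedBall (0 : Cn n) r).norm_image_sub_le_of_norm_fderiv_le (𝕜 := ℂ) (f := g)
    (fun x hx => ?_) (fun x hx => ?_) (by simpa using hw) (by simpa using hz)
  · exact hg.differentiableAt (isOpen_unitBall.mem_nhds (mem_unitBall.2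
      ((mem_closedBall_zero_iff.1 hx).trans_lt (by linarith))))
  · exact norm_fderiv_le_of_bounded hpos (hg.mono ((hsub x hx).trans (ball_subset_ball hr')))
      (fun y hy => hM y (mem_ball_zero_iff.1 (hsub x hx hy)))

/-- The maps of the class `𝒩_A` are locally uniformly Lipschitz continuous. -/
theorem exists_lipschitz_isInN (hA : 0 < lowerIndex A) {r : ℝ} (hr : r < 1) :
    ∃ L, 0 ≤ L ∧ ∀ g, IsInN A g → ∀ z w, ‖z‖ ≤ r → ‖w‖ ≤ r → ‖g z - g w‖ ≤ L * ‖z - w‖ := by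
  obtain ⟨r', hrr', hr'1⟩ := exists_between hr
  obtain ⟨C, hC, hCg⟩ := exists_bound_isInN hA hr'1
  have : 0 < r' - r := by linarith
  exact ⟨2 * C / (r' - r), by positivity, fun g hg z w hz hw =>
    norm_sub_le_of_bounded hg.holomorphic hrr' hr'1.le (fun z hz => hCg g hg z hz.le) hz hw⟩

end Generator

/-! ### Carathéodory differential equations by Picard iteration -/

section Caratheodory

variable {n : ℕ}

/-- A bounded vector field that is Lipschitz continuous in the space variable, uniformly in time,
and measurable in time. -/
structure IsCaratheodory (H : Cn n → ℝ → Cn n) (M L : ℝ) : Prop where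
  lip_nonneg : 0 ≤ L
  bound : ∀ z t, ‖H z t‖ ≤ M
  lipschitz : ∀ z w t, ‖H z t - H w t‖ ≤ L * ‖z - w‖
  measurable : ∀ z, AEStronglyMeasurable (H z) volume

variable {H : Cn n → ℝ → Cn n} {M L : ℝ}

theorem IsCaratheodory.bound_nonneg (hH : IsCaratheodory H M L) : 0 ≤ M :=
  (norm_nonneg _).trans (hH.bound 0 0)

theorem IsCaratheodory.continuous (hH : IsCaratheodory H M L) (t : ℝ) :
    Continuous fun z => H z t :=
  (LipschitzWith.of_dist_le_mul (K := L.toNNReal) fun z w => by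
    rw [dist_eq_norm, dist_eq_norm, Real.coe_toNNReal _ hH.lip_nonneg]
    exact hH.lipschitz z w t).continuous

/-- Along a simple function only finitely many of the measurable maps `H c` occur; a general path is
a limit of simple ones, and `H` is continuous in space. -/
theorem IsCaratheodory.measurable_comp (hH : IsCaratheodory H M L) {w : ℝ → Cn n}
    (hw : Continuous w) : AEStronglyMeasurable (fun t => H (w t) t) volume := by
  have hws : StronglyMeasurable w := hw.stronglyMeasurable
  refine aestronglyMeasurable_of_tendsto_ae (u := atTop)
    (f := fun (m : ℕ) t => H (hws.approx m t) t) (fun m => ?_) (Eventually.of_forall fun t => ?_)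
  · have heq : (fun t => H (hws.approx m t) t) = fun t => ∑ c ∈ (hws.approx m).range,
        ((hws.approx m) ⁻¹' {c}).indicator (H c) t := by
      funext t
      rw [Finset.sum_eq_single_of_mem (hws.approx m t) (SimpleFunc.mem_range_self _ t)]
      · rw [indicator_of_mem]; simp
      · intro c _ hc
        rw [indicator_of_notMem]
        simpa using hc.symm
    rw [heq]
    exact Finset.aestronglyMeasurable_fun_sum _ fun c _ =>
      (hH.measurable c).indicator ((hws.approx m).measurableSet_preimage _)
  · exact ((hH.continuous t).tendsto _).comp (hws.tendsto_approx t)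

theorem IsCaratheodory.intervalIntegrable (hH : IsCaratheodory H M L) {w : ℝ → Cn n}
    (hw : Continuous w) (a b : ℝ) : IntervalIntegrable (fun t => H (w t) t) volume a b := by
  rw [intervalIntegrable_iff]
  refine Measure.integrableOn_of_bounded (M := M) (by simp) (hH.measurable_comp hw)
    (Eventually.of_forall fun t => hH.bound _ _)

/-- The Picard iterates, frozen before the initial time `s`. -/
def picard (H : Cn n → ℝ → Cn n) (s : ℝ) (z : Cn n) : ℕ → ℝ → Cn n
  | 0, _ => z
  | j + 1, t => z + ∫ x in s..max s t, H (picard H s z j x) x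

theorem norm_integral_diff_le (hH : IsCaratheodory H M L) {w : ℝ → Cn n} (hw : Continuous w)
    (z : Cn n) (s a b : ℝ) : ‖(z + ∫ x in s..max s a, H (w x) x) -
      (z + ∫ x in s..max s b, H (w x) x)‖ ≤ M * |a - b| := by
  rw [add_sub_add_left_eq_sub, intervalIntegral.integral_interval_sub_left
    (hH.intervalIntegrable hw _ _) (hH.intervalIntegrable hw _ _)]
  refine (intervalIntegral.norm_integral_le_of_norm_le_const fun x _ => hH.bound _ _).trans ?_
  refine mul_le_mul_of_nonneg_left ?_ hH.bound_nonneg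
  rw [max_comm s a, max_comm s b]
  exact abs_max_sub_max_le_abs a b s

theorem picard_lipschitz (hH : IsCaratheodory H M L) (s : ℝ) (z : Cn n) (j : ℕ) :
    Continuous (picard H s z j) ∧
      ∀ a b, ‖picard H s z j a - picard H s z j b‖ ≤ M * |a - b| := by
  induction j with
  | zero =>
    refine ⟨continuous_const, fun a b => ?_⟩
    simpa [picard] using mul_nonneg hH.bound_nonneg (abs_nonneg _)
  | succ j ih =>
    have h : ∀ a b, ‖picard H s z (j + 1) a - picard H s z (j + 1) b‖ ≤ M * |a - b| :=
      fun a b => norm_integral_diff_le hH ih.1 z s a b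
    refine ⟨(LipschitzWith.of_dist_le_mul (K := M.toNNReal) fun a b => ?_).continuous, h⟩
    rw [dist_eq_norm, Real.dist_eq, Real.coe_toNNReal _ hH.bound_nonneg]
    exact h a b

theorem picard_start (s : ℝ) (z : Cn n) (j : ℕ) : picard H s z j s = z := by
  cases j <;> simp [picard]

theorem norm_picard_succ_sub_le (hH : IsCaratheodory H M L) (s : ℝ) (z : Cn n) (j : ℕ) {t : ℝ}
    (ht : s ≤ t) : ‖picard H s z (j + 1) t - picard H s z j t‖ ≤
      M * L ^ j * (t - s) ^ (j + 1) / (j + 1)! := by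
  have hL := hH.lip_nonneg
  induction j generalizing t with
  | zero =>
    simp only [picard, add_sub_cancel_left, max_eq_right ht]
    refine (intervalIntegral.norm_integral_le_of_norm_le_const
      fun x _ => hH.bound _ _).trans_eq ?_
    rw [abs_of_nonneg (sub_nonneg.2 ht)]; simp
  | succ j ih =>
    have h1 : picard H s z (j + 2) t - picard H s z (j + 1) t =
        ∫ x in s..t, (H (picard H s z (j + 1) x) x - H (picard H s z j x) x) := by
      rw [intervalIntegral.integral_sub
        (hH.intervalIntegrable (picard_lipschitz hH s z (j + 1)).1 _ _)
        (hH.intervalIntegrable (picard_lipschitz hH s z j).1 _ _), picard, picard, max_eq_right ht]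
      abel
    rw [h1]
    have h2 : ∀ x, HasDerivAt (fun x => M * L ^ (j + 1) * (x - s) ^ (j + 2) / (j + 2)!)
        (L * (M * L ^ j * (x - s) ^ (j + 1) / (j + 1)!)) x := fun x => by
      have h3 : HasDerivAt (fun x : ℝ => (x - s) ^ (j + 2)) (((j + 2 : ℕ) : ℝ) * (x - s) ^ (j + 1))
          x := by
        simpa using ((hasDerivAt_id x).sub_const s).fun_pow (j + 2)
      refine ((h3.const_mul (M * L ^ (j + 1))).div_const (((j + 2)! : ℕ) : ℝ)).congr_deriv ?_
      have h4 : ((j + 1)! : ℝ) ≠ 0 := by exact_mod_cast (j + 1).factorial_ne_zero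
      rw [Nat.factorial_succ (j + 1)]
      push_cast
      have h5 : ((j : ℝ) + 1 + 1) ≠ 0 := by positivity
      field_simp
      ring
    have hc : Continuous fun x => L * (M * L ^ j * (x - s) ^ (j + 1) / (j + 1)!) := by fun_prop
    refine (intervalIntegral.norm_integral_le_of_norm_le ht
      (g := fun x => L * (M * L ^ j * (x - s) ^ (j + 1) / (j + 1)!))
      (Eventually.of_forall fun x hx => ?_) (hc.intervalIntegrable _ _)).trans_eq ?_
    · refine (hH.lipschitz _ _ _).trans ?_
      gcongr
      exact ih hx.1.le
    · rw [intervalIntegral.integral_eq_sub_of_hasDerivAt (fun x _ => h2 x)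
        (hc.intervalIntegrable _ _)]
      simp

theorem summable_picard_bound (M L x : ℝ) :
    Summable fun j : ℕ => M * L ^ j * x ^ (j + 1) / (j + 1)! := by
  have h1 := ((Real.summable_pow_div_factorial (|L * x| + 1)).mul_left (|M| * |x|))
  refine Summable.of_norm_bounded h1 fun j => ?_
  have h2 : ((j ! : ℕ) : ℝ) ≤ (((j + 1)! : ℕ) : ℝ) := by
    exact_mod_cast Nat.factorial_le (Nat.le_succ j)
  have h3 : (0 : ℝ) < (j ! : ℕ) := by exact_mod_cast j.factorial_pos
  have h4 : |L| ^ j * |x| ^ j ≤ (|L * x| + 1) ^ j := by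
    rw [← mul_pow, ← abs_mul]; gcongr; linarith
  rw [norm_div, norm_mul, norm_mul, norm_pow, norm_pow, RCLike.norm_natCast, Real.norm_eq_abs,
    Real.norm_eq_abs, Real.norm_eq_abs, pow_succ |x|]
  calc _ = |M| * |x| * ((|L| ^ j * |x| ^ j) / ((j + 1)! : ℕ)) := by ring
    _ ≤ |M| * |x| * ((|L * x| + 1) ^ j / (j ! : ℕ)) := by gcongr

/-- The limit of the Picard iterates. -/
def picardLimit (H : Cn n → ℝ → Cn n) (s : ℝ) (z : Cn n) (t : ℝ) : Cn n :=
  limUnder atTop fun j => picard H s z j (max s t)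

theorem tendsto_picard (hH : IsCaratheodory H M L) (s : ℝ) (z : Cn n) {t : ℝ} (ht : s ≤ t) :
    Tendsto (fun j => picard H s z j t) atTop (𝓝 (picardLimit H s z t)) := by
  rw [picardLimit, max_eq_right ht]
  refine (cauchySeq_of_dist_le_of_summable _ (fun j => ?_)
    (summable_picard_bound M L (t - s))).tendsto_limUnder
  rw [dist_comm, dist_eq_norm]
  exact norm_picard_succ_sub_le hH s z j ht

theorem tendstoUniformly_picard (hH : IsCaratheodory H M L) (s : ℝ) {t : ℝ} (ht : s ≤ t) :
    TendstoUniformly (fun j z => picard H s z j t) (fun z => picardLimit H s z t) atTop := by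
  rw [Metric.tendstoUniformly_iff]
  intro ε hε
  have h0 := tendsto_sum_nat_add fun j : ℕ => M * L ^ j * (t - s) ^ (j + 1) / (j + 1)!
  filter_upwards [h0.eventually (gt_mem_nhds hε)] with j hj z
  rw [dist_comm]
  refine lt_of_le_of_lt ?_ hj
  have := dist_le_tsum_of_dist_le_of_tendsto
    (fun j : ℕ => M * L ^ j * (t - s) ^ (j + 1) / (j + 1)!) (fun j => by
      rw [dist_comm, dist_eq_norm]
      exact norm_picard_succ_sub_le hH s z j ht) (summable_picard_bound M L (t - s))
    (tendsto_picard hH s z ht) j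
  simpa [add_comm] using this

theorem picardLimit_lipschitz (hH : IsCaratheodory H M L) (s : ℝ) (z : Cn n) :
    LipschitzWith M.toNNReal (picardLimit H s z) := by
  refine LipschitzWith.of_dist_le_mul fun a b => ?_
  rw [dist_eq_norm, Real.dist_eq, Real.coe_toNNReal _ hH.bound_nonneg]
  have hmax : ∀ x, picardLimit H s z x = picardLimit H s z (max s x) := fun x => by
    simp [picardLimit]
  rw [hmax a, hmax b]
  refine le_of_tendsto ((tendsto_picard hH s z (le_max_left s a)).sub
    (tendsto_picard hH s z (le_max_left s b))).norm (Eventually.of_forall fun j => ?_)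
  refine ((picard_lipschitz hH s z j).2 _ _).trans ?_
  refine mul_le_mul_of_nonneg_left ?_ hH.bound_nonneg
  rw [max_comm s a, max_comm s b]
  exact abs_max_sub_max_le_abs a b s

theorem picardLimit_continuous (hH : IsCaratheodory H M L) (s : ℝ) (z : Cn n) :
    Continuous (picardLimit H s z) :=
  (picardLimit_lipschitz hH s z).continuous

theorem picardLimit_eq (hH : IsCaratheodory H M L) (s : ℝ) (z : Cn n) {t : ℝ} (ht : s ≤ t) :
    picardLimit H s z t = z + ∫ x in s..t, H (picardLimit H s z x) x := by
  have h1 := (tendsto_picard hH s z ht).comp (tendsto_add_atTop_nat 1)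
  have h2 : Tendsto (fun j => z + ∫ x in s..t, H (picard H s z j x) x) atTop
      (𝓝 (z + ∫ x in s..t, H (picardLimit H s z x) x)) := by
    refine tendsto_const_nhds.add
      (intervalIntegral.tendsto_integral_filter_of_dominated_convergence (fun _ => M)
        (Eventually.of_forall fun j =>
          (hH.measurable_comp (picard_lipschitz hH s z j).1).restrict)
        (Eventually.of_forall fun j => Eventually.of_forall fun x _ => hH.bound _ _)
        intervalIntegrable_const (Eventually.of_forall fun x hx => ?_))
    rw [uIoc_of_le ht] at hx
    exact ((hH.continuous x).tendsto _).comp (tendsto_picard hH s z hx.1.le)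
  refine tendsto_nhds_unique h1 (h2.congr fun j => ?_)
  simp [picard, max_eq_right ht]

/-- Lebesgue differentiation of the integral equation. -/
theorem ae_hasDerivAt_picardLimit (hH : IsCaratheodory H M L) (s : ℝ) (z : Cn n) :
    ∀ᵐ t, s < t → HasDerivAt (picardLimit H s z) (H (picardLimit H s z t) t) t := by
  have hli : LocallyIntegrable (fun t => H (picardLimit H s z t) t) volume := by
    refine (locallyIntegrable_iff).2 fun K hK => ?_
    exact Measure.integrableOn_of_bounded (M := M) hK.measure_lt_top.ne
      (hH.measurable_comp (picardLimit_continuous hH s z))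
      (Eventually.of_forall fun t => hH.bound _ _)
  filter_upwards [LocallyIntegrable.ae_hasDerivAt_integral hli] with t ht hst
  refine ((ht s).const_add z).congr_of_eventuallyEq ?_
  filter_upwards [lt_mem_nhds hst] with x hx
  exact picardLimit_eq hH s z hx.le

/-- Integrals of bounded families of holomorphic maps are holomorphic. -/
theorem differentiableAt_integral {F : Cn n → ℝ → Cn n} {a b ρ C : ℝ} {z₀ : Cn n} (hab : a ≤ b)
    (hρ : 0 < ρ) (hd : ∀ t ∈ Ioc a b, DifferentiableOn ℂ (fun z => F z t) (ball z₀ ρ))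
    (hC : ∀ z t, ‖F z t‖ ≤ C) (hm : ∀ z, AEStronglyMeasurable (F z) volume) :
    DifferentiableAt ℂ (fun z => ∫ t in a..b, F z t) z₀ := by
  have hC0 : 0 ≤ C := (norm_nonneg _).trans (hC 0 0)
  set D : Cn n → ℝ → Cn n := fun w t => fderiv ℂ (fun z => F z t) z₀ w with hD
  have hDint : ∀ w, IntervalIntegrable (D w) volume a b := fun w => by
    rw [intervalIntegrable_iff_integrableOn_Ioc_of_le hab]
    have hmeas : AEStronglyMeasurable (D w) (volume.restrict (Ioc a b)) := by
      refine aestronglyMeasurable_of_tendsto_ae (u := atTop)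
        -- The derivative is measurable in `t` as a pointwise limit of difference quotients with
        -- step `1 / m`.
        (f := fun (m : ℕ) t => (m : ℂ) • (F (z₀ + (m : ℂ)⁻¹ • w) t - F z₀ t))
        (fun m => (((hm _).sub (hm _)).const_smul (m : ℂ)).restrict) ?_
      filter_upwards [ae_restrict_mem measurableSet_Ioc] with t ht
      refine ((hd t ht).differentiableAt (ball_mem_nhds z₀ hρ)).hasFDerivAt.lim w ?_
      simpa using tendsto_natCast_atTop_atTop
    refine ⟨hmeas, HasFiniteIntegral.of_bounded (C := 2 * C / ρ * ‖w‖) ?_⟩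
    filter_upwards [ae_restrict_mem measurableSet_Ioc] with t ht
    refine (ContinuousLinearMap.le_opNorm _ _).trans ?_
    gcongr
    exact norm_fderiv_le_of_bounded hρ (hd t ht) fun z _ => hC z t
  have hFint : ∀ z, IntervalIntegrable (F z) volume a b := fun z => by
    rw [intervalIntegrable_iff]
    exact Measure.integrableOn_of_bounded (M := C) (by simp) (hm z)
      (Eventually.of_forall fun t => hC z t)
  set T : Cn n →ₗ[ℂ] Cn n :=
    { toFun := fun w => ∫ t in a..b, D w t
      map_add' := fun v w => by
        rw [← intervalIntegral.integral_add (hDint v) (hDint w)]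
        simp [hD]
      map_smul' := fun c w => by
        rw [RingHom.id_apply, ← intervalIntegral.integral_smul]
        simp [hD] } with hT
  refine (HasFDerivAt.of_isLittleO (f' := LinearMap.toContinuousLinearMap T) ?_).differentiableAt
  -- The second order Taylor estimate is uniform in `t`, so it survives integration and identifies
  -- the integral of the derivatives as the derivative.
  have hbig : (fun z => (∫ t in a..b, F z t) - (∫ t in a..b, F z₀ t) -
      LinearMap.toContinuousLinearMap T (z - z₀)) =O[𝓝 z₀] fun z => ‖z - z₀‖ ^ 2 := by
    refine Asymptotics.IsBigO.of_bound (4 * C / ρ ^ 2 * (b - a)) ?_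
    filter_upwards [ball_mem_nhds z₀ hρ] with z hz
    have h1 : (∫ t in a..b, F z t) - (∫ t in a..b, F z₀ t) -
        LinearMap.toContinuousLinearMap T (z - z₀) =
        ∫ t in a..b, (F z t - F z₀ t - D (z - z₀) t) := by
      rw [intervalIntegral.integral_sub ((hFint z).sub (hFint z₀)) (hDint _),
        intervalIntegral.integral_sub (hFint z) (hFint z₀)]
      simp [hT]
    rw [h1]
    refine (intervalIntegral.norm_integral_le_of_norm_le_const
      (C := 4 * C * (‖z - z₀‖ / ρ) ^ 2) fun t ht => ?_).trans_eq ?_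
    · rw [uIoc_of_le hab] at ht
      exact norm_sub_sub_fderiv_le hρ (hd t ht) (fun y _ => hC y t) hz
    · rw [abs_of_nonneg (sub_nonneg.2 hab), norm_pow, norm_norm]
      field_simp
  refine hbig.trans_isLittleO ?_
  have h2 : (fun z : Cn n => ‖z - z₀‖ ^ 2) =o[𝓝 z₀] fun z => ‖z - z₀‖ ^ 1 := by
    have h3 : Tendsto (fun z : Cn n => ‖z - z₀‖) (𝓝 z₀) (𝓝 0) := by
      have : Continuous fun z : Cn n => ‖z - z₀‖ := by fun_prop
      simpa using this.tendsto z₀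
    exact (Asymptotics.isLittleO_pow_pow (𝕜 := ℝ) one_lt_two).comp_tendsto h3
  simp only [pow_one] at h2
  exact h2.of_norm_right

/-- Short time holomorphic dependence on the initial value. -/
theorem differentiableOn_picardLimit (hH : IsCaratheodory H M L) {s δ r₀ r : ℝ}
    (hδ : r₀ + M * δ ≤ r) (hd : ∀ t, s < t → DifferentiableOn ℂ (fun z => H z t) (ball 0 r))
    {t : ℝ} (hst : s ≤ t) (htδ : t ≤ s + δ) :
    DifferentiableOn ℂ (fun z => picardLimit H s z t) (ball 0 r₀) := by
  -- At speed at most `M` an iterate starting in the ball of radius `r₀` stays for time `δ` in the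
  -- ball of radius `r`, where the field is holomorphic.
  have hstay : ∀ j, ∀ z ∈ ball (0 : Cn n) r₀, ∀ x ∈ Icc s (s + δ), picard H s z j x ∈ ball 0 r := by
    intro j z hz x hx
    have h1 := (picard_lipschitz hH s z j).2 x s
    rw [picard_start, abs_of_nonneg (sub_nonneg.2 hx.1)] at h1
    rw [mem_ball_zero_iff] at hz ⊢
    have h2 : M * (x - s) ≤ M * δ :=
      mul_le_mul_of_nonneg_left (by linarith [hx.2]) hH.bound_nonneg
    linarith [norm_le_norm_add_norm_sub' (picard H s z j x) z]
  have hpic : ∀ j, ∀ x ∈ Icc s (s + δ),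
      DifferentiableOn ℂ (fun z => picard H s z j x) (ball 0 r₀) := by
    intro j
    induction j with
    | zero => exact fun x _ => differentiableOn_id
    | succ j ih =>
      intro x hx z hz
      obtain ⟨ρ, hρ, hρr⟩ := Metric.isOpen_iff.1 isOpen_ball z hz
      refine DifferentiableAt.differentiableWithinAt ?_
      simp only [picard, max_eq_right hx.1]
      refine differentiableAt_id.add (differentiableAt_integral hx.1 hρ (fun y hy => ?_)
        (fun w y => hH.bound _ _) fun w => hH.measurable_comp (picard_lipschitz hH s w j).1)
      have hy' : y ∈ Icc s (s + δ) := ⟨hy.1.le, hy.2.trans hx.2⟩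
      exact (hd y hy.1).comp ((ih y hy').mono hρr) fun w hw => hstay j w (hρr hw) y hy'
  intro z hz
  obtain ⟨ρ, hρ, hρr⟩ := Metric.isOpen_iff.1 isOpen_ball z hz
  exact (differentiableAt_of_tendstoUniformlyOn_ball hρ
    (Eventually.of_forall fun j => (hpic j t ⟨hst, htδ⟩).mono hρr)
    (tendstoUniformly_picard hH s hst).tendstoUniformlyOn).differentiableWithinAt

end Caratheodory

/-! ### Cutting the generator off near the boundary -/

section Cutoff

variable {n : ℕ} {A : Cn n →L[ℂ] Cn n} {h : Cn n → ℝ → Cn n}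

/-- A piecewise linear function that is `1` on `(-∞, r]` and `0` on `[r', ∞)`. -/
def cutoff (r r' x : ℝ) : ℝ := max 0 (min 1 ((r' - x) / (r' - r)))

theorem cutoff_nonneg (r r' x : ℝ) : 0 ≤ cutoff r r' x := le_max_left _ _

theorem cutoff_le_one (r r' x : ℝ) : cutoff r r' x ≤ 1 :=
  max_le zero_le_one (min_le_left _ _)

theorem cutoff_eq_one {r r' x : ℝ} (hr : r < r') (hx : x ≤ r) : cutoff r r' x = 1 := by
  have : 1 ≤ (r' - x) / (r' - r) := by rw [le_div_iff₀ (by linarith)]; linarith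
  rw [cutoff, min_eq_left this, max_eq_right zero_le_one]

theorem cutoff_eq_zero {r r' x : ℝ} (hr : r < r') (hx : r' ≤ x) : cutoff r r' x = 0 := by
  have : (r' - x) / (r' - r) ≤ 0 := div_nonpos_of_nonpos_of_nonneg (by linarith) (by linarith)
  rw [cutoff, max_eq_left ((min_le_right _ _).trans this)]

theorem abs_cutoff_sub_le {r r' : ℝ} (hr : r < r') (x y : ℝ) :
    |cutoff r r' x - cutoff r r' y| ≤ |x - y| / (r' - r) := by
  have h1 : |cutoff r r' x - cutoff r r' y| ≤ |(r' - x) / (r' - r) - (r' - y) / (r' - r)| := by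
    rw [cutoff, cutoff, max_comm 0, max_comm 0, min_comm 1, min_comm 1]
    exact (abs_max_sub_max_le_abs _ _ _).trans (abs_min_sub_min_le_max _ _ _ _ |>.trans (by simp))
  refine h1.trans_eq ?_
  rw [← sub_div, abs_div, abs_of_pos (sub_pos.2 hr), sub_sub_sub_cancel_left, abs_sub_comm]

/-- The generator (with the opposite sign), cut off near the boundary of the ball. -/
def cutoffField (h : Cn n → ℝ → Cn n) (r r' : ℝ) (z : Cn n) (t : ℝ) : Cn n :=
  if 0 ≤ t then -(((cutoff r r' ‖z‖ : ℝ) : ℂ) • h z t) else 0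

/-- Bounds and Lipschitz constants of the generator are uniform in time only on balls of radius
below `1`. The cutoff makes them global and leaves the field unchanged for `‖z‖ ≤ r`. -/
theorem isCaratheodory_cutoffField (hA : 0 < lowerIndex A) (hh : IsGenerator A h) {r r' : ℝ}
    (hr : r < r') (hr' : r' < 1) : ∃ M L, IsCaratheodory (cutoffField h r r') M L := by
  obtain ⟨C, hC, hCb⟩ := exists_bound_isInN hA hr'
  obtain ⟨K, hK, hKb⟩ := exists_lipschitz_isInN hA hr'
  have hrr : 0 < r' - r := by linarith
  have hcl : ∀ (z w : Cn n), |cutoff r r' ‖z‖ - cutoff r r' ‖w‖| ≤ ‖z - w‖ / (r' - r) := fun z w =>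
    (abs_cutoff_sub_le hr _ _).trans (by gcongr; exact abs_norm_sub_norm_le z w)
  refine ⟨C, C / (r' - r) + K, by positivity, fun z t => ?_, fun z w t => ?_, fun z => ?_⟩
  · unfold cutoffField
    split_ifs with ht
    · rcases le_or_gt ‖z‖ r' with hz | hz
      · rw [norm_neg, norm_smul, Complex.norm_real, Real.norm_of_nonneg (cutoff_nonneg _ _ _)]
        exact (mul_le_of_le_one_left (norm_nonneg _) (cutoff_le_one _ _ _)).trans
          (hCb _ (hh.mem_N t ht) z hz)
      · rw [cutoff_eq_zero hr hz.le]; simpa using hC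
    · simpa using hC
  · unfold cutoffField
    split_ifs with ht
    swap
    · simp only [sub_self, norm_zero]; positivity
    wlog hzw : ‖z‖ ≤ ‖w‖ generalizing z w
    · rw [norm_sub_rev, norm_sub_rev z]
      exact this w z (le_of_not_ge hzw)
    have hN := hh.mem_N t ht
    rw [neg_sub_neg]
    rcases le_or_gt ‖w‖ r' with hw | hw
    · have hz := hzw.trans hw
      have h1 : ((cutoff r r' ‖w‖ : ℝ) : ℂ) • h w t - ((cutoff r r' ‖z‖ : ℝ) : ℂ) • h z t =
          ((cutoff r r' ‖w‖ - cutoff r r' ‖z‖ : ℝ) : ℂ) • h w t +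
            ((cutoff r r' ‖z‖ : ℝ) : ℂ) • (h w t - h z t) := by
        push_cast
        module
      rw [h1]
      refine (norm_add_le _ _).trans ?_
      rw [norm_smul, norm_smul, Complex.norm_real, Complex.norm_real,
        Real.norm_of_nonneg (cutoff_nonneg _ _ _), Real.norm_eq_abs, add_mul]
      refine add_le_add ?_ ?_
      · calc _ ≤ ‖w - z‖ / (r' - r) * C := by
              gcongr
              · exact hcl w z
              · exact hCb _ hN w hw
          _ = _ := by rw [norm_sub_rev]; ring
      · refine (mul_le_of_le_one_left (norm_nonneg _) (cutoff_le_one _ _ _)).trans ?_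
        rw [norm_sub_rev]
        exact hKb _ hN z w hz hw
    · rw [cutoff_eq_zero hr hw.le]
      rcases le_or_gt ‖z‖ r' with hz | hz
      -- With `z` inside and `w` outside the support, the cutoff at `z` is itself at most `‖z - w‖ /
      -- (r' - r)`.
      · have h2 := hcl z w
        rw [cutoff_eq_zero hr hw.le, sub_zero, abs_of_nonneg (cutoff_nonneg _ _ _)] at h2
        simp only [Complex.ofReal_zero, zero_smul, zero_sub, norm_neg]
        rw [norm_smul, Complex.norm_real, Real.norm_of_nonneg (cutoff_nonneg _ _ _)]
        calc _ ≤ ‖z - w‖ / (r' - r) * C := by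
              gcongr
              exact hCb _ hN z hz
          _ = C / (r' - r) * ‖z - w‖ := by ring
          _ ≤ _ := by gcongr; linarith
      · rw [cutoff_eq_zero hr hz.le]
        simp only [Complex.ofReal_zero, zero_smul, sub_self, norm_zero]
        positivity
  · rcases lt_or_ge ‖z‖ 1 with hz | hz
    · have hm : AEStronglyMeasurable (h z) (volume.restrict (Ici (0 : ℝ))) :=
        (hh.measurable z (mem_unitBall.2 hz)).aestronglyMeasurable
      have h2 : cutoffField h r r' z = (Ici (0 : ℝ)).indicator
          (fun t => -(((cutoff r r' ‖z‖ : ℝ) : ℂ) • h z t)) := by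
        funext t
        simp only [cutoffField, indicator, mem_Ici]
      rw [h2, aestronglyMeasurable_indicator_iff measurableSet_Ici]
      exact (continuous_neg.comp
        (continuous_const_smul ((cutoff r r' ‖z‖ : ℝ) : ℂ))).comp_aestronglyMeasurable hm
    · have h2 : cutoffField h r r' z = fun _ => 0 := by
        funext t
        simp [cutoffField, cutoff_eq_zero hr (hr'.le.trans hz)]
      rw [h2]
      exact aestronglyMeasurable_const

end Cutoff

/-! ### Trajectories: decay, and dependence on initial values -/

section Trajectory

variable {n : ℕ} {A : Cn n →L[ℂ] Cn n} {h : Cn n → ℝ → Cn n}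

/-- `w` solves `w' = -h(w, t)` on `[s, ∞)` in the unit ball. -/
structure IsTrajectory (h : Cn n → ℝ → Cn n) (s : ℝ) (w : ℝ → Cn n) : Prop where
  mem : ∀ t, s ≤ t → w t ∈ unitBall n
  lip : ∀ T, LipOn w s T
  deriv : ∀ᵐ t, s < t → HasDerivAt w (-h (w t) t) t

theorem IsTrajectory.restrict {s s' : ℝ} {w : ℝ → Cn n} (hw : IsTrajectory h s w) (hs : s ≤ s') :
    IsTrajectory h s' w where
  mem t ht := hw.mem t (hs.trans ht)
  lip T := (hw.lip T).mono (Icc_subset_Icc_left hs)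
  deriv := by filter_upwards [hw.deriv] with t ht hst using ht (hs.trans_lt hst)

theorem hasDerivAt_normSq {w : ℝ → Cn n} {w' : Cn n} {t : ℝ} (hw : HasDerivAt w w' t) :
    HasDerivAt (fun t => ‖w t‖ ^ 2) (2 * (inner ℂ (w t) w').re) t := by
  refine hw.norm_sq.congr_deriv ?_
  rw [PiLp.inner_apply, PiLp.inner_apply, Complex.re_sum]
  simp [Complex.inner]

theorem LipOn.normSq {w : ℝ → Cn n} {a b : ℝ} (hw : LipOn w a b) :
    LipOn (fun t => ‖w t‖ ^ 2) a b := by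
  have h1 : LipOn (fun t => ‖w t‖) a b :=
    hw.comp_lipschitzOn (s := univ) (lipschitzWith_one_norm.lipschitzOnWith) (fun _ _ => mem_univ _)
  have h2 := LipOn.bilinear (ContinuousLinearMap.mul ℝ ℝ) h1 h1
  simpa [sq] using h2

/-- Gronwall's inequality for `‖w‖²`, whose derivative is `2 Re ⟨w, w'⟩`. -/
theorem normSq_le_mul_exp {s t : ℝ} (hst : s ≤ t) {w w' : ℝ → Cn n} {α α' : ℝ → ℝ}
    (hw : LipOn w s t) (hα : ContDiff ℝ 1 α) (hα' : ∀ x, HasDerivAt α (α' x) x)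
    (hd : ∀ᵐ x, x ∈ Ioo s t → HasDerivAt w (w' x) x ∧
      2 * (inner ℂ (w x) (w' x)).re ≤ α' x * ‖w x‖ ^ 2) :
    ‖w t‖ ^ 2 ≤ ‖w s‖ ^ 2 * Real.exp (α t - α s) :=
  le_mul_exp_of_ae_hasDerivAt_le (u' := fun x => 2 * (inner ℂ (w x) (w' x)).re) hst
    (hw.normSq.absolutelyContinuous hst) hα hα' (by
      filter_upwards [hd] with x hx hxs
      exact ⟨hasDerivAt_normSq (hx hxs).1, (hx hxs).2⟩)

/-- The derivative of `‖w‖²` is `-2 Re ⟨w, h(w, t)⟩ ≤ 0`. -/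
theorem IsTrajectory.norm_le (hh : IsGenerator A h) {s t : ℝ} (hs : 0 ≤ s) (hst : s ≤ t)
    {w : ℝ → Cn n} (hw : IsTrajectory h s w) : ‖w t‖ ≤ ‖w s‖ := by
  have := normSq_le_mul_exp (α := fun _ => 0) (α' := fun _ => 0) (w' := fun x => -h (w x) x) hst
    (hw.lip t) contDiff_const (fun x => hasDerivAt_const x _) (by
      filter_upwards [hw.deriv] with x hx hxs
      refine ⟨hx hxs.1, ?_⟩
      rw [inner_neg_right, Complex.neg_re, zero_mul]
      have h0 : 0 ≤ (inner ℂ (w x) (h (w x) x)).re := by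
        rcases eq_or_ne (w x) 0 with h0 | h0
        · simp [h0]
        · exact ((hh.mem_N x (hs.trans hxs.1.le)).re_pos _ (hw.mem x hxs.1.le) h0).le
      linarith)
  simp only [sub_self, Real.exp_zero, mul_one] at this
  exact (sq_le_sq₀ (norm_nonneg _) (norm_nonneg _)).1 this

/-- Trajectories decay at the rate `m(A)`. -/
theorem exists_decay (hA : 0 < lowerIndex A) (hh : IsGenerator A h) {r : ℝ} (hr : r < 1) :
    ∃ C, 0 < C ∧ ∀ s, 0 ≤ s → ∀ w, IsTrajectory h s w → ‖w s‖ ≤ r → ∀ t, s ≤ t →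
      ‖w t‖ ≤ C * Real.exp (-(lowerIndex A * (t - s))) * ‖w s‖ := by
  rcases lt_or_ge r 0 with hr0 | hr0
  · exact ⟨1, one_pos, fun s _ w _ hws => absurd (norm_nonneg (w s)) (by linarith)⟩
  set m := lowerIndex A with hm
  -- `κ` is the least value of `(1 - x) / (1 + x)` on `[0, r]`.
  set κ : ℝ := (1 - r) / (1 + r) with hκ
  have hκ0 : 0 < κ := div_pos (by linarith) (by linarith)
  have hpt : ∀ x, 0 ≤ x → ∀ z ∈ unitBall n,
      2 * (inner ℂ z (-h z x)).re ≤ -(2 * m) * ((1 - ‖z‖) / (1 + ‖z‖)) * ‖z‖ ^ 2 := by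
    intro x hx z hz
    have h1 := ((hh.mem_N x hx).inner_estimates hA hz).1
    have h2 : 0 < 1 + ‖z‖ := by positivity
    rw [inner_neg_right, Complex.neg_re]
    have h3 : m * ‖z‖ ^ 2 * (1 - ‖z‖) / (1 + ‖z‖) ≤ (inner ℂ z (h z x)).re := by
      rw [div_le_iff₀ h2]; exact h1
    calc _ ≤ -(2 * (m * ‖z‖ ^ 2 * (1 - ‖z‖) / (1 + ‖z‖))) := by linarith
      _ = _ := by ring
  refine ⟨Real.exp (2 * r / κ), Real.exp_pos _, fun s hs w hw hws t hst => ?_⟩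
  have hmono : ∀ x, s ≤ x → ‖w x‖ ≤ r := fun x hx => (hw.norm_le hh hs hx).trans hws
  -- A first, crude decay with the weaker rate `m κ`.
  have hfirst : ∀ x, s ≤ x → ‖w x‖ ≤ r * Real.exp (-(m * κ * (x - s))) := by
    intro x hx
    have := normSq_le_mul_exp (α := fun y => -(2 * m * κ) * y) (α' := fun _ => -(2 * m * κ))
      (w' := fun x => -h (w x) x) hx (hw.lip x) (by fun_prop)
      (fun y => by simpa using (hasDerivAt_id y).const_mul (-(2 * m * κ))) (by
        filter_upwards [hw.deriv] with y hy hys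
        refine ⟨hy hys.1, (hpt y (hs.trans hys.1.le) _ (hw.mem y hys.1.le)).trans ?_⟩
        have h1 : κ ≤ (1 - ‖w y‖) / (1 + ‖w y‖) := by
          have := hmono y hys.1.le
          rw [hκ, div_le_div_iff₀ (by positivity) (by positivity)]
          nlinarith
        have h2 : 2 * m * κ ≤ 2 * m * ((1 - ‖w y‖) / (1 + ‖w y‖)) := by gcongr
        have h3 : 0 ≤ ‖w y‖ ^ 2 := by positivity
        nlinarith)
    have h4 : ‖w x‖ ^ 2 ≤ (r * Real.exp (-(m * κ * (x - s)))) ^ 2 := by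
      refine this.trans ?_
      rw [mul_pow, ← Real.exp_nat_mul]
      gcongr
      push_cast
      linarith
    exact (sq_le_sq₀ (norm_nonneg _) (by positivity)).1 h4
  -- Bootstrap: `(1 - x) / (1 + x) ≥ 1 - 2 x`, and the crude decay makes the error `4 m ‖w‖`
  -- integrable with total at most `4 r / κ`. The full rate follows, and the square root turns the
  -- factor into `e^{2r/κ}`.
  have := normSq_le_mul_exp
    (α := fun y => -(2 * m) * y - 4 * r / κ * Real.exp (-(m * κ * (y - s))))
    (α' := fun y => -(2 * m) + 4 * m * (r * Real.exp (-(m * κ * (y - s)))))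
    (w' := fun x => -h (w x) x) hst (hw.lip t) (by fun_prop)
    (fun y => by
      have h1 : HasDerivAt (fun y => -(m * κ * (y - s))) (-(m * κ)) y := by
        simpa using (((hasDerivAt_id y).sub_const s).const_mul (m * κ)).fun_neg
      have h2 : HasDerivAt (fun y => -(2 * m) * y) (-(2 * m)) y := by
        simpa using (hasDerivAt_id y).const_mul (-(2 * m))
      refine (h2.sub (h1.exp.const_mul (4 * r / κ))).congr_deriv ?_
      field_simp
      ring) (by
      filter_upwards [hw.deriv] with y hy hys
      refine ⟨hy hys.1, (hpt y (hs.trans hys.1.le) _ (hw.mem y hys.1.le)).trans ?_⟩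
      have h1 : 1 - 2 * ‖w y‖ ≤ (1 - ‖w y‖) / (1 + ‖w y‖) := by
        rw [le_div_iff₀ (by positivity)]
        nlinarith [norm_nonneg (w y)]
      have h2 := hfirst y hys.1.le
      have h3 : 0 ≤ ‖w y‖ ^ 2 := by positivity
      have h4 : -(2 * m) * ((1 - ‖w y‖) / (1 + ‖w y‖)) ≤
          -(2 * m) + 4 * m * (r * Real.exp (-(m * κ * (y - s)))) := by
        nlinarith
      exact mul_le_mul_of_nonneg_right h4 h3)
  have h5 : ‖w t‖ ^ 2 ≤ (Real.exp (2 * r / κ) * Real.exp (-(m * (t - s))) * ‖w s‖) ^ 2 := by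
    refine this.trans ?_
    rw [mul_pow, ← Real.exp_add, ← Real.exp_nat_mul, mul_comm (‖w s‖ ^ 2)]
    gcongr
    simp only [sub_self, mul_zero, neg_zero, Real.exp_zero, mul_one]
    have h6 : 0 ≤ 4 * r / κ * Real.exp (-(m * κ * (t - s))) := by positivity
    push_cast
    have h7 : 2 * (2 * r / κ) = 4 * r / κ := by ring
    linarith
  exact (sq_le_sq₀ (norm_nonneg _) (by positivity)).1 h5

theorem abs_inner_sub_le (hA : 0 < lowerIndex A) (hh : IsGenerator A h) {r : ℝ} (hr : r < 1) :
    ∃ L, 0 ≤ L ∧ ∀ t, 0 ≤ t → ∀ z w, ‖z‖ ≤ r → ‖w‖ ≤ r →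
      |(inner ℂ (z - w) (-h z t - -h w t)).re| ≤ L * ‖z - w‖ ^ 2 := by
  obtain ⟨L, hL, hLb⟩ := exists_lipschitz_isInN hA hr
  refine ⟨L, hL, fun t ht z w hz hw => ?_⟩
  refine (Complex.abs_re_le_norm _).trans ((norm_inner_le_norm _ _).trans ?_)
  have h1 := hLb _ (hh.mem_N t ht) z w hz hw
  rw [neg_sub_neg, norm_sub_rev (h w t)]
  nlinarith [norm_nonneg (z - w)]

/-- Trajectories depend on the initial values in a bi-Lipschitz way. -/
theorem exists_dist_trajectory (hA : 0 < lowerIndex A) (hh : IsGenerator A h) {r : ℝ}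
    (hr : r < 1) : ∃ L, 0 ≤ L ∧ ∀ s, 0 ≤ s → ∀ w₁ w₂, IsTrajectory h s w₁ → IsTrajectory h s w₂ →
      ‖w₁ s‖ ≤ r → ‖w₂ s‖ ≤ r → ∀ t, s ≤ t →
      ‖w₁ t - w₂ t‖ ^ 2 ≤ ‖w₁ s - w₂ s‖ ^ 2 * Real.exp (L * (t - s)) ∧
      ‖w₁ s - w₂ s‖ ^ 2 ≤ ‖w₁ t - w₂ t‖ ^ 2 * Real.exp (L * (t - s)) := by
  obtain ⟨L, hL, hLb⟩ := abs_inner_sub_le hA hh hr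
  refine ⟨2 * L, by positivity, fun s hs w₁ w₂ h₁ h₂ hr₁ hr₂ t hst => ?_⟩
  have hd : ∀ᵐ x, x ∈ Ioo s t →
      HasDerivAt (fun y => w₁ y - w₂ y) (-h (w₁ x) x - -h (w₂ x) x) x ∧
      |(inner ℂ (w₁ x - w₂ x) (-h (w₁ x) x - -h (w₂ x) x)).re| ≤ L * ‖w₁ x - w₂ x‖ ^ 2 := by
    filter_upwards [h₁.deriv, h₂.deriv] with x hx₁ hx₂ hxs
    exact ⟨(hx₁ hxs.1).sub (hx₂ hxs.1), hLb x (hs.trans hxs.1.le) _ _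
      ((h₁.norm_le hh hs hxs.1.le).trans hr₁) ((h₂.norm_le hh hs hxs.1.le).trans hr₂)⟩
  have hlip : LipOn (fun y => w₁ y - w₂ y) s t := (h₁.lip t).sub (h₂.lip t)
  constructor
  · have := normSq_le_mul_exp (α := fun y => 2 * L * y) (α' := fun _ => 2 * L)
      (w' := fun x => -h (w₁ x) x - -h (w₂ x) x) hst hlip (by fun_prop)
      (fun y => by simpa using (hasDerivAt_id y).const_mul (2 * L)) (by
        filter_upwards [hd] with x hx hxs
        refine ⟨(hx hxs).1, ?_⟩
        linarith [(abs_le.1 (hx hxs).2).2])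
    rwa [← mul_sub] at this
  -- The backward estimate is Gronwall's inequality for the negative of the squared distance.
  · have := le_mul_exp_of_ae_hasDerivAt_le (u := fun y => -‖w₁ y - w₂ y‖ ^ 2)
      (u' := fun x => -(2 * (inner ℂ (w₁ x - w₂ x) (-h (w₁ x) x - -h (w₂ x) x)).re))
      (A := fun y => -(2 * L) * y) (A' := fun _ => -(2 * L)) hst
      ((hlip.normSq.absolutelyContinuous hst).neg) (by fun_prop)
      (fun y => by simpa using (hasDerivAt_id y).const_mul (-(2 * L))) (by
        filter_upwards [hd] with x hx hxs
        refine ⟨(hasDerivAt_normSq (hx hxs).1).neg, ?_⟩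
        linarith [(abs_le.1 (hx hxs).2).1])
    have h3 : ‖w₁ s - w₂ s‖ ^ 2 * Real.exp (-(2 * L * (t - s))) ≤ ‖w₁ t - w₂ t‖ ^ 2 := by
      have h4 : -(2 * L) * t - -(2 * L) * s = -(2 * L * (t - s)) := by ring
      rw [h4] at this
      linarith
    rw [Real.exp_neg, mul_inv_le_iff₀ (Real.exp_pos _)] at h3
    exact h3

/-- The two halves of the bi-Lipschitz estimate: forward uniqueness makes transition maps well
defined, backward uniqueness makes them injective. -/
theorem IsTrajectory.eq_of_eq (hA : 0 < lowerIndex A) (hh : IsGenerator A h) {s t : ℝ}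
    (hs : 0 ≤ s) (hst : s ≤ t) {w₁ w₂ : ℝ → Cn n} (h₁ : IsTrajectory h s w₁)
    (h₂ : IsTrajectory h s w₂) : w₁ s = w₂ s ↔ w₁ t = w₂ t := by
  have hr : max ‖w₁ s‖ ‖w₂ s‖ < 1 :=
    max_lt (mem_unitBall.1 (h₁.mem s le_rfl)) (mem_unitBall.1 (h₂.mem s le_rfl))
  obtain ⟨L, -, hL⟩ := exists_dist_trajectory hA hh hr
  obtain ⟨h3, h4⟩ := hL s hs w₁ w₂ h₁ h₂ (le_max_left _ _) (le_max_right _ _) t hst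
  constructor
  · intro heq
    rw [heq, sub_self, norm_zero] at h3
    have : ‖w₁ t - w₂ t‖ ^ 2 = 0 := le_antisymm (by simpa using h3) (by positivity)
    exact sub_eq_zero.1 (norm_eq_zero.1 (pow_eq_zero_iff two_ne_zero |>.1 this))
  · intro heq
    rw [heq, sub_self, norm_zero] at h4
    have : ‖w₁ s - w₂ s‖ ^ 2 = 0 := le_antisymm (by simpa using h4) (by positivity)
    exact sub_eq_zero.1 (norm_eq_zero.1 (pow_eq_zero_iff two_ne_zero |>.1 this))

end Trajectory

/-! ### The transition maps of the flow -/

section Transition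

variable {n : ℕ} {A : Cn n →L[ℂ] Cn n} {h : Cn n → ℝ → Cn n}

/-- Cutting off does not change the sign of `Re ⟨w, h⟩`, so the norm still cannot grow. The path
therefore never leaves the region where the cutoff is `1`, and it solves the original equation. -/
theorem isTrajectory_picardLimit (hA : 0 < lowerIndex A) (hh : IsGenerator A h) {r r' : ℝ}
    (hr : r < r') (hr' : r' < 1) {s : ℝ} (hs : 0 ≤ s) {z : Cn n} (hz : ‖z‖ ≤ r) :
    IsTrajectory h s (picardLimit (cutoffField h r r') s z) ∧
      picardLimit (cutoffField h r r') s z s = z := by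
  obtain ⟨M, L, hH⟩ := isCaratheodory_cutoffField hA hh hr hr'
  set w := picardLimit (cutoffField h r r') s z with hw
  have hws : w s = z := by simpa using picardLimit_eq hH s z le_rfl
  have hlip : ∀ T, LipOn w s T := fun T => ⟨_, (picardLimit_lipschitz hH s z).lipschitzOnWith⟩
  have hnorm : ∀ t, s ≤ t → ‖w t‖ ≤ ‖z‖ := fun t ht => by
    have := normSq_le_mul_exp (α := fun _ => 0) (α' := fun _ => 0)
      (w' := fun x => cutoffField h r r' (w x) x) ht (hlip t) contDiff_const
      (fun x => hasDerivAt_const x _) (by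
        filter_upwards [ae_hasDerivAt_picardLimit hH s z] with x hx hxs
        refine ⟨hx hxs.1, ?_⟩
        have hx0 : 0 ≤ x := hs.trans hxs.1.le
        rw [cutoffField, if_pos hx0, inner_neg_right, inner_smul_right, Complex.neg_re,
          Complex.re_ofReal_mul, zero_mul]
        have h1 : 0 ≤ cutoff r r' ‖w x‖ * (inner ℂ (w x) (h (w x) x)).re := by
          rcases lt_or_ge ‖w x‖ 1 with h1 | h1
          · refine mul_nonneg (cutoff_nonneg _ _ _) ?_
            rcases eq_or_ne (w x) 0 with h0 | h0
            · simp [h0]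
            · exact ((hh.mem_N x hx0).re_pos _ (mem_unitBall.2 h1) h0).le
          · rw [cutoff_eq_zero hr (hr'.le.trans h1), zero_mul]
        linarith)
    simp only [sub_self, Real.exp_zero, mul_one] at this
    rw [hws] at this
    exact (sq_le_sq₀ (norm_nonneg _) (norm_nonneg _)).1 this
  refine ⟨⟨fun t ht => mem_unitBall.2 ?_, hlip, ?_⟩, hws⟩
  · linarith [hnorm t ht]
  · filter_upwards [ae_hasDerivAt_picardLimit hH s z] with t ht hst
    have h1 := ht hst
    rwa [cutoffField, if_pos (hs.trans hst.le), cutoff_eq_one hr ((hnorm t hst.le).trans hz),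
      Complex.ofReal_one, one_smul] at h1

theorem exists_trajectory (hA : 0 < lowerIndex A) (hh : IsGenerator A h) {s : ℝ} (hs : 0 ≤ s)
    {z : Cn n} (hz : z ∈ unitBall n) : ∃ w, IsTrajectory h s w ∧ w s = z := by
  obtain ⟨r, hzr, hr⟩ := exists_between (mem_unitBall.1 hz)
  obtain ⟨r', hr', hr1⟩ := exists_between hr
  exact ⟨_, isTrajectory_picardLimit hA hh hr' hr1 hs hzr.le⟩

open Classical in
/-- The transition maps of the differential equation `w' = -h(w, t)`. -/
def transition (h : Cn n → ℝ → Cn n) (s t : ℝ) (z : Cn n) : Cn n :=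
  if hw : ∃ w, IsTrajectory h s w ∧ w s = z then hw.choose t else 0

theorem IsTrajectory.transition_eq (hA : 0 < lowerIndex A) (hh : IsGenerator A h) {s t : ℝ}
    (hs : 0 ≤ s) (hst : s ≤ t) {w : ℝ → Cn n} (hw : IsTrajectory h s w) :
    transition h s t (w s) = w t := by
  have hex : ∃ w', IsTrajectory h s w' ∧ w' s = w s := ⟨w, hw, rfl⟩
  rw [transition, dif_pos hex]
  exact (hex.choose_spec.1.eq_of_eq hA hh hs hst hw).1 hex.choose_spec.2

theorem isTrajectory_transition (hA : 0 < lowerIndex A) (hh : IsGenerator A h) {s : ℝ}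
    (hs : 0 ≤ s) {z : Cn n} (hz : z ∈ unitBall n) :
    IsTrajectory h s (fun t => transition h s t z) ∧ transition h s s z = z := by
  have hex := exists_trajectory hA hh hs hz
  have : (fun t => transition h s t z) = hex.choose := by
    funext t
    rw [transition, dif_pos hex]
  refine ⟨this ▸ hex.choose_spec.1, ?_⟩
  rw [transition, dif_pos hex]
  exact hex.choose_spec.2

theorem transition_mem (hA : 0 < lowerIndex A) (hh : IsGenerator A h) {s t : ℝ}
    (hs : 0 ≤ s) (hst : s ≤ t) {z : Cn n} (hz : z ∈ unitBall n) :
    transition h s t z ∈ unitBall n :=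
  (isTrajectory_transition hA hh hs hz).1.mem t hst

theorem norm_transition_le (hA : 0 < lowerIndex A) (hh : IsGenerator A h) {s t : ℝ}
    (hs : 0 ≤ s) (hst : s ≤ t) {z : Cn n} (hz : z ∈ unitBall n) :
    ‖transition h s t z‖ ≤ ‖z‖ := by
  obtain ⟨h1, h2⟩ := isTrajectory_transition hA hh hs hz
  have := h1.norm_le hh hs hst
  rwa [h2] at this

theorem transition_comp (hA : 0 < lowerIndex A) (hh : IsGenerator A h) {s t u : ℝ}
    (hs : 0 ≤ s) (hst : s ≤ t) (htu : t ≤ u) {z : Cn n} (hz : z ∈ unitBall n) :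
    transition h t u (transition h s t z) = transition h s u z :=
  ((isTrajectory_transition hA hh hs hz).1.restrict hst).transition_eq hA hh (hs.trans hst) htu

theorem transition_injOn (hA : 0 < lowerIndex A) (hh : IsGenerator A h) {s t : ℝ}
    (hs : 0 ≤ s) (hst : s ≤ t) : InjOn (transition h s t) (unitBall n) := by
  intro z hz w hw heq
  obtain ⟨h1, h2⟩ := isTrajectory_transition hA hh hs hz
  obtain ⟨h3, h4⟩ := isTrajectory_transition hA hh hs hw
  have := (h1.eq_of_eq hA hh hs hst h3).2 heq
  rwa [h2, h4] at this

theorem transition_zero (hA : 0 < lowerIndex A) (hh : IsGenerator A h) {s t : ℝ}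
    (hs : 0 ≤ s) (hst : s ≤ t) : transition h s t 0 = 0 := by
  have := norm_transition_le hA hh hs hst zero_mem_unitBall
  simpa using this

/-- It matters that `δ` depends only on `r₀` and not on the initial time `s`, so that long times can
be reached in finitely many steps. -/
theorem exists_short_time_differentiableOn (hA : 0 < lowerIndex A) (hh : IsGenerator A h)
    {r₀ : ℝ} (hr₀ : r₀ < 1) : ∃ δ, 0 < δ ∧ ∀ s t, 0 ≤ s → s ≤ t → t ≤ s + δ →
      DifferentiableOn ℂ (transition h s t) (ball 0 r₀) := by
  obtain ⟨r, hr0, hr⟩ := exists_between hr₀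
  obtain ⟨r', hr', hr1⟩ := exists_between hr
  obtain ⟨M, L, hH⟩ := isCaratheodory_cutoffField hA hh hr' hr1
  have hM := hH.bound_nonneg
  have hδ : 0 < (r - r₀) / (M + 1) := div_pos (by linarith) (by linarith)
  refine ⟨(r - r₀) / (M + 1), hδ, fun s t hs hst ht => ?_⟩
  refine (differentiableOn_picardLimit hH (r₀ := r₀) (r := r) (δ := (r - r₀) / (M + 1)) (s := s)
    ?_ (fun x hx => ?_) hst ht).congr fun z hz => ?_
  · have : M * ((r - r₀) / (M + 1)) ≤ (M + 1) * ((r - r₀) / (M + 1)) := by gcongr; linarith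
    rw [mul_div_cancel₀ _ (by linarith)] at this
    linarith
  · have hx0 : 0 ≤ x := hs.trans hx.le
    refine ((hh.mem_N x hx0).holomorphic.mono (ball_subset_ball hr.le)).neg.congr fun z hz => ?_
    rw [cutoffField, if_pos hx0, cutoff_eq_one hr' (mem_ball_zero_iff.1 hz).le,
      Complex.ofReal_one, one_smul]
    rfl
  · obtain ⟨h1, h2⟩ := isTrajectory_picardLimit hA hh hr' hr1 hs (z := z)
      ((mem_ball_zero_iff.1 hz).le.trans hr0.le)
    have := h1.transition_eq hA hh hs hst
    rwa [h2] at this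

/-- Composition of short steps; transition maps do not increase norms, so every step keeps the ball
of radius `r`. -/
theorem differentiableOn_transition (hA : 0 < lowerIndex A) (hh : IsGenerator A h) {s t : ℝ}
    (hs : 0 ≤ s) (hst : s ≤ t) : DifferentiableOn ℂ (transition h s t) (unitBall n) := by
  intro z hz
  obtain ⟨r, hzr, hr⟩ := exists_between (mem_unitBall.1 hz)
  obtain ⟨δ, hδ, hδd⟩ := exists_short_time_differentiableOn hA hh hr
  have key : ∀ N : ℕ, ∀ t, s ≤ t → t ≤ s + N * δ →
      DifferentiableOn ℂ (transition h s t) (ball 0 r) := by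
    intro N
    induction N with
    | zero =>
      intro t h1 h2
      exact hδd s t hs h1 (by simp at h2; linarith)
    | succ N ih =>
      intro t h1 h2
      rcases le_total t (s + N * δ) with h3 | h3
      · exact ih t h1 h3
      have h4 : s ≤ s + N * δ := le_add_of_nonneg_right (by positivity)
      refine ((hδd (s + N * δ) t (hs.trans h4) h3 (by push_cast at h2; linarith)).comp
        (ih (s + N * δ) h4 le_rfl) fun w hw => ?_).congr fun w hw => ?_
      · have hw1 : ‖w‖ < r := mem_ball_zero_iff.1 hw
        exact mem_ball_zero_iff.2 ((norm_transition_le hA hh hs h4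
          (mem_unitBall.2 (hw1.trans hr))).trans_lt hw1)
      · exact (transition_comp hA hh hs h4 h3
          (mem_unitBall.2 ((mem_ball_zero_iff.1 hw).trans hr))).symm
  obtain ⟨N, hN⟩ := exists_nat_ge ((t - s) / δ)
  rw [div_le_iff₀ hδ] at hN
  exact ((key N t hst (by linarith)).differentiableAt
    (isOpen_ball.mem_nhds (mem_ball_zero_iff.2 hzr))).differentiableWithinAt

theorem exists_norm_transition_sub_le (hA : 0 < lowerIndex A) (hh : IsGenerator A h) {r : ℝ}
    (hr : r < 1) : ∃ C, 0 ≤ C ∧ ∀ s t, 0 ≤ s → s ≤ t → ∀ z, ‖z‖ ≤ r →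
      ‖transition h s t z - z‖ ≤ C * (t - s) := by
  obtain ⟨C, hC, hCb⟩ := exists_bound_isInN hA hr
  refine ⟨C, hC, fun s t hs hst z hz => ?_⟩
  have hzb : z ∈ unitBall n := mem_unitBall.2 (by linarith)
  obtain ⟨h1, h2⟩ := isTrajectory_transition hA hh hs hzb
  have := norm_sub_le_of_ae_hasDerivAt (B := fun x => C * x) (B' := fun _ => C)
    (u' := fun x => -h (transition h s x z) x) hst ((h1.lip t).absolutelyContinuous hst)
    ((LipOn.of_contDiff (by fun_prop) s t).absolutelyContinuous hst) (by
      filter_upwards [h1.deriv] with x hx hxs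
      refine ⟨hx hxs.1, by simpa using (hasDerivAt_id x).const_mul C, ?_⟩
      rw [norm_neg]
      exact hCb _ (hh.mem_N x (hs.trans hxs.1.le)) _
        ((norm_transition_le hA hh hs hxs.1.le hzb).trans hz))
  rw [h2] at this
  linarith

theorem intervalIntegrable_generator (hA : 0 < lowerIndex A) (hh : IsGenerator A h) {z : Cn n}
    (hz : z ∈ unitBall n) {a b : ℝ} (ha : 0 ≤ a) (hb : 0 ≤ b) :
    IntervalIntegrable (h z) volume a b := by
  obtain ⟨C, hC, hCb⟩ := exists_bound_isInN hA (mem_unitBall.1 hz)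
  rw [intervalIntegrable_iff]
  have hsub : uIoc a b ⊆ Ici 0 := fun x hx => (le_min ha hb).trans hx.1.le
  refine ⟨((hh.measurable z hz).aestronglyMeasurable).mono_measure
    (Measure.restrict_mono hsub le_rfl),
    HasFiniteIntegral.restrict_of_bounded (C := C) (by simp) ?_⟩
  filter_upwards [ae_restrict_mem measurableSet_uIoc] with x hx
  exact hCb _ (hh.mem_N x (hsub hx)) z le_rfl

/-- Freezing the space variable at `z` changes the velocity by `O(t - s)`, hence the position by
`O((t - s)²)`. This second order accuracy later gives the Loewner equation at Lebesgue points. -/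
theorem exists_norm_transition_sub_integral_le (hA : 0 < lowerIndex A) (hh : IsGenerator A h)
    {r : ℝ} (hr : r < 1) : ∃ C, 0 ≤ C ∧ ∀ s t, 0 ≤ s → s ≤ t → ∀ z, ‖z‖ ≤ r →
      ‖transition h s t z - z + ∫ x in s..t, h z x‖ ≤ C * (t - s) ^ 2 := by
  obtain ⟨C, hC, hCb⟩ := exists_norm_transition_sub_le hA hh hr
  obtain ⟨L, hL, hLb⟩ := exists_lipschitz_isInN hA hr
  refine ⟨L * C, by positivity, fun s t hs hst z hz => ?_⟩
  have hzb : z ∈ unitBall n := mem_unitBall.2 (by linarith)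
  obtain ⟨h1, h2⟩ := isTrajectory_transition hA hh hs hzb
  obtain ⟨D, hD, hDb⟩ := exists_bound_isInN hA hr
  have h_int : ∀ a b, 0 ≤ a → 0 ≤ b → IntervalIntegrable (h z) volume a b := fun a b =>
    intervalIntegrable_generator hA hh hzb
  have hlip : LipOn (fun x => ∫ y in s..x, h z y) s t := by
    refine LipOn.of_dist_le (C := D) fun x hx y hy hxy => ?_
    have hx0 := hs.trans hx.1
    have hy0 := hs.trans hy.1
    rw [intervalIntegral.integral_interval_sub_left (h_int _ _ hs hy0) (h_int _ _ hs hx0)]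
    refine (intervalIntegral.norm_integral_le_of_norm_le_const (C := D) fun τ hτ => ?_).trans_eq ?_
    · rw [uIoc_of_le hxy] at hτ
      exact hDb _ (hh.mem_N τ (hx0.trans hτ.1.le)) z hz
    · rw [abs_of_nonneg (sub_nonneg.2 hxy)]
  have := norm_sub_le_of_ae_hasDerivAt (B := fun x => L * C * (t - s) * x)
    (B' := fun _ => L * C * (t - s))
    (u := fun x => transition h s x z + ∫ y in s..x, h z y)
    (u' := fun x => -h (transition h s x z) x + h z x) hst
    (((h1.lip t).add hlip).absolutelyContinuous hst)
    ((LipOn.of_contDiff (by fun_prop) s t).absolutelyContinuous hst) (by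
      filter_upwards [h1.deriv, (h_int s t hs (hs.trans hst)).ae_hasDerivAt_integral]
        with x hx hxi hxs
      refine ⟨(hx hxs.1).add (hxi ?_ s left_mem_uIcc),
        by simpa using (hasDerivAt_id x).const_mul (L * C * (t - s)), ?_⟩
      · rw [uIcc_of_le hst]; exact ⟨hxs.1.le, hxs.2.le⟩
      · rw [neg_add_eq_sub, norm_sub_rev]
        refine (hLb _ (hh.mem_N x (hs.trans hxs.1.le)) _ _
          ((norm_transition_le hA hh hs hxs.1.le hzb).trans hz) hz).trans ?_
        rw [mul_assoc]
        gcongr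
        refine (hCb s x hs hxs.1.le z hz).trans ?_
        gcongr
        exact hxs.2.le)
  rw [h2, intervalIntegral.integral_same, add_zero] at this
  calc _ = ‖transition h s t z + (∫ x in s..t, h z x) - z‖ := by congr 1; abel
    _ ≤ _ := this
    _ = _ := by ring

theorem exists_norm_transition_decay (hA : 0 < lowerIndex A) (hh : IsGenerator A h) {r : ℝ}
    (hr : r < 1) : ∃ C, 0 < C ∧ ∀ s t, 0 ≤ s → s ≤ t → ∀ z, ‖z‖ ≤ r →
      ‖transition h s t z‖ ≤ C * Real.exp (-(lowerIndex A * (t - s))) * ‖z‖ := by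
  obtain ⟨C, hC, hCb⟩ := exists_decay hA hh hr
  refine ⟨C, hC, fun s t hs hst z hz => ?_⟩
  obtain ⟨h1, h2⟩ := isTrajectory_transition hA hh hs (mem_unitBall.2 (hz.trans_lt hr))
  have := hCb s hs _ h1 (by rwa [h2]) t hst
  rwa [h2] at this

end Transition

/-! ### Growth of `e^{tL}` on spectral subspaces -/

section Growth

variable {V : Type*} [NormedAddCommGroup V] [NormedSpace ℂ V] [FiniteDimensional ℂ V]

/-- The one-parameter group `e^{tL}`. -/
def expL (L : V →L[ℂ] V) (t : ℝ) : V →L[ℂ] V := NormedSpace.exp ((t : ℂ) • L)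

theorem expL_zero (L : V →L[ℂ] V) : expL L 0 = 1 := by simp [expL]

theorem expL_add (L : V →L[ℂ] V) (s t : ℝ) : expL L (s + t) = expL L s * expL L t := by
  have := FiniteDimensional.complete ℂ V
  let : NormedAlgebra ℚ (V →L[ℂ] V) := NormedAlgebra.restrictScalars ℚ ℂ _
  rw [expL, expL, expL, Complex.ofReal_add, add_smul]
  exact NormedSpace.exp_add_of_commute (((Commute.refl L).smul_left _).smul_right _)

theorem expL_add_apply (L : V →L[ℂ] V) (s t : ℝ) (v : V) :
    expL L (s + t) v = expL L s (expL L t v) := by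
  rw [expL_add]; rfl

theorem expL_neg_apply_apply (L : V →L[ℂ] V) (t : ℝ) (v : V) :
    expL L (-t) (expL L t v) = v := by
  rw [← expL_add_apply, neg_add_cancel, expL_zero]; rfl

theorem expL_apply_neg_apply (L : V →L[ℂ] V) (t : ℝ) (v : V) :
    expL L t (expL L (-t) v) = v := by
  rw [← expL_add_apply, add_neg_cancel, expL_zero]; rfl

theorem hasDerivAt_expL (L : V →L[ℂ] V) (t : ℝ) : HasDerivAt (expL L) (L * expL L t) t := by
  have := FiniteDimensional.complete ℂ V
  have h := (hasDerivAt_exp_smul_const' L (t : ℂ)).scomp t (Complex.ofRealCLM.hasDerivAt)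
  exact h.congr_deriv (by simp [expL])

theorem commute_expL {L M : V →L[ℂ] V} (h : Commute M L) (t : ℝ) : Commute M (expL L t) :=
  (h.smul_right (t : ℂ)).exp_right

theorem expL_apply_comm (L : V →L[ℂ] V) (t : ℝ) (v : V) : expL L t (L v) = L (expL L t v) :=
  congrArg (fun M : V →L[ℂ] V => M v) (commute_expL (Commute.refl L) t).symm.eq

theorem hasDerivAt_expL_apply (L : V →L[ℂ] V) {y : ℝ → V} {y' : V} {t : ℝ}
    (hy : HasDerivAt y y' t) :
    HasDerivAt (fun t => expL L t (y t)) (L (expL L t (y t)) + expL L t y') t :=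
  ((ContinuousLinearMap.restrictScalarsL ℂ V V ℝ ℝ).hasFDerivAt.comp_hasDerivAt t
    (hasDerivAt_expL L t)).clm_apply hy

theorem contDiff_expL (L : V →L[ℂ] V) : ContDiff ℝ 1 (expL L) := by
  have hc : Continuous (expL L) :=
    continuous_iff_continuousAt.2 fun t => (hasDerivAt_expL L t).continuousAt
  refine contDiff_one_iff_deriv.2 ⟨fun t => (hasDerivAt_expL L t).differentiableAt, ?_⟩
  have : deriv (expL L) = fun t => L * expL L t := funext fun t => (hasDerivAt_expL L t).deriv
  rw [this]
  exact continuous_const.mul hc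

theorem continuous_expL (L : V →L[ℂ] V) : Continuous (expL L) := (contDiff_expL L).continuous

/-- Induction on the order of nilpotency: the derivative of `e^{tL} v` is `e^{tL} (L v)`, and one
integration costs one power of `t`. -/
theorem exists_norm_expL_apply_le_of_pow_apply_eq_zero (L : V →L[ℂ] V) (d : ℕ) :
    ∀ v : V, (((L : V →ₗ[ℂ] V) ^ d) v = 0) →
      ∃ C : ℝ, 0 ≤ C ∧ ∀ t : ℝ, ‖expL L t v‖ ≤ C * (1 + |t|) ^ d := by
  induction d with
  | zero =>
    intro v hv
    refine ⟨0, le_rfl, fun t => ?_⟩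
    have : v = 0 := by simpa using hv
    simp [this]
  | succ d ih =>
    intro v hv
    obtain ⟨C, hC, h⟩ := ih (L v) (by rw [pow_succ] at hv; exact hv)
    refine ⟨C + ‖v‖, by positivity, fun t => ?_⟩
    have hd : ∀ x : ℝ, HasDerivAt (fun x => expL L x v) (expL L x (L v)) x := fun x =>
      (hasDerivAt_expL_apply L (hasDerivAt_const x v)).congr_deriv (by
        rw [map_zero, add_zero, expL_apply_comm])
    have hb : ∀ x ∈ uIcc 0 t, ‖expL L x (L v)‖ ≤ C * (1 + |t|) ^ d := fun x hx => by
      refine (h x).trans ?_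
      have : |x| ≤ |t| := by
        have := abs_sub_left_of_mem_uIcc hx
        simpa using this
      gcongr
    have := (convex_uIcc (0 : ℝ) t).norm_image_sub_le_of_norm_hasDerivWithin_le
      (fun x _ => (hd x).hasDerivWithinAt) hb left_mem_uIcc right_mem_uIcc
    rw [expL_zero, sub_zero, Real.norm_eq_abs] at this
    have h1 : ‖expL L t v‖ ≤ ‖v‖ + C * (1 + |t|) ^ d * |t| := by
      have h2 := norm_sub_norm_le (expL L t v) ((1 : V →L[ℂ] V) v)
      have h3 : ‖((1 : V →L[ℂ] V) v)‖ = ‖v‖ := rfl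
      linarith
    have h4 : (1 : ℝ) ≤ (1 + |t|) ^ (d + 1) := one_le_pow₀ (by linarith [abs_nonneg t])
    have h5 : (1 + |t|) ^ d * |t| ≤ (1 + |t|) ^ (d + 1) := by
      rw [pow_succ]; gcongr; linarith [abs_nonneg t]
    nlinarith [norm_nonneg v]

/-- `e^{tL} = e^{tμ} e^{t(L - μ)}`, and `L - μ` is nilpotent on `v`. -/
theorem exists_norm_expL_apply_le_of_mem_maxGenEigenspace (L : V →L[ℂ] V) {μ : ℂ} {v : V}
    (hv : v ∈ End.maxGenEigenspace (L : V →ₗ[ℂ] V) μ) :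
    ∃ (C : ℝ) (d : ℕ), 0 ≤ C ∧
      ∀ t : ℝ, ‖expL L t v‖ ≤ C * (1 + |t|) ^ d * Real.exp (t * μ.re) := by
  have := FiniteDimensional.complete ℂ V
  obtain ⟨d, hd⟩ := (End.mem_maxGenEigenspace _ _ _).1 hv
  obtain ⟨C, hC, h⟩ := exists_norm_expL_apply_le_of_pow_apply_eq_zero
    (L - μ • (1 : V →L[ℂ] V)) d v (by rw [← hd]; rfl)
  refine ⟨C, d, hC, fun t => ?_⟩
  have h1 : expL L t = Complex.exp (t * μ) • expL (L - μ • (1 : V →L[ℂ] V)) t := by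
    let : NormedAlgebra ℚ (V →L[ℂ] V) := NormedAlgebra.restrictScalars ℚ ℂ _
    have h2 : (t : ℂ) • L = algebraMap ℂ (V →L[ℂ] V) (t * μ) +
        (t : ℂ) • (L - μ • (1 : V →L[ℂ] V)) := by
      rw [Algebra.algebraMap_eq_smul_one, smul_sub, smul_smul]; abel
    rw [expL, h2, NormedSpace.exp_add_of_commute (Algebra.commutes _ _),
      ← NormedSpace.algebraMap_exp_comm, ← Complex.exp_eq_exp_ℂ, Algebra.algebraMap_eq_smul_one,
      smul_mul_assoc, one_mul]
    rfl
  have h3 : ‖Complex.exp (t * μ)‖ = Real.exp (t * μ.re) := by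
    rw [Complex.norm_exp, Complex.re_ofReal_mul]
  rw [h1, smul_apply, norm_smul, h3, mul_comm]
  exact mul_le_mul_of_nonneg_right (h t) (Real.exp_nonneg _)

/-- The time set `T` and the exponent `b` are left free so that one statement serves forward time on
the stable subspace and backward time on the unstable one. Only actual eigenvalues in `S` matter,
the other generalized eigenspaces being zero. -/
theorem exists_norm_expL_apply_le_of_mem_spectralSubspace (L : V →L[ℂ] V) {S : Set ℂ} {T : Set ℝ}
    {b : ℝ → ℝ}
    (hb : ∀ μ ∈ S, End.HasEigenvalue (L : V →ₗ[ℂ] V) μ → ∀ t ∈ T, t * μ.re ≤ b t) {v : V}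
    (hv : v ∈ spectralSubspace (L : V →ₗ[ℂ] V) S) :
    ∃ (C : ℝ) (d : ℕ), 0 ≤ C ∧
      ∀ t ∈ T, ‖expL L t v‖ ≤ C * (1 + |t|) ^ d * Real.exp (b t) := by
  rw [spectralSubspace, ← iSup_subtype''] at hv
  refine Submodule.iSup_induction _ (motive := fun v => ∃ (C : ℝ) (d : ℕ), 0 ≤ C ∧
    ∀ t ∈ T, ‖expL L t v‖ ≤ C * (1 + |t|) ^ d * Real.exp (b t)) hv ?_ ?_ ?_
  · rintro ⟨μ, hμ⟩ x hx
    rcases eq_or_ne x 0 with rfl | hx0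
    · exact ⟨0, 0, le_rfl, fun t _ => by simp⟩
    obtain ⟨k, hk⟩ := (End.mem_maxGenEigenspace _ _ _).1 hx
    have he : End.HasEigenvalue (L : V →ₗ[ℂ] V) μ := by
      refine End.hasEigenvalue_of_hasGenEigenvalue (k := k) fun hbot => hx0 ?_
      have : x ∈ (End.genEigenspace (L : V →ₗ[ℂ] V) μ) k := End.mem_genEigenspace_nat.2 hk
      rw [hbot] at this
      simpa using this
    obtain ⟨C, d, hC, h⟩ := exists_norm_expL_apply_le_of_mem_maxGenEigenspace L hx
    refine ⟨C, d, hC, fun t ht => (h t).trans ?_⟩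
    have := hb μ hμ he t ht
    gcongr
  · exact ⟨0, 0, le_rfl, fun t _ => by simp⟩
  · rintro x y ⟨C₁, d₁, hC₁, h₁⟩ ⟨C₂, d₂, hC₂, h₂⟩
    refine ⟨C₁ + C₂, max d₁ d₂, by positivity, fun t ht => ?_⟩
    rw [map_add]
    have h0 : (1 : ℝ) ≤ 1 + |t| := by linarith [abs_nonneg t]
    have e1 : (1 + |t|) ^ d₁ ≤ (1 + |t|) ^ max d₁ d₂ := pow_le_pow_right₀ h0 (le_max_left _ _)
    have e2 : (1 + |t|) ^ d₂ ≤ (1 + |t|) ^ max d₁ d₂ := pow_le_pow_right₀ h0 (le_max_right _ _)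
    calc _ ≤ _ := norm_add_le _ _
      _ ≤ C₁ * (1 + |t|) ^ d₁ * Real.exp (b t) + C₂ * (1 + |t|) ^ d₂ * Real.exp (b t) :=
        add_le_add (h₁ t ht) (h₂ t ht)
      _ ≤ C₁ * (1 + |t|) ^ max d₁ d₂ * Real.exp (b t) +
          C₂ * (1 + |t|) ^ max d₁ d₂ * Real.exp (b t) := by gcongr
      _ = _ := by ring

theorem exists_norm_expL_comp_le (L : V →L[ℂ] V) {S : Set ℂ} {T : Set ℝ} {b : ℝ → ℝ}
    (hb : ∀ μ ∈ S, End.HasEigenvalue (L : V →ₗ[ℂ] V) μ → ∀ t ∈ T, t * μ.re ≤ b t)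
    (P : V →ₗ[ℂ] V) (hP : ∀ v, P v ∈ spectralSubspace (L : V →ₗ[ℂ] V) S) :
    ∃ (C : ℝ) (d : ℕ), 0 ≤ C ∧
      ∀ t ∈ T, ∀ v, ‖expL L t (P v)‖ ≤ C * (1 + |t|) ^ d * Real.exp (b t) * ‖v‖ := by
  set B := Module.finBasis ℂ V
  choose C d hC h using fun i => exists_norm_expL_apply_le_of_mem_spectralSubspace L hb (hP (B i))
  have hC' : 0 ≤ ∑ i, C i := Finset.sum_nonneg fun i _ => hC i
  refine ⟨Fintype.card (Fin (finrank ℂ V)) • ‖(B.equivFunL : V →L[ℂ] (Fin (finrank ℂ V) → ℂ))‖ *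
    ∑ i, C i, ∑ i, d i, by positivity, fun t ht v => ?_⟩
  have h0 : (1 : ℝ) ≤ 1 + |t| := by linarith [abs_nonneg t]
  have := B.opNorm_le (u := (expL L t).comp (LinearMap.toContinuousLinearMap P))
    (M := (∑ i, C i) * (1 + |t|) ^ (∑ i, d i) * Real.exp (b t)) (by positivity) (fun i => by
      refine (h i t ht).trans ?_
      have e1 : (1 + |t|) ^ d i ≤ (1 + |t|) ^ (∑ i, d i) :=
        pow_le_pow_right₀ h0 (Finset.single_le_sum (f := d) (by simp) (Finset.mem_univ i))
      have e2 : C i ≤ ∑ i, C i := Finset.single_le_sum (fun i _ => hC i) (Finset.mem_univ i)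
      gcongr)
  refine (((expL L t).comp (LinearMap.toContinuousLinearMap P)).le_of_opNorm_le this v).trans_eq ?_
  ring

theorem exists_pow_mul_exp_le {c : ℝ} (hc : 0 < c) (d : ℕ) :
    ∃ C : ℝ, 0 < C ∧ ∀ t : ℝ, 0 ≤ t → (1 + t) ^ d * Real.exp (-(c * t)) ≤ C := by
  refine ⟨(d ! : ℝ) / c ^ d * Real.exp c, by positivity, fun t ht => ?_⟩
  have := Real.pow_div_factorial_le_exp (c * (1 + t)) (by positivity) d
  rw [div_le_iff₀ (by positivity), mul_pow] at this
  have h1 : (1 + t) ^ d ≤ (d ! : ℝ) / c ^ d * Real.exp (c * (1 + t)) := by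
    rw [div_mul_eq_mul_div, le_div_iff₀ (by positivity)]
    linarith
  calc _ ≤ (d ! : ℝ) / c ^ d * Real.exp (c * (1 + t)) * Real.exp (-(c * t)) := by gcongr
    _ = _ := by rw [mul_assoc, ← Real.exp_add]; ring_nf

end Growth

/-! ### Functions of polynomial growth, with a switch `p` for boundedness -/

/-- `u` has at most polynomial growth on `[0, ∞)`, and is bounded if `p` holds. -/
def PolyB (p : Prop) (u : ℝ → ℝ) : Prop :=
  ∃ (C : ℝ) (d : ℕ), 0 ≤ C ∧ (p → d = 0) ∧ ∀ t : ℝ, 0 ≤ t → u t ≤ C * (1 + t) ^ d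

namespace PolyB

variable {p : Prop} {u v : ℝ → ℝ}

theorem mono (hv : PolyB p v) (h : ∀ t, 0 ≤ t → u t ≤ v t) : PolyB p u := by
  obtain ⟨C, d, hC, hp, H⟩ := hv
  exact ⟨C, d, hC, hp, fun t ht => (h t ht).trans (H t ht)⟩

theorem const (p : Prop) (c : ℝ) : PolyB p (fun _ => c) :=
  ⟨|c|, 0, abs_nonneg c, fun _ => rfl, fun t _ => by simpa using le_abs_self c⟩

theorem add (hu : PolyB p u) (hv : PolyB p v) : PolyB p (fun t => u t + v t) := by
  obtain ⟨C₁, d₁, hC₁, hp₁, h₁⟩ := hu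
  obtain ⟨C₂, d₂, hC₂, hp₂, h₂⟩ := hv
  refine ⟨C₁ + C₂, d₁ + d₂, by positivity, fun hp => by simp [hp₁ hp, hp₂ hp], fun t ht => ?_⟩
  have h0 : (1 : ℝ) ≤ 1 + t := by linarith
  have e1 : (1 + t) ^ d₁ ≤ (1 + t) ^ (d₁ + d₂) := pow_le_pow_right₀ h0 (by omega)
  have e2 : (1 + t) ^ d₂ ≤ (1 + t) ^ (d₁ + d₂) := pow_le_pow_right₀ h0 (by omega)
  rw [add_mul]
  refine add_le_add ((h₁ t ht).trans ?_) ((h₂ t ht).trans ?_) <;> gcongr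

theorem const_mul {c : ℝ} (hc : 0 ≤ c) (hu : PolyB p u) : PolyB p (fun t => c * u t) := by
  obtain ⟨C, d, hC, hp, H⟩ := hu
  exact ⟨c * C, d, by positivity, hp, fun t ht => by
    rw [mul_assoc]; exact mul_le_mul_of_nonneg_left (H t ht) hc⟩

theorem sum {ι : Type*} (s : Finset ι) {u : ι → ℝ → ℝ} (h : ∀ i ∈ s, PolyB p (u i)) :
    PolyB p (fun t => ∑ i ∈ s, u i t) := by
  classical
  induction s using Finset.induction_on with
  | empty => simpa using const p 0
  | insert a s ha ih =>
    simp only [Finset.sum_insert ha]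
    exact (h a (Finset.mem_insert_self _ _)).add
      (ih fun i hi => h i (Finset.mem_insert_of_mem hi))

end PolyB

/-! ### Spectral projections and the spectral gap -/

section SpectralProjection

variable {V : Type*} [AddCommGroup V] [Module ℂ V] [FiniteDimensional ℂ V]

theorem mapsTo_spectralSubspace {L M : End ℂ V} (h : Commute L M) (S : Set ℂ) {v : V}
    (hv : v ∈ spectralSubspace L S) : M v ∈ spectralSubspace L S := by
  have : spectralSubspace L S ≤ (spectralSubspace L S).comap M := by
    refine iSup₂_le fun μ hμ x hx => ?_
    exact Submodule.mem_iSup_of_mem μ (Submodule.mem_iSup_of_mem hμ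
      (End.mapsTo_maxGenEigenspace_of_comm h μ hx))
  exact this hv

theorem spectralProjection_mem (L : End ℂ V) (S : Set ℂ) (v : V) :
    spectralProjection L S v ∈ spectralSubspace L S :=
  Submodule.projection_apply_mem _ v

theorem sub_spectralProjection_mem (L : End ℂ V) (S : Set ℂ) (v : V) :
    v - spectralProjection L S v ∈ spectralSubspace L Sᶜ :=
  Submodule.sub_projection_mem _ v

theorem spectralProjection_eq_self {L : End ℂ V} {S : Set ℂ} {v : V}
    (hv : v ∈ spectralSubspace L S) : spectralProjection L S v = v :=
  (Submodule.projection_eq_self_iff _ v).2 hv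

theorem spectralProjection_eq_zero {L : End ℂ V} {S : Set ℂ} {v : V}
    (hv : v ∈ spectralSubspace L Sᶜ) : spectralProjection L S v = 0 :=
  (Submodule.projection_apply_eq_zero_iff _).2 hv

theorem spectralProjection_commute {L M : End ℂ V} (h : Commute L M) (S : Set ℂ) (v : V) :
    spectralProjection L S (M v) = M (spectralProjection L S v) := by
  have h1 : M v = M (spectralProjection L S v) + M (v - spectralProjection L S v) := by
    rw [← map_add]; congr 1; abel
  rw [h1, map_add, spectralProjection_eq_self (mapsTo_spectralSubspace h S
    (spectralProjection_mem L S v)), spectralProjection_eq_zero (mapsTo_spectralSubspace h Sᶜ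
    (sub_spectralProjection_mem L S v)), add_zero]

theorem spectralProjection_eq_zero_of_forall {L : End ℂ V} {S : Set ℂ}
    (h : ∀ μ ∈ S, ¬ L.HasEigenvalue μ) : spectralProjection L S = 0 := by
  ext v
  have hbot : spectralSubspace L S = ⊥ := by
    refine le_bot_iff.1 (iSup₂_le fun μ hμ x hx => ?_)
    by_contra hx0
    obtain ⟨k, hk⟩ := (End.mem_maxGenEigenspace _ _ _).1 hx
    refine h μ hμ (End.hasEigenvalue_of_hasGenEigenvalue (k := k) fun hb => hx0 ?_)
    rw [← hb]
    exact End.mem_genEigenspace_nat.2 hk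
  have := spectralProjection_mem L S v
  rw [hbot] at this
  simpa using this

/-- There are finitely many eigenvalues. The factor `2` reserves half of the gap for absorbing
polynomial factors. -/
theorem exists_spectral_gap (L : End ℂ V) :
    ∃ c : ℝ, 0 < c ∧ ∀ μ, L.HasEigenvalue μ → μ.re ≠ 0 → 2 * c ≤ |μ.re| := by
  have hf : {μ | L.HasEigenvalue μ ∧ μ.re ≠ 0}.Finite :=
    L.finite_hasEigenvalue.subset fun μ hμ => hμ.1
  rcases Set.eq_empty_or_nonempty {μ | L.HasEigenvalue μ ∧ μ.re ≠ 0} with h0 | h0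
  · refine ⟨1, one_pos, fun μ h1 h2 => ?_⟩
    have : μ ∈ {μ | L.HasEigenvalue μ ∧ μ.re ≠ 0} := ⟨h1, h2⟩
    simp [h0] at this
  · obtain ⟨ν, hν, hmin⟩ := Set.exists_min_image _ (fun μ : ℂ => |μ.re|) hf h0
    refine ⟨|ν.re| / 2, by have := abs_pos.2 hν.2; positivity, fun μ h1 h2 => ?_⟩
    have := hmin μ ⟨h1, h2⟩
    linarith

end SpectralProjection

/-! ### Polynomially bounded solutions of linear equations -/

section LinearODE

variable {V : Type*} [NormedAddCommGroup V] [NormedSpace ℂ V] [FiniteDimensional ℂ V]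

/-- The spectral projection of `L` that belongs to the spectral values with nonpositive real
part. -/
abbrev stableProj {V : Type*} [AddCommGroup V] [Module ℂ V] [FiniteDimensional ℂ V]
    (L : End ℂ V) : V →ₗ[ℂ] V := spectralProjection L {l : ℂ | l.re ≤ 0}

theorem stableProj_expL (L : V →L[ℂ] V) (t : ℝ) (v : V) :
    stableProj (L : V →ₗ[ℂ] V) (expL L t v) = expL L t (stableProj (L : V →ₗ[ℂ] V) v) := by
  have : Commute (L : End ℂ V) (expL L t : V →ₗ[ℂ] V) := by
    ext v
    exact (expL_apply_comm L t v).symm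
  exact spectralProjection_commute this _ v

/-- On the unstable subspace `e^{-tL}` decays like `e^{-2ct}` times a polynomial, and half of the
exponent absorbs the polynomial. -/
theorem exists_norm_expL_neg_unstable_le (L : V →L[ℂ] V) :
    ∃ c C : ℝ, 0 < c ∧ 0 ≤ C ∧ ∀ t, 0 ≤ t → ∀ v,
      ‖expL L (-t) (v - stableProj (L : V →ₗ[ℂ] V) v)‖ ≤ C * Real.exp (-(c * t)) * ‖v‖ := by
  obtain ⟨c, hc, hgap⟩ := exists_spectral_gap (L : V →ₗ[ℂ] V)
  obtain ⟨C, d, hC, h⟩ := exists_norm_expL_comp_le L (S := {l : ℂ | l.re ≤ 0}ᶜ) (T := Iic 0)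
    (b := fun t => 2 * c * t) (fun μ hμ he t ht => by
      have h1 : 0 < μ.re := by simpa using hμ
      have h2 := hgap μ he h1.ne'
      rw [abs_of_pos h1] at h2
      have : t ≤ 0 := ht
      nlinarith) (LinearMap.id - stableProj (L : V →ₗ[ℂ] V))
      (fun v => sub_spectralProjection_mem _ _ v)
  obtain ⟨C', hC', h'⟩ := exists_pow_mul_exp_le hc d
  refine ⟨c, C * C', hc, by positivity, fun t ht v => ?_⟩
  refine (h (-t) (by simpa using ht) v).trans ?_
  rw [abs_neg, abs_of_nonneg ht]
  have e : Real.exp (2 * c * -t) = Real.exp (-(c * t)) * Real.exp (-(c * t)) := by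
    rw [← Real.exp_add]; ring_nf
  rw [e, mul_assoc C, ← mul_assoc ((1 + t) ^ d), ← mul_assoc C]
  have := h' t ht
  gcongr

theorem exists_norm_expL_stable_le (L : V →L[ℂ] V) :
    ∃ (C : ℝ) (d : ℕ), 0 ≤ C ∧ ∀ t, 0 ≤ t → ∀ v,
      ‖expL L t (stableProj (L : V →ₗ[ℂ] V) v)‖ ≤ C * (1 + t) ^ d * ‖v‖ := by
  obtain ⟨C, d, hC, h⟩ := exists_norm_expL_comp_le L (S := {l : ℂ | l.re ≤ 0}) (T := Ici 0)
    (b := fun t => 0) (fun μ hμ he t ht => mul_nonpos_of_nonneg_of_nonpos ht hμ)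
    (stableProj (L : V →ₗ[ℂ] V)) (fun v => spectralProjection_mem _ _ v)
  refine ⟨C, d, hC, fun t ht v => (h t ht v).trans_eq ?_⟩
  rw [abs_of_nonneg ht, Real.exp_zero, mul_one]

/-- Without purely imaginary eigenvalues the stable part decays instead of growing polynomially;
this is where nonresonance yields boundedness. -/
theorem exists_norm_expL_stable_le_exp (L : V →L[ℂ] V)
    (hL : ∀ μ, End.HasEigenvalue (L : V →ₗ[ℂ] V) μ → μ.re ≠ 0) :
    ∃ c C : ℝ, 0 < c ∧ 0 ≤ C ∧ ∀ t, 0 ≤ t → ∀ v,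
      ‖expL L t (stableProj (L : V →ₗ[ℂ] V) v)‖ ≤ C * Real.exp (-(c * t)) * ‖v‖ := by
  obtain ⟨c, hc, hgap⟩ := exists_spectral_gap (L : V →ₗ[ℂ] V)
  obtain ⟨C, d, hC, h⟩ := exists_norm_expL_comp_le L (S := {l : ℂ | l.re ≤ 0}) (T := Ici 0)
    (b := fun t => -(2 * c * t)) (fun μ hμ he t ht => by
      have h1 : μ.re ≤ 0 := hμ
      have h2 := hgap μ he (hL μ he)
      rw [abs_of_nonpos h1] at h2
      have : 0 ≤ t := ht
      nlinarith) (stableProj (L : V →ₗ[ℂ] V)) (fun v => spectralProjection_mem _ _ v)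
  obtain ⟨C', hC', h'⟩ := exists_pow_mul_exp_le hc d
  refine ⟨c, C * C', hc, by positivity, fun t ht v => ?_⟩
  refine (h t ht v).trans ?_
  rw [abs_of_nonneg ht]
  have e : Real.exp (-(2 * c * t)) = Real.exp (-(c * t)) * Real.exp (-(c * t)) := by
    rw [← Real.exp_add]; ring_nf
  rw [e, mul_assoc C, ← mul_assoc ((1 + t) ^ d), ← mul_assoc C]
  have := h' t ht
  gcongr

theorem integrableOn_Ioi_exp {c : ℝ} (hc : 0 < c) (K t : ℝ) :
    IntegrableOn (fun τ => K * Real.exp (-(c * (τ - t)))) (Ioi t) := by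
  have := (integrableOn_exp_mul_Ioi (neg_lt_zero.2 hc) t).const_mul (K * Real.exp (c * t))
  have h1 : ∀ τ : ℝ, K * Real.exp (-(c * (τ - t))) =
      K * Real.exp (c * t) * Real.exp (-c * τ) := fun τ => by
    rw [mul_assoc, ← Real.exp_add]; ring_nf
  simp only [h1]
  exact this

theorem integral_Ioi_exp {c : ℝ} (hc : 0 < c) (K t : ℝ) :
    ∫ τ in Ioi t, K * Real.exp (-(c * (τ - t))) = K / c := by
  have h1 : ∀ τ : ℝ, K * Real.exp (-(c * (τ - t))) =
      K * Real.exp (c * t) * Real.exp (-c * τ) := fun τ => by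
    rw [mul_assoc, ← Real.exp_add]; ring_nf
  simp only [h1]
  rw [integral_const_mul, integral_exp_mul_Ioi (neg_lt_zero.2 hc), neg_div_neg_eq, mul_assoc,
    ← mul_div_assoc, ← Real.exp_add]
  simp [div_eq_mul_inv]

theorem norm_setIntegral_Ioi_le {c K t : ℝ} (hc : 0 < c) {g : ℝ → V}
    (hg : ∀ τ, t < τ → ‖g τ‖ ≤ K * Real.exp (-(c * (τ - t)))) :
    ‖∫ τ in Ioi t, g τ‖ ≤ K / c := by
  rw [← integral_Ioi_exp hc K t]
  exact norm_integral_le_of_norm_le (integrableOn_Ioi_exp hc K t)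
    ((ae_restrict_iff' measurableSet_Ioi).2 (ae_of_all _ fun τ hτ => hg τ hτ))

theorem norm_intervalIntegral_le_of_exp {c K t : ℝ} (hc : 0 < c) (ht : 0 ≤ t) (hK : 0 ≤ K)
    {g : ℝ → V} (hg : ∀ τ, 0 < τ → τ ≤ t → ‖g τ‖ ≤ K * Real.exp (-(c * (t - τ)))) :
    ‖∫ τ in 0..t, g τ‖ ≤ K / c := by
  have h1 : ∀ τ, HasDerivAt (fun τ => K / c * Real.exp (-(c * (t - τ))))
      (K * Real.exp (-(c * (t - τ)))) τ := fun τ => by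
    have := (((((hasDerivAt_id τ).const_sub t).const_mul c).fun_neg).exp).const_mul (K / c)
    refine this.congr_deriv ?_
    simp only [id]
    field_simp
  have h2 : ∫ τ in 0..t, K * Real.exp (-(c * (t - τ))) =
      K / c * Real.exp (-(c * (t - t))) - K / c * Real.exp (-(c * (t - 0))) :=
    intervalIntegral.integral_eq_sub_of_hasDerivAt (fun τ _ => h1 τ)
      (Continuous.intervalIntegrable (by fun_prop) _ _)
  refine (intervalIntegral.norm_integral_le_of_norm_le ht
    (ae_of_all _ fun τ hτ => hg τ hτ.1 hτ.2)
    (Continuous.intervalIntegrable (by fun_prop) _ _)).trans ?_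
  rw [h2]
  have : 0 ≤ K / c * Real.exp (-(c * (t - 0))) := by positivity
  simp only [sub_self, mul_zero, neg_zero, Real.exp_zero]
  linarith

theorem intervalIntegrable_of_locallyIntegrable {g : ℝ → V} (hg : LocallyIntegrable g volume)
    (a b : ℝ) : IntervalIntegrable g volume a b :=
  (hg.integrableOn_isCompact isCompact_uIcc).intervalIntegrable

theorem lipOn_integral {g : ℝ → V} {a b M : ℝ} (hg : LocallyIntegrable g volume)
    (hM : ∀ t ∈ Icc a b, ‖g t‖ ≤ M) (x₀ : ℝ) : LipOn (fun t => ∫ τ in x₀..t, g τ) a b := by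
  refine LipOn.of_dist_le (C := M) fun x hx y hy hxy => ?_
  rw [intervalIntegral.integral_interval_sub_left (intervalIntegrable_of_locallyIntegrable hg _ _) (intervalIntegrable_of_locallyIntegrable hg _ _)]
  have := intervalIntegral.norm_integral_le_of_norm_le_const (a := x) (b := y) (f := g) (C := M)
    (fun t ht => hM t ⟨by rw [uIoc_of_le hxy] at ht; linarith [ht.1, hx.1],
      by rw [uIoc_of_le hxy] at ht; linarith [ht.2, hy.2]⟩)
  rwa [abs_of_nonneg (sub_nonneg.2 hxy)] at this

theorem LipOn.expL_apply (L : V →L[ℂ] V) {y : ℝ → V} {a b : ℝ} (hy : LipOn y a b) :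
    LipOn (fun t => expL L t (y t)) a b := by
  have h1 : LipOn (fun t => ContinuousLinearMap.restrictScalarsL ℂ V V ℝ ℝ (expL L t)) a b :=
    LipOn.of_contDiff ((ContinuousLinearMap.contDiff _).comp (contDiff_expL L)) a b
  exact LipOn.bilinear (ContinuousLinearMap.id ℝ (V →L[ℝ] V)) h1 hy

theorem LipOn.expL_neg_apply (L : V →L[ℂ] V) {y : ℝ → V} {a b : ℝ} (hy : LipOn y a b) :
    LipOn (fun t => expL L (-t) (y t)) a b := by
  have h1 : LipOn (fun t => ContinuousLinearMap.restrictScalarsL ℂ V V ℝ ℝ (expL L (-t))) a b :=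
    LipOn.of_contDiff ((ContinuousLinearMap.contDiff _).comp
      ((contDiff_expL L).comp contDiff_neg)) a b
  exact LipOn.bilinear (ContinuousLinearMap.id ℝ (V →L[ℝ] V)) h1 hy

theorem hasDerivAt_expL_neg_apply (L : V →L[ℂ] V) {y : ℝ → V} {y' : V} {t : ℝ}
    (hy : HasDerivAt y y' t) :
    HasDerivAt (fun t => expL L (-t) (y t)) (expL L (-t) (y' - L (y t))) t := by
  have h1 : HasDerivAt (fun t => expL L (-t)) (-(L * expL L (-t))) t := by
    have := (hasDerivAt_expL L (-t)).scomp t (hasDerivAt_neg t)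
    exact this.congr_deriv (by simp)
  have := ((ContinuousLinearMap.restrictScalarsL ℂ V V ℝ ℝ).hasFDerivAt.comp_hasDerivAt t
    h1).clm_apply hy
  refine this.congr_deriv ?_
  rw [map_sub, expL_apply_comm]
  simp
  abel

/-- The equation `F' = L F + N` with polynomially bounded right-hand side has a polynomially bounded
solution with prescribed stable part of the initial value. -/
theorem exists_polyB_solution (L : V →L[ℂ] V) {p : Prop}
    (hp : p → ∀ μ, End.HasEigenvalue (L : V →ₗ[ℂ] V) μ → μ.re ≠ 0) {N : ℝ → V}
    (hN : AEStronglyMeasurable N (volume.restrict (Ici 0))) (hNb : PolyB p (fun t => ‖N t‖))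
    {Q : V} (hQ : stableProj (L : V →ₗ[ℂ] V) Q = Q) :
    ∃ F : ℝ → V, stableProj (L : V →ₗ[ℂ] V) (F 0) = Q ∧ PolyB p (fun t => ‖F t‖) ∧
      (∀ T, LipOn F 0 T) ∧ ∀ᵐ t, 0 < t → HasDerivAt F (L (F t) + N t) t := by
  have := FiniteDimensional.complete ℂ V
  set P : V →L[ℂ] V := LinearMap.toContinuousLinearMap (stableProj (L : V →ₗ[ℂ] V)) with hPdef
  have hPE : ∀ t v, P (expL L t v) = expL L t (P v) := fun t v => stableProj_expL L t v
  obtain ⟨C, d, hC, hd, hNle⟩ := hNb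
  set N₁ : ℝ → V := (Ici (0 : ℝ)).indicator N with hN₁
  have hN₁m : AEStronglyMeasurable N₁ volume :=
    (aestronglyMeasurable_indicator_iff measurableSet_Ici).2 hN
  have hN₁0 : ∀ t, 0 ≤ t → N₁ t = N t := fun t ht => indicator_of_mem (mem_Ici.2 ht) N
  have hN₁le : ∀ t, ‖N₁ t‖ ≤ C * (1 + |t|) ^ d := fun t => by
    rcases le_or_gt 0 t with ht | ht
    · rw [hN₁0 t ht, abs_of_nonneg ht]; exact hNle t ht
    · rw [hN₁, indicator_of_notMem (by simpa using ht), norm_zero]; positivity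
  have hEc : Continuous fun τ => expL L (-τ) := (continuous_expL L).comp continuous_neg
  -- Variation of constants: the solution will be `e^{tL} (x₀ + ∫₀ᵗ g)`.
  set g : ℝ → V := fun τ => expL L (-τ) (N₁ τ) with hg
  have hgm : AEStronglyMeasurable g volume :=
    ContinuousLinearMap.aestronglyMeasurable_comp₂ (ContinuousLinearMap.id ℂ (V →L[ℂ] V))
      hEc.aestronglyMeasurable hN₁m
  have hgle : ∀ τ, ‖g τ‖ ≤ ‖expL L (-τ)‖ * (C * (1 + |τ|) ^ d) := fun τ =>
    ((expL L (-τ)).le_opNorm _).trans (by gcongr; exact hN₁le τ)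
  have hbc : Continuous fun τ : ℝ => ‖expL L (-τ)‖ * (C * (1 + |τ|) ^ d) :=
    hEc.norm.mul (by fun_prop)
  have hgli : LocallyIntegrable g volume := by
    refine hbc.locallyIntegrable.mono hgm (ae_of_all _ fun τ => ?_)
    rw [Real.norm_of_nonneg (by positivity)]
    exact hgle τ
  have hPgli : LocallyIntegrable (fun τ => P (g τ)) volume := by
    refine ((continuous_const (y := ‖P‖)).mul hbc).locallyIntegrable.mono
      (P.continuous.comp_aestronglyMeasurable hgm) (ae_of_all _ fun τ => ?_)
    refine (P.le_opNorm (g τ)).trans ((mul_le_mul_of_nonneg_left (hgle τ) (norm_nonneg P)).trans ?_)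
    exact le_abs_self _
  set g' : ℝ → V := fun τ => g τ - P (g τ) with hg'
  have hg'm : AEStronglyMeasurable g' volume :=
    hgm.sub (P.continuous.comp_aestronglyMeasurable hgm)
  obtain ⟨c, C₁, hc, hC₁, hU⟩ := exists_norm_expL_neg_unstable_le L
  obtain ⟨C₂, hC₂, hpe⟩ := exists_pow_mul_exp_le (half_pos hc) d
  have hg't : ∀ t τ, 0 ≤ t → t ≤ τ → ‖expL L t (g' τ)‖ ≤
      C₁ * C₂ * C * (1 + t) ^ d * Real.exp (-(c / 2 * (τ - t))) := fun t τ ht htτ => by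
    have e1 : expL L t (g' τ) = expL L (-(τ - t)) (N₁ τ - P (N₁ τ)) := by
      have e2 : g' τ = expL L (-τ) (N₁ τ - P (N₁ τ)) := by
        rw [hg', hg]; simp only [hPE, map_sub]
      rw [e2, ← expL_add_apply]; congr 2; ring
    rw [e1]
    have h1 := hU (τ - t) (sub_nonneg.2 htτ) (N₁ τ)
    have h2 := hN₁le τ
    rw [abs_of_nonneg (ht.trans htτ)] at h2
    have h3 := hpe (τ - t) (sub_nonneg.2 htτ)
    -- `1 + τ ≤ (1 + t) (1 + (τ - t))`: the growth of `N` at time `τ` is charged partly to `t` and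
    -- partly to half of the exponential decay in `τ - t`.
    have h4 : (1 + τ) ^ d ≤ (1 + t) ^ d * (1 + (τ - t)) ^ d := by
      rw [← mul_pow]
      have : 0 ≤ 1 + τ := by linarith
      gcongr
      nlinarith
    have e5 : Real.exp (-(c * (τ - t))) =
        Real.exp (-(c / 2 * (τ - t))) * Real.exp (-(c / 2 * (τ - t))) := by
      rw [← Real.exp_add]; ring_nf
    calc _ ≤ _ := h1
      _ ≤ C₁ * Real.exp (-(c * (τ - t))) * (C * ((1 + t) ^ d * (1 + (τ - t)) ^ d)) := by
        gcongr
        exact h2.trans (by gcongr)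
      _ = C₁ * C * (1 + t) ^ d * Real.exp (-(c / 2 * (τ - t))) *
          ((1 + (τ - t)) ^ d * Real.exp (-(c / 2 * (τ - t)))) := by rw [e5]; ring
      _ ≤ C₁ * C * (1 + t) ^ d * Real.exp (-(c / 2 * (τ - t))) * C₂ := by gcongr
      _ = _ := by ring
  have hg'i : IntegrableOn g' (Ioi 0) := by
    refine (integrableOn_Ioi_exp (half_pos hc) (C₁ * C₂ * C) 0).mono' hg'm.restrict
      ((ae_restrict_iff' measurableSet_Ioi).2 (ae_of_all _ fun τ hτ => ?_))
    have := hg't 0 τ le_rfl (le_of_lt hτ)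
    rw [expL_zero] at this
    simpa using this
  -- The unstable part of the initial value is forced: with this choice the unstable part of `x₀ +
  -- ∫₀ᵗ g` becomes `-∫_t^∞ g'`, which `e^{tL}` does not blow up.
  set x₀ : V := Q - ∫ τ in Ioi 0, g' τ with hx₀
  have hsplit : ∀ t, 0 ≤ t → x₀ + ∫ τ in 0..t, g τ =
      Q + (∫ τ in 0..t, P (g τ)) - ∫ τ in Ioi t, g' τ := fun t ht => by
    have h1 := intervalIntegral.integral_Ioi_sub_Ioi hg'i ht
    have h2 : ∫ τ in 0..t, g' τ = (∫ τ in 0..t, g τ) - ∫ τ in 0..t, P (g τ) :=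
      intervalIntegral.integral_sub (intervalIntegrable_of_locallyIntegrable hgli _ _) (intervalIntegrable_of_locallyIntegrable hPgli _ _)
    rw [h2] at h1
    rw [sub_eq_iff_eq_add] at h1
    rw [hx₀, h1]
    abel
  refine ⟨fun t => expL L t (x₀ + ∫ τ in 0..t, g τ), ?_, ?_, ?_, ?_⟩
  · have h1 : P (∫ τ in Ioi 0, g' τ) = 0 := by
      rw [← P.integral_comp_comm hg'i]
      have : ∀ τ, P (g' τ) = 0 := fun τ =>
        spectralProjection_eq_zero (sub_spectralProjection_mem _ _ (g τ))
      simp [this]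
    simp only [intervalIntegral.integral_same, add_zero, expL_zero, hx₀]
    change P (Q - _) = Q
    rw [map_sub, h1, sub_zero]
    exact hQ
  · have hb3 : PolyB p (fun t => ‖∫ τ in Ioi t, expL L t (g' τ)‖) := by
      refine ⟨C₁ * C₂ * C / (c / 2), d, by positivity, hd, fun t ht => ?_⟩
      refine (norm_setIntegral_Ioi_le (half_pos hc)
        (fun τ hτ => hg't t τ ht hτ.le)).trans_eq ?_
      ring
    have hPg : ∀ t τ, 0 ≤ τ → expL L t (P (g τ)) = expL L (t - τ) (P (N τ)) := fun t τ hτ => by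
      have : P (g τ) = expL L (-τ) (P (N τ)) := by rw [hg]; simp only [hPE, hN₁0 τ hτ]
      rw [this, ← expL_add_apply]; rfl
    -- Stable contributions. Under `p` the semigroup decays exponentially and `N` is bounded, so the
    -- convolution is bounded; otherwise the integration raises the degree by one.
    have hb12 : PolyB p (fun t => ‖expL L t Q‖ + ‖∫ τ in 0..t, expL L t (P (g τ))‖) := by
      by_cases hpp : p
      · obtain ⟨c', C', hc', hC', h'⟩ := exists_norm_expL_stable_le_exp L (hp hpp)
        have hd0 := hd hpp
        subst hd0
        refine ⟨C' * ‖Q‖ + C' * C / c', 0, by positivity, fun _ => rfl, fun t ht => ?_⟩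
        rw [pow_zero, mul_one]
        refine add_le_add ?_ ?_
        · have := h' t ht Q
          rw [hQ] at this
          refine this.trans ?_
          have : Real.exp (-(c' * t)) ≤ 1 := Real.exp_le_one_iff.2 (by
            have := mul_nonneg hc'.le ht; linarith)
          have h0 : 0 ≤ C' * ‖Q‖ := by positivity
          nlinarith
        · refine norm_intervalIntegral_le_of_exp hc' ht (by positivity) fun τ hτ hτt => ?_
          rw [hPg t τ hτ.le]
          refine (h' (t - τ) (sub_nonneg.2 hτt) (N τ)).trans ?_
          have := hNle τ hτ.le
          rw [pow_zero, mul_one] at this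
          calc _ ≤ C' * Real.exp (-(c' * (t - τ))) * C := by gcongr
            _ = _ := by ring
      · obtain ⟨C', d', hC', h'⟩ := exists_norm_expL_stable_le L
        refine PolyB.add ⟨C' * ‖Q‖, d', by positivity, fun h => absurd h hpp, fun t ht => ?_⟩
          ⟨C' * C, d' + d + 1, by positivity, fun h => absurd h hpp, fun t ht => ?_⟩
        · have := h' t ht Q
          rw [hQ] at this
          linarith
        · have := intervalIntegral.norm_integral_le_of_norm_le_const (a := 0) (b := t)
            (f := fun τ => expL L t (P (g τ))) (C := C' * (1 + t) ^ d' * (C * (1 + t) ^ d))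
            (fun τ hτ => by
              rw [uIoc_of_le ht] at hτ
              rw [hPg t τ hτ.1.le]
              have h0 : 0 ≤ t - τ := sub_nonneg.2 hτ.2
              have h1 : 0 ≤ τ := hτ.1.le
              refine (h' (t - τ) h0 (N τ)).trans ?_
              gcongr
              · linarith
              · refine (hNle τ h1).trans ?_
                gcongr
                exact hτ.2)
          rw [sub_zero, abs_of_nonneg ht] at this
          refine this.trans ?_
          rw [pow_succ, pow_add]
          have h0 : 0 ≤ C' * (1 + t) ^ d' * (C * (1 + t) ^ d) := by positivity
          nlinarith
    refine (hb12.add hb3).mono fun t ht => ?_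
    have h1 : expL L t (∫ τ in 0..t, P (g τ)) = ∫ τ in 0..t, expL L t (P (g τ)) :=
      ((expL L t).intervalIntegral_comp_comm (intervalIntegrable_of_locallyIntegrable hPgli _ _)).symm
    have h2 : expL L t (∫ τ in Ioi t, g' τ) = ∫ τ in Ioi t, expL L t (g' τ) :=
      ((expL L t).integral_comp_comm (hg'i.mono_set (Ioi_subset_Ioi ht))).symm
    simp only
    rw [hsplit t ht, map_sub, map_add, h1, h2]
    exact (norm_sub_le _ _).trans (by gcongr; exact norm_add_le _ _)
  · intro T
    obtain ⟨M, hM⟩ := isCompact_Icc.exists_bound_of_continuousOn (s := Icc 0 T) hbc.continuousOn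
    exact LipOn.expL_apply L ((LipOn.const x₀ 0 T).add
      (lipOn_integral hgli (fun t ht => (hgle t).trans ((le_abs_self _).trans (hM t ht))) 0))
  · filter_upwards [LocallyIntegrable.ae_hasDerivAt_integral hgli] with t ht ht0
    have h1 := hasDerivAt_expL_apply L ((ht 0).const_add x₀)
    refine h1.congr_deriv ?_
    rw [hg]
    simp only
    rw [expL_apply_neg_apply, hN₁0 t ht0.le]

/-- A polynomially bounded solution of `D' = L D` vanishes if the stable part of its initial value
does. -/
theorem eq_zero_of_polyB_solution (L : V →L[ℂ] V) {D : ℝ → V} (hD : ∀ T, LipOn D 0 T)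
    (hD' : ∀ᵐ t, 0 < t → HasDerivAt D (L (D t)) t) (hb : PolyB False (fun t => ‖D t‖))
    (h0 : stableProj (L : V →ₗ[ℂ] V) (D 0) = 0) {t : ℝ} (ht : 0 ≤ t) : D t = 0 := by
  have hconst : ∀ t, 0 ≤ t → expL L (-t) (D t) = D 0 := fun t ht => by
    have h1 := norm_sub_le_of_ae_hasDerivAt (u := fun t => expL L (-t) (D t)) (u' := fun _ => 0)
      (B := fun _ => 0) (B' := fun _ => 0) ht
      ((LipOn.expL_neg_apply L (hD t)).absolutelyContinuous ht)
      ((LipOn.const (0 : ℝ) 0 t).absolutelyContinuous ht) (by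
        filter_upwards [hD'] with x hx hx0
        refine ⟨?_, hasDerivAt_const _ _, by simp⟩
        have := hasDerivAt_expL_neg_apply L (hx hx0.1)
        simpa using this)
    have h2 : expL L (-t) (D t) = expL L (-0) (D 0) := by
      rw [← sub_eq_zero, ← norm_le_zero_iff]; simpa using h1
    rw [h2, neg_zero, expL_zero]; rfl
  obtain ⟨c, C₁, hc, hC₁, hU⟩ := exists_norm_expL_neg_unstable_le L
  obtain ⟨C, d, hC, -, hDb⟩ := hb
  obtain ⟨C₂, hC₂, hpe⟩ := exists_pow_mul_exp_le (half_pos hc) d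
  have hP : ∀ t, 0 ≤ t → stableProj (L : V →ₗ[ℂ] V) (D t) = 0 := fun t ht => by
    have h1 : D t = expL L t (D 0) := by rw [← hconst t ht, expL_apply_neg_apply]
    rw [h1, stableProj_expL, h0, map_zero]
  -- `D 0 = e^{-tL} D t` with `D t` unstable and polynomially bounded, so the right-hand side tends
  -- to `0`.
  have hD0 : D 0 = 0 := by
    have hle : ∀ t, 0 ≤ t → ‖D 0‖ ≤ C₁ * C * C₂ * Real.exp (-(c / 2 * t)) := fun t ht => by
      have h1 := hU t ht (D t)
      rw [hP t ht, sub_zero, hconst t ht] at h1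
      have h2 := hDb t ht
      have h3 := hpe t ht
      have e5 : Real.exp (-(c * t)) = Real.exp (-(c / 2 * t)) * Real.exp (-(c / 2 * t)) := by
        rw [← Real.exp_add]; ring_nf
      calc _ ≤ _ := h1
        _ ≤ C₁ * Real.exp (-(c * t)) * (C * (1 + t) ^ d) := by gcongr
        _ = C₁ * C * Real.exp (-(c / 2 * t)) * ((1 + t) ^ d * Real.exp (-(c / 2 * t))) := by
          rw [e5]; ring
        _ ≤ C₁ * C * Real.exp (-(c / 2 * t)) * C₂ := by gcongr
        _ = _ := by ring
    have hlim : Tendsto (fun t : ℝ => C₁ * C * C₂ * Real.exp (-(c / 2 * t))) atTop (𝓝 0) := by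
      have : Tendsto (fun t : ℝ => Real.exp (-(c / 2 * t))) atTop (𝓝 0) :=
        Real.tendsto_exp_neg_atTop_nhds_zero.comp
          (tendsto_id.const_mul_atTop (half_pos hc))
      simpa using this.const_mul (C₁ * C * C₂)
    have := ge_of_tendsto hlim ((eventually_ge_atTop 0).mono hle)
    simpa using this
  rw [← expL_apply_neg_apply L t (D t), hconst t ht, hD0, map_zero]

end LinearODE

/-! ### The same results on spaces without a norm -/

section WeakODE

variable {V : Type*} [AddCommGroup V] [Module ℂ V] [FiniteDimensional ℂ V]

/-- A norm on a finite-dimensional complex vector space. -/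
abbrev coordNorm (V : Type*) [AddCommGroup V] [Module ℂ V] [FiniteDimensional ℂ V] :
    NormedAddCommGroup V :=
  NormedAddCommGroup.induced V (Fin (finrank ℂ V) → ℂ) (Module.finBasis ℂ V).equivFun
    (Module.finBasis ℂ V).equivFun.injective

/-- The spaces `HomPoly n k` come without a norm, so regularity, growth and the equation are tested
against linear functionals; inside the proof an auxiliary norm from coordinates is used. -/
theorem exists_weak_polyB_solution (L : End ℂ V) {p : Prop}
    (hp : p → ∀ μ, L.HasEigenvalue μ → μ.re ≠ 0) {N : ℝ → V}
    (hN : ∀ f : V →ₗ[ℂ] ℂ, AEMeasurable (fun t => f (N t)) (volume.restrict (Ici 0)))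
    (hNb : ∀ f : V →ₗ[ℂ] ℂ, PolyB p (fun t => ‖f (N t)‖))
    {Q : V} (hQ : stableProj L Q = Q) :
    ∃ F : ℝ → V, stableProj L (F 0) = Q ∧ ∀ f : V →ₗ[ℂ] ℂ, PolyB p (fun t => ‖f (F t)‖) ∧
      (∀ T, LipOn (fun t => f (F t)) 0 T) ∧
      ∀ᵐ t, 0 < t → HasDerivAt (fun t => f (F t)) (f (L (F t) + N t)) t := by
  let := coordNorm V
  let : NormedSpace ℂ V :=
    NormedSpace.induced ℂ V (Fin (finrank ℂ V) → ℂ) (Module.finBasis ℂ V).equivFun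
  set B := Module.finBasis ℂ V
  have hN' : AEStronglyMeasurable N (volume.restrict (Ici 0)) := by
    have : N = fun t => ∑ i, B.coord i (N t) • B i := funext fun t => (B.sum_repr (N t)).symm
    rw [this]
    refine Finset.aestronglyMeasurable_fun_sum _ fun i _ => ?_
    exact (hN (B.coord i)).aestronglyMeasurable.smul_const _
  have hNb' : PolyB p (fun t => ‖N t‖) := by
    refine (PolyB.sum Finset.univ
      (u := fun i t => ‖B i‖ * ‖B.coord i (N t)‖) fun i _ =>
        (hNb (B.coord i)).const_mul (norm_nonneg _)).mono fun t _ => ?_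
    conv_lhs => rw [← B.sum_repr (N t)]
    refine (norm_sum_le _ _).trans (Finset.sum_le_sum fun i _ => ?_)
    rw [norm_smul, mul_comm]; rfl
  obtain ⟨F, hF0, hFb, hFl, hFd⟩ :=
    exists_polyB_solution (LinearMap.toContinuousLinearMap L) hp hN' hNb' (Q := Q) hQ
  refine ⟨F, hF0, fun f => ?_⟩
  set f' : V →L[ℂ] ℂ := LinearMap.toContinuousLinearMap f
  refine ⟨(hFb.const_mul (norm_nonneg f')).mono fun t _ => f'.le_opNorm _, fun T => ?_, ?_⟩
  · obtain ⟨K, hK⟩ := hFl T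
    exact ⟨_, f'.lipschitz.comp_lipschitzOnWith hK⟩
  · filter_upwards [hFd] with t ht ht0
    exact (f'.restrictScalars ℝ).hasFDerivAt.comp_hasDerivAt t (ht ht0)

theorem eq_zero_of_weak_polyB_solution (L : End ℂ V) {D : ℝ → V}
    (hD : ∀ f : V →ₗ[ℂ] ℂ, ∀ T, LipOn (fun t => f (D t)) 0 T)
    (hD' : ∀ f : V →ₗ[ℂ] ℂ, ∀ᵐ t, 0 < t → HasDerivAt (fun t => f (D t)) (f (L (D t))) t)
    (hb : ∀ f : V →ₗ[ℂ] ℂ, PolyB False (fun t => ‖f (D t)‖))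
    (h0 : stableProj L (D 0) = 0) {t : ℝ} (ht : 0 ≤ t) : D t = 0 := by
  let := coordNorm V
  let : NormedSpace ℂ V :=
    NormedSpace.induced ℂ V (Fin (finrank ℂ V) → ℂ) (Module.finBasis ℂ V).equivFun
  set B := Module.finBasis ℂ V
  have hDe : D = fun t => ∑ i, B.coord i (D t) • B i := funext fun t => (B.sum_repr (D t)).symm
  refine eq_zero_of_polyB_solution (LinearMap.toContinuousLinearMap L) (fun T => ?_) ?_ ?_ h0 ht
  · rw [hDe]
    refine LipOn.sum _ fun i _ => ?_
    exact LipOn.bilinear ((ContinuousLinearMap.lsmul ℝ ℂ : ℂ →L[ℝ] V →L[ℝ] V)) (hD (B.coord i) T)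
      (LipOn.const (B i) 0 T)
  · have : ∀ᵐ t, ∀ i, 0 < t →
        HasDerivAt (fun t => B.coord i (D t)) (B.coord i (L (D t))) t :=
      ae_all_iff.2 fun i => hD' (B.coord i)
    filter_upwards [this] with t ht ht0
    have h1 : HasDerivAt (fun t => ∑ i, B.coord i (D t) • B i)
        (∑ i, B.coord i (L (D t)) • B i) t :=
      HasDerivAt.fun_sum fun i _ => (ht i ht0).smul_const (B i)
    rw [← hDe] at h1
    exact h1.congr_deriv (B.sum_repr (L (D t)))
  · refine (PolyB.sum Finset.univ
      (u := fun i t => ‖B i‖ * ‖B.coord i (D t)‖) fun i _ =>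
        (hb (B.coord i)).const_mul (norm_nonneg _)).mono fun t _ => ?_
    conv_lhs => rw [← B.sum_repr (D t)]
    refine (norm_sum_le _ _).trans (Finset.sum_le_sum fun i _ => ?_)
    rw [norm_smul, mul_comm]; rfl

end WeakODE

/-! ### The spectrum of `B_k` -/

section Eigenvalues

variable {n : ℕ}

theorem hasEigenvalue_of_mem_maxGenEigenspace {V : Type*} [AddCommGroup V] [Module ℂ V]
    {L : End ℂ V} {μ : ℂ} {x : V} (hx : x ∈ L.maxGenEigenspace μ) (hx0 : x ≠ 0) :
    L.HasEigenvalue μ := by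
  obtain ⟨k, hk⟩ := (End.mem_maxGenEigenspace _ _ _).1 hx
  refine End.hasEigenvalue_of_hasGenEigenvalue (k := k) fun hb => hx0 ?_
  have : x ∈ (L.genEigenspace μ) k := End.mem_genEigenspace_nat.2 hk
  rw [hb] at this
  simpa using this

instance (k : ℕ) :
    FiniteDimensional ℂ (ContinuousMultilinearMap ℂ (fun _ : Fin k => Cn n) (Cn n)) :=
  Module.Finite.of_injective
    ({ toFun := fun M => M.toMultilinearMap
       map_add' := fun _ _ => rfl
       map_smul' := fun _ _ => rfl } :
      ContinuousMultilinearMap ℂ (fun _ : Fin k => Cn n) (Cn n) →ₗ[ℂ]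
        MultilinearMap ℂ (fun _ : Fin k => Cn n) (Cn n))
    ContinuousMultilinearMap.toMultilinearMap_injective

/-- The operator on `k`-linear mappings that induces `opB A k` on the diagonal. -/
def multiB (A : Cn n →L[ℂ] Cn n) (k : ℕ) :
    End ℂ (ContinuousMultilinearMap ℂ (fun _ : Fin k => Cn n) (Cn n)) where
  toFun M := (∑ i, M.compContinuousLinearMap
    (Function.update (fun _ => ContinuousLinearMap.id ℂ (Cn n)) i A)) -
      A.compContinuousMultilinearMap M
  map_add' M N := by
    ext1 z
    simp [Finset.sum_add_distrib]
    abel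
  map_smul' c M := by
    ext1 z
    simp [Finset.smul_sum, smul_sub]

theorem multiB_apply (A : Cn n →L[ℂ] Cn n) {k : ℕ}
    (M : ContinuousMultilinearMap ℂ (fun _ : Fin k => Cn n) (Cn n)) (z : Fin k → Cn n) :
    multiB A k M z = (∑ i, M (Function.update z i (A (z i)))) - A (M z) := by
  simp only [multiB, LinearMap.coe_mk, AddHom.coe_mk, sub_apply, sum_apply,
    ContinuousMultilinearMap.compContinuousLinearMap_apply,
    ContinuousLinearMap.compContinuousMultilinearMap_coe, Function.comp_apply]
  congr 1
  refine Finset.sum_congr rfl fun i _ => congrArg M ?_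
  funext j
  by_cases hj : j = i
  · subst hj; simp
  · simp [hj]

theorem opB_rangeRestrict (A : Cn n →L[ℂ] Cn n) {k : ℕ}
    (M : ContinuousMultilinearMap ℂ (fun _ : Fin k => Cn n) (Cn n)) :
    opB A k ((diagonal n k).rangeRestrict M) = (diagonal n k).rangeRestrict (multiB A k M) := by
  ext1
  funext z
  change fderiv ℂ (diagonal n k M) z (A z) - A (diagonal n k M z) = multiB A k M (fun _ => z)
  rw [(hasFDerivAt_diagonal M z).fderiv, multiB_apply]
  simp [diagonal, ContinuousMultilinearMap.linearDeriv_apply]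

/-- `opB A k` is a quotient of `multiB A k`. In finite dimension, if `multiB A k - μ` were injective
it would be surjective, hence so would `opB A k - μ`, which would then be injective. -/
theorem hasEigenvalue_multiB {A : Cn n →L[ℂ] Cn n} {k : ℕ} {μ : ℂ}
    (h : End.HasEigenvalue (opB A k) μ) : (multiB A k).HasEigenvalue μ := by
  by_contra hne
  have hinj : Function.Injective (multiB A k - algebraMap ℂ
      (End ℂ (ContinuousMultilinearMap ℂ (fun _ : Fin k => Cn n) (Cn n))) μ) := by
    rw [← LinearMap.ker_eq_bot]
    rw [End.hasEigenvalue_iff, not_not, End.eigenspace_def] at hne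
    exact hne
  have hsurj := LinearMap.injective_iff_surjective.1 hinj
  have hsurj' : Function.Surjective (opB A k - algebraMap ℂ (End ℂ (HomPoly n k)) μ) := by
    rintro ⟨_, M, rfl⟩
    obtain ⟨M', rfl⟩ := hsurj M
    let q : HomPoly n k := (diagonal n k).rangeRestrict M'
    exact ⟨q, congrArg (fun x : HomPoly n k => x - μ • q) (opB_rangeRestrict A M')⟩
  have hinj' := LinearMap.injective_iff_surjective.2 hsurj'
  rw [End.hasEigenvalue_iff, End.eigenspace_def] at h
  exact h (LinearMap.ker_eq_bot.2 hinj')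

/-- For an eigenvector `M` one has `(A - ν) M(z) = ∑ M(…, (A - l_i) z_i, …)` with `ν = ∑ l_i - μ`.
Every summand has smaller total nilpotency order, so induction on that order applies. -/
theorem map_mem_maxGenEigenspace {A : Cn n →L[ℂ] Cn n} {k : ℕ} {μ : ℂ}
    {M : ContinuousMultilinearMap ℂ (fun _ : Fin k => Cn n) (Cn n)}
    (hM : multiB A k M = μ • M) (l : Fin k → ℂ) (N : ℕ) :
    ∀ (a : Fin k → ℕ), ∑ i, a i = N → ∀ z : Fin k → Cn n,
      (∀ i, (((A : End ℂ (Cn n)) - l i • (1 : End ℂ (Cn n))) ^ a i) (z i) = 0) →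
      M z ∈ End.maxGenEigenspace (A : End ℂ (Cn n)) (∑ i, l i - μ) := by
  induction N using Nat.strong_induction_on with
  | _ N ih =>
    intro a ha z hz
    set ν := ∑ i, l i - μ with hν
    have h1 : ∀ i, M (Function.update z i (A (z i) - l i • z i)) ∈
        End.maxGenEigenspace (A : End ℂ (Cn n)) ν := fun i => by
      rcases Nat.eq_zero_or_pos (a i) with hi | hi
      · have hzi : z i = 0 := by have := hz i; rw [hi] at this; simpa using this
        rw [M.map_coord_zero i (by simp [hzi])]
        exact zero_mem _
      · refine ih (∑ j, Function.update a i (a i - 1) j) ?_ (Function.update a i (a i - 1)) rfl _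
          fun j => ?_
        · rw [← ha]
          refine Finset.sum_lt_sum (fun j _ => ?_) ⟨i, Finset.mem_univ i, ?_⟩
          · by_cases hj : j = i
            · subst hj; simp
            · simp [hj]
          · simpa using hi
        · by_cases hj : j = i
          · subst hj
            rw [Function.update_self, Function.update_self]
            have := hz j
            rw [show a j = (a j - 1) + 1 by omega, pow_succ] at this
            exact this
          · rw [Function.update_of_ne hj, Function.update_of_ne hj]
            exact hz j
    have h2 : A (M z) - ν • M z = ∑ i, M (Function.update z i (A (z i) - l i • z i)) := by
      have h3 : multiB A k M z = μ • M z := by rw [hM]; rfl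
      rw [multiB_apply] at h3
      simp only [ContinuousMultilinearMap.map_update_sub,
        ContinuousMultilinearMap.map_update_smul, Function.update_eq_self,
        Finset.sum_sub_distrib, ← Finset.sum_smul]
      rw [hν, sub_smul, ← h3]
      abel
    have h4 : A (M z) - ν • M z ∈ End.maxGenEigenspace (A : End ℂ (Cn n)) ν := by
      rw [h2]; exact Submodule.sum_mem _ fun i _ => h1 i
    obtain ⟨m, hm⟩ := (End.mem_maxGenEigenspace _ _ _).1 h4
    refine (End.mem_maxGenEigenspace _ _ _).2 ⟨m + 1, ?_⟩
    rw [pow_succ]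
    exact hm

/-- Generalized eigenvectors of `A` contain a basis, and a nonzero multilinear map is nonzero on
some tuple of basis vectors. Its value there is a nonzero generalized eigenvector for `∑ l_i - μ`.
-/
theorem exists_eigenvalues_of_opB {A : Cn n →L[ℂ] Cn n} {k : ℕ} {μ : ℂ}
    (h : End.HasEigenvalue (opB A k) μ) :
    ∃ (l : Fin k → ℂ) (ν : ℂ), (∀ i, End.HasEigenvalue (A : End ℂ (Cn n)) (l i)) ∧
      End.HasEigenvalue (A : End ℂ (Cn n)) ν ∧ μ = ∑ i, l i - ν := by
  obtain ⟨M, hM, hM0⟩ := (hasEigenvalue_multiB h).exists_hasEigenvector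
  have hM' : multiB A k M = μ • M := End.mem_eigenspace_iff.1 hM
  set U : Set (Cn n) := ⋃ l : ℂ, (End.maxGenEigenspace (A : End ℂ (Cn n)) l : Set (Cn n))
  have hU : ⊤ ≤ Submodule.span ℂ U := by
    rw [Submodule.span_iUnion, ← End.iSup_maxGenEigenspace_eq_top (A : End ℂ (Cn n))]
    exact iSup_mono fun l => Submodule.subset_span
  set b := Basis.ofSpan hU
  have hz : ∃ v : Fin k → _, M (fun i => b (v i)) ≠ 0 := by
    by_contra! hv
    refine hM0 (ContinuousMultilinearMap.toMultilinearMap_injective ?_)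
    exact Basis.ext_multilinear (fun _ => b) fun v => hv v
  obtain ⟨v, hv⟩ := hz
  have hmem : ∀ i, ∃ l, b (v i) ∈ End.maxGenEigenspace (A : End ℂ (Cn n)) l := fun i => by
    have := Basis.ofSpan_subset hU (mem_range_self (v i))
    exact mem_iUnion.1 this
  choose l hl using hmem
  choose a ha using fun i => (End.mem_maxGenEigenspace _ _ _).1 (hl i)
  have := map_mem_maxGenEigenspace hM' l _ a rfl (fun i => b (v i)) ha
  refine ⟨l, ∑ i, l i - μ, fun i => ?_, hasEigenvalue_of_mem_maxGenEigenspace this hv, by ring⟩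
  exact hasEigenvalue_of_mem_maxGenEigenspace (hl i) (b.ne_zero _)

theorem lowerIndex_le_re {A : Cn n →L[ℂ] Cn n} {l : ℂ}
    (hl : End.HasEigenvalue (A : End ℂ (Cn n)) l) : lowerIndex A ≤ l.re := by
  obtain ⟨v, hv, hv0⟩ := hl.exists_hasEigenvector
  have hAv : A v = l • v := End.mem_eigenspace_iff.1 hv
  have h1 : ‖v‖ ≠ 0 := norm_ne_zero_iff.2 hv0
  have hu : ‖((‖v‖⁻¹ : ℝ) : ℂ) • v‖ = 1 := by
    rw [norm_smul]; simp [h1]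
  refine (lowerIndex_le hu).trans_eq ?_
  rw [map_smul, hAv, smul_comm, inner_smul_right, inner_self_eq_norm_sq_to_K, hu]
  simp

theorem hasEigenvalue_mem_spectrum {A : Cn n →L[ℂ] Cn n} {l : ℂ}
    (hl : End.HasEigenvalue (A : End ℂ (Cn n)) l) : l ∈ spectrum ℂ A := by
  obtain ⟨v, hv, hv0⟩ := hl.exists_hasEigenvector
  have hAv : A v = l • v := End.mem_eigenspace_iff.1 hv
  rw [spectrum.mem_iff]
  rintro ⟨u, hu⟩
  apply hv0
  have h1 : (u : Cn n →L[ℂ] Cn n) v = 0 := by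
    rw [hu, Algebra.algebraMap_eq_smul_one, sub_apply, smul_apply, hAv]
    exact sub_self _
  have h2 : ((↑u⁻¹ : Cn n →L[ℂ] Cn n) * u) v = v := by rw [Units.inv_mul]; rfl
  rw [← h2]
  change (↑u⁻¹ : Cn n →L[ℂ] Cn n) ((u : Cn n →L[ℂ] Cn n) v) = 0
  rw [h1, map_zero]

theorem re_le_upperIndex {A : Cn n →L[ℂ] Cn n} {l : ℂ}
    (hl : End.HasEigenvalue (A : End ℂ (Cn n)) l) : l.re ≤ upperIndex A :=
  le_csSup ((spectrum.isCompact A).image Complex.continuous_re).bddAbove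
    (mem_image_of_mem _ (hasEigenvalue_mem_spectrum hl))

theorem nontrivial_of_lowerIndex_pos {A : Cn n →L[ℂ] Cn n} (hA : 0 < lowerIndex A) :
    Nontrivial (Cn n) := by
  by_contra hn
  rw [not_nontrivial_iff_subsingleton] at hn
  have : lowerIndex A = 0 := by
    -- For `n = 0` the infimum runs over the empty set and takes the default value `0`, so the
    -- hypothesis excludes this case.
    have : (sphere (0 : Cn n) 1) = ∅ := sphere_eq_empty_of_subsingleton one_ne_zero
    rw [lowerIndex, this, image_empty, Real.sInf_empty]
  exact hA.ne' this

theorem lowerIndex_le_upperIndex {A : Cn n →L[ℂ] Cn n} (hA : 0 < lowerIndex A) :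
    lowerIndex A ≤ upperIndex A := by
  have := nontrivial_of_lowerIndex_pos hA
  obtain ⟨l, hl⟩ := End.exists_eigenvalue (A : End ℂ (Cn n))
  exact (lowerIndex_le_re hl).trans (re_le_upperIndex hl)

/-- Needed so that the truncation order `n₀ + 1` is at least `2` and the linear term is retained. -/
theorem one_le_nZero {A : Cn n →L[ℂ] Cn n} (hA : 0 < lowerIndex A) : 1 ≤ nZero A := by
  refine Nat.le_floor ?_
  rw [Nat.cast_one, one_le_div hA]
  exact lowerIndex_le_upperIndex hA

theorem upperIndex_lt {A : Cn n →L[ℂ] Cn n} (hA : 0 < lowerIndex A) {k : ℕ}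
    (hk : nZero A < k) : upperIndex A < k * lowerIndex A :=
  (div_lt_iff₀ hA).1 (Nat.lt_of_floor_lt hk)

/-- The real part is at least `k m(A) - k₊(A)`, which is positive beyond degree `n₀`; no free data
exist there. -/
theorem re_pos_of_hasEigenvalue_opB {A : Cn n →L[ℂ] Cn n} (hA : 0 < lowerIndex A) {k : ℕ}
    (hk : nZero A < k) {μ : ℂ} (h : End.HasEigenvalue (opB A k) μ) : 0 < μ.re := by
  obtain ⟨l, ν, hl, hν, rfl⟩ := exists_eigenvalues_of_opB h
  have h1 : (k : ℝ) * lowerIndex A ≤ ∑ i, (l i).re := by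
    have := Finset.card_nsmul_le_sum Finset.univ (fun i => (l i).re) (lowerIndex A)
      (fun i _ => lowerIndex_le_re (hl i))
    simpa using this
  have h2 := re_le_upperIndex hν
  have h3 := upperIndex_lt hA hk
  rw [Complex.sub_re, Complex.re_sum]
  linarith

theorem projLE_eq_zero {A : Cn n →L[ℂ] Cn n} (hA : 0 < lowerIndex A) {k : ℕ}
    (hk : nZero A < k) : projLE A k = 0 :=
  spectralProjection_eq_zero_of_forall fun _ hμ h =>
    absurd hμ (not_le.2 (re_pos_of_hasEigenvalue_opB hA hk h))

theorem re_ne_zero_of_conjSumNonresonant {A : Cn n →L[ℂ] Cn n} (hA : ConjSumNonresonant A) {k : ℕ}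
    (hk : 2 ≤ k) {μ : ℂ} (h : End.HasEigenvalue (opB A k) μ) : μ.re ≠ 0 := by
  classical
  obtain ⟨l, ν, hl, hν, rfl⟩ := exists_eigenvalues_of_opB h
  intro h0
  set l' : Fin k → End.Eigenvalues (A : End ℂ (Cn n)) := fun i => ⟨l i, hl i⟩
  -- A vanishing real part is a resonance whose multiplicities count how often each eigenvalue
  -- occurs among the `l i`.
  refine hA (fun x => (Finset.univ.filter fun i => l' i = x).card) ?_ ⟨ν, hν⟩ ?_
  · rw [← Finset.card_eq_sum_card_fiberwise (fun i _ => Finset.mem_univ _)]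
    simpa using hk
  · have h1 : ∀ x : End.Eigenvalues (A : End ℂ (Cn n)),
        ((Finset.univ.filter fun i => l' i = x).card : ℂ) *
          ((x : ℂ) + (starRingEnd ℂ) (x : ℂ)) =
        ∑ i with l' i = x, (l i + (starRingEnd ℂ) (l i)) := fun x => by
      rw [← nsmul_eq_mul, ← Finset.sum_const]
      refine Finset.sum_congr rfl fun i hi => ?_
      rw [← (Finset.mem_filter.1 hi).2]
      rfl
    simp only [h1]
    rw [Finset.sum_fiberwise]
    change _ = ν + (starRingEnd ℂ) ν
    simp only [Complex.add_conj]
    rw [Complex.sub_re, Complex.re_sum] at h0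
    rw [← Complex.ofReal_sum]
    congr 1
    rw [← Finset.mul_sum]
    linarith

theorem expOp_eq_expL (A : Cn n →L[ℂ] Cn n) (t : ℝ) : expOp A t = expL A t := rfl

theorem exists_norm_expOp_le (A : Cn n →L[ℂ] Cn n) :
    ∃ (C : ℝ) (d : ℕ), 0 ≤ C ∧ ∀ t : ℝ, 0 ≤ t → ∀ v,
      ‖expOp A t v‖ ≤ C * (1 + t) ^ d * Real.exp (upperIndex A * t) * ‖v‖ := by
  obtain ⟨C, d, hC, h⟩ := exists_norm_expL_comp_le A (S := univ) (T := Ici 0)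
    (b := fun t => upperIndex A * t) (fun μ _ hμ t ht => by
      rw [mul_comm]
      exact mul_le_mul_of_nonneg_right (re_le_upperIndex hμ) ht) LinearMap.id (fun v => by
        rw [spectralSubspace]
        simp [End.iSup_maxGenEigenspace_eq_top])
  refine ⟨C, d, hC, fun t ht v => ?_⟩
  have := h t ht v
  rwa [abs_of_nonneg ht] at this

end Eigenvalues

/-! ### Homogeneous terms of `Dg v` -/

section TaylorTransport

variable {n : ℕ}

theorem exists_bound_of_differentiableOn {g : Cn n → Cn n}
    (hg : DifferentiableOn ℂ g (unitBall n)) {r : ℝ} (hr : r < 1) :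
    ∃ M, 0 ≤ M ∧ ∀ z, ‖z‖ ≤ r → ‖g z‖ ≤ M := by
  obtain ⟨M, hM⟩ := (isCompact_closedBall (0 : Cn n) r).exists_bound_of_continuousOn
    (hg.continuousOn.mono (closedBall_subset_ball hr))
  exact ⟨|M|, abs_nonneg M, fun z hz =>
    (hM z (mem_closedBall_zero_iff.2 hz)).trans (le_abs_self M)⟩

theorem differentiableOn_fderiv_apply {g v : Cn n → Cn n}
    (hg : DifferentiableOn ℂ g (unitBall n)) (hv : DifferentiableOn ℂ v (unitBall n)) :
    DifferentiableOn ℂ (fun z => fderiv ℂ g z (v z)) (unitBall n) :=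
  (differentiableOn_fderiv isOpen_unitBall hg).clm_apply hv

/-- Cauchy's estimate on the ball of radius `‖z‖` around `z`. The extra factor `‖z‖` on the left
avoids the exponent `N - 1`. -/
theorem norm_fderiv_mul_norm_le {g : Cn n → Cn n} (hg : DifferentiableOn ℂ g (unitBall n))
    {r C : ℝ} (hr1 : r ≤ 1) {N : ℕ} (hC : ∀ z, ‖z‖ < r → ‖g z‖ ≤ C * ‖z‖ ^ N)
    {z : Cn n} (hz : ‖z‖ < r / 2) : ‖fderiv ℂ g z‖ * ‖z‖ ≤ 2 * |C| * 2 ^ N * ‖z‖ ^ N := by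
  rcases eq_or_ne z 0 with rfl | hz0
  · simp only [norm_zero, mul_zero]; positivity
  have hz' := norm_pos_iff.2 hz0
  have hsub : ∀ w ∈ ball z ‖z‖, ‖w‖ < 2 * ‖z‖ := fun w hw => by
    rw [mem_ball, dist_eq_norm] at hw
    have := norm_le_norm_add_norm_sub' w z
    linarith
  have := norm_fderiv_le_of_bounded hz' (hg.mono fun w hw => mem_unitBall.2 (by
    linarith [hsub w hw])) (M := |C| * (2 * ‖z‖) ^ N) (fun w hw => by
      have h1 := hsub w hw
      refine (hC w (by linarith)).trans ?_
      have := le_abs_self C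
      gcongr)
  rw [le_div_iff₀ hz'] at this
  refine this.trans_eq ?_
  rw [mul_pow]; ring

/-- Counting orders: `Dg` loses one order and `v` brings `m + 1`, so the product is `O(‖z‖^(N +
m))`. -/
theorem taylorTerm_fderiv_apply_eq_zero {g v : Cn n → Cn n}
    (hg : DifferentiableOn ℂ g (unitBall n)) (hv : DifferentiableOn ℂ v (unitBall n))
    {r C C' : ℝ} (hr : 0 < r) (hr1 : r ≤ 1) {N m k : ℕ}
    (hC : ∀ z, ‖z‖ < r → ‖g z‖ ≤ C * ‖z‖ ^ N)
    (hC' : ∀ z, ‖z‖ < r → ‖v z‖ ≤ C' * ‖z‖ ^ (m + 1)) (hk : k < N + m) :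
    taylorTerm (fun z => fderiv ℂ g z (v z)) k = 0 := by
  refine taylorTerm_eq_zero_of_norm_le (differentiableOn_fderiv_apply hg hv) (half_pos hr)
    (C := 2 * |C| * 2 ^ N * |C'|) (fun z hz => ?_) hk
  have h1 := norm_fderiv_mul_norm_le hg hr1 hC hz
  have h2 := hC' z (by linarith)
  have h3 := le_abs_self C'
  calc _ ≤ ‖fderiv ℂ g z‖ * ‖v z‖ := ContinuousLinearMap.le_opNorm _ _
    _ ≤ ‖fderiv ℂ g z‖ * (|C'| * ‖z‖ ^ (m + 1)) := by
      gcongr; exact h2.trans (by gcongr)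
    _ = ‖fderiv ℂ g z‖ * ‖z‖ * (|C'| * ‖z‖ ^ m) := by ring
    _ ≤ 2 * |C| * 2 ^ N * ‖z‖ ^ N * (|C'| * ‖z‖ ^ m) := by gcongr
    _ = _ := by ring

/-- The contribution of the terms of degree `< k` of `q` to the term of degree `k` of `Dq v`. -/
def lowerTerm (q : (j : ℕ) → HomPoly n j) (v : Cn n → Cn n) (k : ℕ) : HomPoly n k :=
  taylorTerm (fun z => fderiv ℂ (fun w => ∑ j ∈ Finset.range k, (q j : Cn n → Cn n) w) z (v z)) k

theorem lowerTerm_congr {q q' : (j : ℕ) → HomPoly n j} {k : ℕ} (h : ∀ j < k, q j = q' j)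
    (v : Cn n → Cn n) : lowerTerm q v k = lowerTerm q' v k := by
  have : (fun w => ∑ j ∈ Finset.range k, (q j : Cn n → Cn n) w) =
      fun w => ∑ j ∈ Finset.range k, (q' j : Cn n → Cn n) w :=
    funext fun w => Finset.sum_congr rfl fun j hj => by rw [h j (Finset.mem_range.1 hj)]
  rw [lowerTerm, lowerTerm, this]

/-- The homogeneous terms of `Dg v`, when `v(z) = A z + O(‖z‖²)`. -/
theorem taylorTerm_fderiv_apply {A : Cn n →L[ℂ] Cn n} {g v : Cn n → Cn n}
    (hg : DifferentiableOn ℂ g (unitBall n)) (hv : DifferentiableOn ℂ v (unitBall n))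
    (hv0 : v 0 = 0) (hvA : fderiv ℂ v 0 = A) (k : ℕ) (z : Cn n) :
    (taylorTerm (fun z => fderiv ℂ g z (v z)) k : Cn n → Cn n) z =
      A ((taylorTerm g k : Cn n → Cn n) z) + (opB A k (taylorTerm g k) : Cn n → Cn n) z +
        (lowerTerm (taylorTerm g) v k : Cn n → Cn n) z := by
  set S : Cn n → Cn n := fun w => ∑ j ∈ Finset.range k, (taylorTerm g j : Cn n → Cn n) w with hS
  set c := taylorTerm g k with hc
  have hSd : Differentiable ℂ S :=
    Differentiable.fun_sum fun j _ => differentiable_homPoly _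
  have hcd : Differentiable ℂ (c : Cn n → Cn n) := differentiable_homPoly c
  -- Split `g = S + c + ρ` by degree and `v = A + (v - A)`. In degree `k`, `S` contributes
  -- `lowerTerm`, and `Dc A` is `A c + B_k c`; `Dc (v - A)` and `Dρ v` have higher order.
  set ρ : Cn n → Cn n := fun w => g w - (S w + (c : Cn n → Cn n) w) with hρ
  have hρd : DifferentiableOn ℂ ρ (unitBall n) :=
    hg.sub (hSd.add hcd).differentiableOn
  obtain ⟨M, hM0, hM⟩ := exists_bound_of_differentiableOn hg (r := 1 / 2) (by norm_num)
  obtain ⟨M', hM'0, hM'⟩ := exists_bound_of_differentiableOn hv (r := 1 / 2) (by norm_num)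
  have hρle : ∀ w, ‖w‖ < 1 / 2 → ‖ρ w‖ ≤ (M + (k + 1 : ℕ) * M) * 2 ^ (k + 1) * ‖w‖ ^ (k + 1) :=
    fun w hw => by
      have := norm_sub_sum_taylorTerm_le hg (by norm_num) (by norm_num) hM (k + 1) hw
      rw [Finset.sum_range_succ] at this
      refine this.trans_eq ?_
      rw [show ‖w‖ / (1 / 2) = 2 * ‖w‖ by ring, mul_pow]; ring
  have hvle : ∀ w, ‖w‖ < 1 / 2 → ‖v w - A w‖ ≤ 4 * M' * 2 ^ 2 * ‖w‖ ^ (1 + 1) := fun w hw => by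
    have := norm_sub_sub_fderiv_le (f := v) (c := 0) (r := 1 / 2) (M := M') (by norm_num)
      (hv.mono fun x hx => mem_unitBall.2 (by
        rw [mem_ball_zero_iff] at hx; linarith))
      (fun x hx => hM' x (mem_ball_zero_iff.1 hx).le) (mem_ball_zero_iff.2 hw)
    rw [hv0, hvA, sub_zero, sub_zero] at this
    refine this.trans_eq ?_
    rw [div_pow]; field_simp
  have hvle' : ∀ w, ‖w‖ < 1 / 2 → ‖v w‖ ≤ (4 * M' * 2 ^ 2 + ‖A‖) * ‖w‖ ^ (0 + 1) := fun w hw => by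
    have h1 := hvle w hw
    have h2 := A.le_opNorm w
    have h3 := norm_le_norm_add_norm_sub' (v w) (A w)
    have h4 : ‖w‖ ^ (1 + 1) ≤ ‖w‖ ^ (0 + 1) :=
      pow_le_pow_of_le_one (norm_nonneg _) (by linarith) (by norm_num)
    have h5 : 0 ≤ 4 * M' * 2 ^ 2 := by positivity
    calc ‖v w‖ ≤ ‖A‖ * ‖w‖ + 4 * M' * 2 ^ 2 * ‖w‖ ^ (1 + 1) := by linarith
      _ ≤ ‖A‖ * ‖w‖ + 4 * M' * 2 ^ 2 * ‖w‖ ^ (0 + 1) := by gcongr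
      _ = _ := by ring
  obtain ⟨Cc, hCc0, hCc⟩ := norm_homPoly_le c
  have h1 : taylorTerm (fun z => fderiv ℂ ρ z (v z)) k = 0 :=
    taylorTerm_fderiv_apply_eq_zero hρd hv (r := 1 / 2) (by norm_num) (by norm_num) hρle hvle'
      (by omega)
  have hvA' : DifferentiableOn ℂ (fun w => v w - A w) (unitBall n) :=
    hv.sub A.differentiable.differentiableOn
  have h2 : taylorTerm (fun z => fderiv ℂ (c : Cn n → Cn n) z (v z - A z)) k = 0 :=
    taylorTerm_fderiv_apply_eq_zero hcd.differentiableOn hvA' (r := 1 / 2) (by norm_num)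
      (by norm_num) (fun w _ => hCc w) hvle (by omega)
  have h3 : taylorTerm (fun z => fderiv ℂ g z (v z)) k =
      taylorTerm (fun z => (A ((c : Cn n → Cn n) z) + (opB A k c : Cn n → Cn n) z +
        fderiv ℂ S z (v z)) + (fderiv ℂ (c : Cn n → Cn n) z (v z - A z) +
          fderiv ℂ ρ z (v z))) k := by
    refine taylorTerm_congr ?_ k
    filter_upwards [unitBall_mem_nhds] with w hw
    have e1 : fderiv ℂ ρ w = fderiv ℂ g w - (fderiv ℂ S w + fderiv ℂ (c : Cn n → Cn n) w) := by
      have hgw : DifferentiableAt ℂ g w := hg.differentiableAt (isOpen_unitBall.mem_nhds hw)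
      exact ((hgw.hasFDerivAt).sub ((hSd w).hasFDerivAt.add (hcd w).hasFDerivAt)).fderiv
    have e2 : (opB A k c : Cn n → Cn n) w =
      fderiv ℂ (c : Cn n → Cn n) w (A w) - A ((c : Cn n → Cn n) w) := rfl
    rw [e1, e2, map_sub]
    simp only [sub_apply, add_apply]
    abel
  have dA : DifferentiableOn ℂ (fun z => A ((c : Cn n → Cn n) z)) (unitBall n) :=
    (A.differentiable.comp hcd).differentiableOn
  have dB : DifferentiableOn ℂ (opB A k c : Cn n → Cn n) (unitBall n) :=
    (differentiable_homPoly _).differentiableOn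
  have dS := differentiableOn_fderiv_apply hSd.differentiableOn hv
  have dc := differentiableOn_fderiv_apply hcd.differentiableOn hvA'
  have dρ := differentiableOn_fderiv_apply hρd hv
  rw [h3, taylorTerm_add ((dA.fun_add dB).fun_add dS) (dc.fun_add dρ), taylorTerm_add dc dρ, h1, h2,
    taylorTerm_add (dA.fun_add dB) dS, taylorTerm_add dA dB, taylorTerm_homPoly_self]
  simp only [add_zero, Submodule.coe_add, Pi.add_apply]
  rw [taylorTerm_clm hcd.differentiableOn, taylorTerm_homPoly_self]
  rfl

theorem taylorTerm_sum_homPoly (q : (j : ℕ) → HomPoly n j) {k N : ℕ} (hk : k < N) :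
    taylorTerm (fun w => ∑ j ∈ Finset.range N, (q j : Cn n → Cn n) w) k = q k := by
  rw [taylorTerm_sum _ fun j _ => (differentiable_homPoly (q j)).differentiableOn,
    Finset.sum_eq_single k (fun j _ hj => taylorTerm_homPoly_of_ne (q j) hj.symm)
      (fun h => absurd (Finset.mem_range.2 hk) h), taylorTerm_homPoly_self]

end TaylorTransport

/-! ### Functionals on `𝒫ᵏ` and measurability of the terms -/

section Functionals

variable {n : ℕ}

/-- Every functional on `𝒫ᵏ(ℂⁿ)` is a combination of evaluations of coordinates. -/
theorem exists_eval_repr {k : ℕ} (f : HomPoly n k →ₗ[ℂ] ℂ) :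
    ∃ (s : Finset (Cn n × Fin n)) (c : Cn n × Fin n → ℂ),
      ∀ Q : HomPoly n k, f Q = ∑ x ∈ s, c x * (Q : Cn n → Cn n) x.1 x.2 := by
  set e : Cn n × Fin n → Dual ℂ (HomPoly n k) := fun x =>
    { toFun := fun Q => (Q : Cn n → Cn n) x.1 x.2
      map_add' := fun _ _ => rfl
      map_smul' := fun _ _ => rfl } with he
  -- Evaluations separate points, and in finite dimension a separating family of functionals spans
  -- the dual.
  have hspan : Submodule.span ℂ (range e) = ⊤ := by
    rw [← Subspace.dualCoannihilator_dualAnnihilator_eq (W := Submodule.span ℂ (range e))]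
    have : (Submodule.span ℂ (range e)).dualCoannihilator = ⊥ := by
      refine (Submodule.eq_bot_iff _).2 fun Q hQ => ?_
      rw [Submodule.mem_dualCoannihilator] at hQ
      ext1
      funext z
      ext i
      exact hQ (e (z, i)) (Submodule.subset_span ⟨(z, i), rfl⟩)
    rw [this, Submodule.dualAnnihilator_bot]
  have hf : f ∈ Submodule.span ℂ (range e) := by rw [hspan]; trivial
  obtain ⟨c, hc⟩ := (Finsupp.mem_span_range_iff_exists_finsupp).1 hf
  refine ⟨c.support, c, fun Q => ?_⟩
  rw [← hc, Finsupp.sum, LinearMap.sum_apply]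
  rfl

/-- The homogeneous term of a family of holomorphic mappings depends measurably on the parameter if
the family does. -/
theorem aemeasurable_taylorTerm {μ : Measure ℝ} {g : ℝ → Cn n → Cn n}
    (hg : ∀ᵐ t ∂μ, DifferentiableOn ℂ (g t) (unitBall n))
    (hm : ∀ z ∈ unitBall n, AEMeasurable (fun t => g t z) μ) (k : ℕ) (z : Cn n) :
    AEMeasurable (fun t => (taylorTerm (g t) k : Cn n → Cn n) z) μ := by
  induction k using Nat.strong_induction_on with
  | _ k ih =>
    -- Scales tending to `0` that keep `δ z` in the ball of radius `1 / 2`. The term of degree `k`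
    -- is the limit of `(g(δ z) - lower terms) / δ^k`, measurable by induction.
    set δ : ℕ → ℝ := fun m => 1 / ((1 + ‖z‖) * 3) / ((m : ℝ) + 1) with hδ
    have hδ0 : ∀ m, 0 < δ m := fun m => by positivity
    have hδz : ∀ m, δ m * ‖z‖ < 1 / 2 := fun m => by
      have h1 : δ m ≤ 1 / ((1 + ‖z‖) * 3) :=
        div_le_self (by positivity) (by linarith [Nat.cast_nonneg (α := ℝ) m])
      have h2 : 1 / ((1 + ‖z‖) * 3) * ‖z‖ < 1 / 2 := by
        rw [div_mul_eq_mul_div, div_lt_div_iff₀ (by positivity) (by norm_num)]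
        linarith [norm_nonneg z]
      exact (mul_le_mul_of_nonneg_right h1 (norm_nonneg z)).trans_lt h2
    have hδnorm : ∀ m, ‖((δ m : ℝ) : ℂ) • z‖ = δ m * ‖z‖ := fun m => by
      rw [norm_smul, Complex.norm_real, Real.norm_of_nonneg (hδ0 m).le]
    have hδlim : Tendsto δ atTop (𝓝 0) := by
      have := (tendsto_one_div_add_atTop_nhds_zero_nat (𝕜 := ℝ)).const_mul
        (1 / ((1 + ‖z‖) * 3))
      simpa [hδ, div_eq_mul_inv] using this
    refine aemeasurable_of_tendsto_metrizable_ae atTop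
      (f := fun m t => (((δ m : ℝ) : ℂ) ^ k)⁻¹ • (g t (((δ m : ℝ) : ℂ) • z) -
        ∑ j ∈ Finset.range k, ((δ m : ℝ) : ℂ) ^ j • (taylorTerm (g t) j : Cn n → Cn n) z))
      (fun m => ?_) ?_
    · refine ((hm _ (mem_unitBall.2 ?_)).sub (Finset.aemeasurable_fun_sum _ fun j hj =>
        (ih j (Finset.mem_range.1 hj)).const_smul (((δ m : ℝ) : ℂ) ^ j))).const_smul
          (((δ m : ℝ) : ℂ) ^ k)⁻¹
      rw [hδnorm]; linarith [hδz m]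
    · filter_upwards [hg] with t ht
      obtain ⟨M, hM0, hM⟩ := exists_bound_of_differentiableOn ht (r := 1 / 2) (by norm_num)
      rw [tendsto_iff_norm_sub_tendsto_zero]
      have hle : ∀ m, ‖(((δ m : ℝ) : ℂ) ^ k)⁻¹ • (g t (((δ m : ℝ) : ℂ) • z) -
          ∑ j ∈ Finset.range k, ((δ m : ℝ) : ℂ) ^ j • (taylorTerm (g t) j : Cn n → Cn n) z) -
          (taylorTerm (g t) k : Cn n → Cn n) z‖ ≤
          (M + (k + 1 : ℕ) * M) * (2 * ‖z‖) ^ (k + 1) * δ m := fun m => by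
        have h1 := norm_sub_sum_taylorTerm_le ht (by norm_num) (by norm_num) hM (k + 1)
          (z := ((δ m : ℝ) : ℂ) • z) (by rw [hδnorm]; exact hδz m)
        rw [Finset.sum_range_succ] at h1
        simp only [homPoly_smul] at h1
        have hne : ((δ m : ℝ) : ℂ) ^ k ≠ 0 := pow_ne_zero _ (by exact_mod_cast (hδ0 m).ne')
        have e1 : (((δ m : ℝ) : ℂ) ^ k)⁻¹ • (g t (((δ m : ℝ) : ℂ) • z) -
          ∑ j ∈ Finset.range k, ((δ m : ℝ) : ℂ) ^ j • (taylorTerm (g t) j : Cn n → Cn n) z) -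
          (taylorTerm (g t) k : Cn n → Cn n) z = (((δ m : ℝ) : ℂ) ^ k)⁻¹ •
          (g t (((δ m : ℝ) : ℂ) • z) - (∑ j ∈ Finset.range k,
            ((δ m : ℝ) : ℂ) ^ j • (taylorTerm (g t) j : Cn n → Cn n) z +
            ((δ m : ℝ) : ℂ) ^ k • (taylorTerm (g t) k : Cn n → Cn n) z)) := by
          rw [← sub_sub, smul_sub _ (_ - _), smul_smul, inv_mul_cancel₀ hne, one_smul]
        rw [e1, norm_smul, norm_inv, norm_pow, Complex.norm_real,
          Real.norm_of_nonneg (hδ0 m).le]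
        rw [hδnorm] at h1
        have h0 := hδ0 m
        calc _ ≤ (δ m ^ k)⁻¹ * ((M + (k + 1 : ℕ) * M) * (δ m * ‖z‖ / (1 / 2)) ^ (k + 1)) := by
              gcongr
          _ = _ := by
            have : δ m * ‖z‖ / (1 / 2) = δ m * (2 * ‖z‖) := by ring
            rw [this, mul_pow, pow_succ (δ m)]
            field_simp
      refine squeeze_zero (fun m => norm_nonneg _) hle ?_
      simpa using hδlim.const_mul ((M + (k + 1 : ℕ) * M) * (2 * ‖z‖) ^ (k + 1))

end Functionals

/-! ### The triangular system for the coefficients -/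

section Coefficients

variable {n : ℕ} {A : Cn n →L[ℂ] Cn n} {h : Cn n → ℝ → Cn n} {p : Prop}

/-- The identity as a homogeneous polynomial mapping. -/
def idPoly (n : ℕ) : HomPoly n 1 :=
  ⟨fun z => z, ContinuousMultilinearMap.ofSubsingleton ℂ (Cn n) (Cn n) (0 : Fin 1)
    (ContinuousLinearMap.id ℂ (Cn n)), rfl⟩

theorem idPoly_apply (z : Cn n) : (idPoly n : Cn n → Cn n) z = z := rfl

theorem opB_idPoly : opB A 1 (idPoly n) = 0 := by
  ext1
  funext z
  change fderiv ℂ (fun z : Cn n => z) z (A z) - A z = 0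
  rw [fderiv_fun_id]
  exact sub_self _

theorem lowerTerm_eq_zero {q : (j : ℕ) → HomPoly n j} {k : ℕ} (h : ∀ j < k, q j = 0)
    (v : Cn n → Cn n) : lowerTerm q v k = 0 := by
  have h1 : (fun w => ∑ j ∈ Finset.range k, (q j : Cn n → Cn n) w) = fun _ => 0 :=
    funext fun w => Finset.sum_eq_zero fun j hj => by rw [h j (Finset.mem_range.1 hj)]; rfl
  rw [lowerTerm, h1]
  have := taylorTerm_sum (n := n) (∅ : Finset ℕ) (g := fun _ _ => 0) (by simp) k
  simpa using this

/-- The coordinates of `𝒫ᵏ(ℂⁿ)` in a basis. -/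
theorem coe_eq_sum_coord {k : ℕ} (Q : HomPoly n k) (z : Cn n) :
    (Q : Cn n → Cn n) z = ∑ i, (finBasis ℂ (HomPoly n k)).coord i Q •
      (finBasis ℂ (HomPoly n k) i : Cn n → Cn n) z := by
  have := congrArg (fun R : HomPoly n k => (R : Cn n → Cn n) z)
    ((finBasis ℂ (HomPoly n k)).sum_repr Q)
  simp only [Submodule.coe_sum, Finset.sum_apply] at this
  exact this.symm

theorem fderiv_eq_sum_coord {k : ℕ} (Q : HomPoly n k) (z : Cn n) :
    fderiv ℂ (Q : Cn n → Cn n) z = ∑ i, (finBasis ℂ (HomPoly n k)).coord i Q •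
      fderiv ℂ (finBasis ℂ (HomPoly n k) i : Cn n → Cn n) z := by
  have : (Q : Cn n → Cn n) = fun z => ∑ i, (finBasis ℂ (HomPoly n k)).coord i Q •
      (finBasis ℂ (HomPoly n k) i : Cn n → Cn n) z := funext fun z => coe_eq_sum_coord Q z
  conv_lhs => rw [this]
  exact (HasFDerivAt.fun_sum fun i _ => ((differentiable_homPoly (finBasis ℂ (HomPoly n k) i)
    z).hasFDerivAt.const_smul ((finBasis ℂ (HomPoly n k)).coord i Q))).fderiv

theorem continuous_fderiv_homPoly {k : ℕ} (Q : HomPoly n k) :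
    Continuous (fderiv ℂ (Q : Cn n → Cn n)) := by
  have := (differentiableOn_fderiv isOpen_univ (differentiable_homPoly Q).differentiableOn)
  exact continuousOn_univ.1 this.continuousOn

/-- Expansion in a basis turns bounds on functionals into bounds for the map and its derivative on
the closed unit ball. -/
theorem exists_polyB_bound {k : ℕ} {F : ℝ → HomPoly n k}
    (hF : ∀ f : HomPoly n k →ₗ[ℂ] ℂ, PolyB p (fun t => ‖f (F t)‖)) :
    ∃ u : ℝ → ℝ, PolyB p u ∧ (∀ t, 0 ≤ u t) ∧ ∀ t z, ‖z‖ ≤ 1 →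
      ‖(F t : Cn n → Cn n) z‖ ≤ u t ∧ ‖fderiv ℂ (F t : Cn n → Cn n) z‖ ≤ u t := by
  set B := finBasis ℂ (HomPoly n k)
  have h1 : ∀ i, ∃ c, 0 ≤ c ∧ ∀ z, ‖z‖ ≤ 1 → ‖(B i : Cn n → Cn n) z‖ ≤ c ∧
      ‖fderiv ℂ (B i : Cn n → Cn n) z‖ ≤ c := fun i => by
    obtain ⟨c₁, hc₁⟩ := (isCompact_closedBall (0 : Cn n) 1).exists_bound_of_continuousOn
      (differentiable_homPoly (B i)).continuous.continuousOn
    obtain ⟨c₂, hc₂⟩ := (isCompact_closedBall (0 : Cn n) 1).exists_bound_of_continuousOn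
      (continuous_fderiv_homPoly (B i)).continuousOn
    refine ⟨|c₁| + |c₂|, by positivity, fun z hz => ⟨?_, ?_⟩⟩
    · refine (hc₁ z (mem_closedBall_zero_iff.2 hz)).trans ?_
      linarith [le_abs_self c₁, abs_nonneg c₂]
    · refine (hc₂ z (mem_closedBall_zero_iff.2 hz)).trans ?_
      linarith [le_abs_self c₂, abs_nonneg c₁]
  choose c hc hcB using h1
  refine ⟨fun t => ∑ i, c i * ‖B.coord i (F t)‖,
    PolyB.sum _ fun i _ => (hF (B.coord i)).const_mul (hc i),
    fun t => Finset.sum_nonneg fun i _ => mul_nonneg (hc i) (norm_nonneg _), fun t z hz => ⟨?_, ?_⟩⟩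
  · rw [coe_eq_sum_coord]
    refine (norm_sum_le _ _).trans (Finset.sum_le_sum fun i _ => ?_)
    rw [norm_smul, mul_comm]
    exact mul_le_mul_of_nonneg_right (hcB i z hz).1 (norm_nonneg _)
  · rw [fderiv_eq_sum_coord]
    refine (norm_sum_le _ _).trans (Finset.sum_le_sum fun i _ => ?_)
    rw [norm_smul, mul_comm]
    exact mul_le_mul_of_nonneg_right (hcB i z hz).2 (norm_nonneg _)

theorem polyB_functional {k : ℕ} {F : ℝ → HomPoly n k}
    (hF : ∀ z, PolyB p (fun t => ‖(F t : Cn n → Cn n) z‖)) (f : HomPoly n k →ₗ[ℂ] ℂ) :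
    PolyB p (fun t => ‖f (F t)‖) := by
  obtain ⟨s, c, hf⟩ := exists_eval_repr f
  refine (PolyB.sum s (u := fun x t => ‖c x‖ * ‖(F t : Cn n → Cn n) x.1‖) fun x _ =>
    (hF x.1).const_mul (norm_nonneg _)).mono fun t _ => ?_
  rw [hf]
  refine (norm_sum_le _ _).trans (Finset.sum_le_sum fun x _ => ?_)
  rw [norm_mul]
  exact mul_le_mul_of_nonneg_left (PiLp.norm_apply_le _ _) (norm_nonneg _)

theorem continuousOn_Ici_of_lipOn {E : Type*} [NormedAddCommGroup E] {u : ℝ → E} {a : ℝ}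
    (hu : ∀ T, LipOn u a T) : ContinuousOn u (Ici a) := fun t ht => by
  obtain ⟨K, hK⟩ := hu (t + 1)
  refine (hK.continuousOn t ⟨ht, by linarith⟩).mono_of_mem_nhdsWithin ?_
  rw [← Ici_inter_Iic]
  exact inter_mem self_mem_nhdsWithin (mem_nhdsWithin_of_mem_nhds (Iic_mem_nhds (by linarith)))

/-- `F j` solves the equation for the term of degree `j`. -/
def IsCoeff (A : Cn n →L[ℂ] Cn n) (h : Cn n → ℝ → Cn n) (p : Prop)
    (F : (j : ℕ) → ℝ → HomPoly n j) (j : ℕ) : Prop :=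
  ∀ f : HomPoly n j →ₗ[ℂ] ℂ, PolyB p (fun t => ‖f (F j t)‖) ∧
    (∀ T, LipOn (fun t => f (F j t)) 0 T) ∧
    ∀ᵐ t, 0 < t → HasDerivAt (fun t => f (F j t))
      (f (opB A j (F j t) + lowerTerm (fun i => F i t) (fun z => h z t) j)) t

theorem IsCoeff.congr {F F' : (j : ℕ) → ℝ → HomPoly n j} {j : ℕ} (hF : IsCoeff A h p F j)
    (hFF' : ∀ i ≤ j, F i = F' i) : IsCoeff A h p F' j := by
  intro f
  have h1 : ∀ t, lowerTerm (fun i => F' i t) (fun z => h z t) j =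
      lowerTerm (fun i => F i t) (fun z => h z t) j := fun t =>
    lowerTerm_congr (fun i hi => by rw [hFF' i hi.le]) _
  simp only [h1, ← hFF' j le_rfl]
  exact hF f

theorem isCoeff_zero {F : (j : ℕ) → ℝ → HomPoly n j} (h0 : ∀ t, F 0 t = 0) :
    IsCoeff A h p F 0 := by
  intro f
  have h1 : ∀ t, lowerTerm (fun i => F i t) (fun z => h z t) 0 = 0 := fun t =>
    lowerTerm_eq_zero (fun i hi => absurd hi (Nat.not_lt_zero i)) _
  simp only [h0, h1, map_zero, add_zero]
  exact ⟨PolyB.const p _, fun T => LipOn.const _ _ _, ae_of_all _ fun t _ => hasDerivAt_const _ _⟩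

/-- The identity is in the kernel of `B₁` and nothing of lower degree contributes, so the constant
coefficient solves its equation. -/
theorem isCoeff_one {F : (j : ℕ) → ℝ → HomPoly n j} (h0 : ∀ t, F 0 t = 0)
    (h1 : ∀ t, F 1 t = idPoly n) : IsCoeff A h p F 1 := by
  intro f
  have h2 : ∀ t, lowerTerm (fun i => F i t) (fun z => h z t) 1 = 0 := fun t =>
    lowerTerm_eq_zero (fun i hi => by obtain rfl : i = 0 := by omega
                                      exact h0 t) _
  simp only [h1, h2, opB_idPoly, add_zero, map_zero]
  exact ⟨PolyB.const p _, fun T => LipOn.const _ _ _, ae_of_all _ fun t _ => hasDerivAt_const _ _⟩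

theorem fderiv_sum_homPoly (q : (j : ℕ) → HomPoly n j) (k : ℕ) (z : Cn n) :
    fderiv ℂ (fun w => ∑ j ∈ Finset.range k, (q j : Cn n → Cn n) w) z =
      ∑ j ∈ Finset.range k, fderiv ℂ (q j : Cn n → Cn n) z :=
  (HasFDerivAt.fun_sum fun j _ => (differentiable_homPoly (q j) z).hasFDerivAt).fderiv

theorem differentiable_sum_homPoly (q : (j : ℕ) → HomPoly n j) (k : ℕ) :
    Differentiable ℂ (fun w => ∑ j ∈ Finset.range k, (q j : Cn n → Cn n) w) :=
  Differentiable.fun_sum fun _ _ => differentiable_homPoly _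

/-- On the ball of radius `1 / 2` the generator is bounded uniformly in time, so growth comes only
from the lower coefficients; Cauchy's estimate transfers it to the term of degree `k`. -/
theorem polyB_lowerTerm (hA : 0 < lowerIndex A) (hh : IsGenerator A h)
    {F : (j : ℕ) → ℝ → HomPoly n j} {k : ℕ}
    (hF : ∀ j < k, ∀ f : HomPoly n j →ₗ[ℂ] ℂ, PolyB p (fun t => ‖f (F j t)‖)) (z : Cn n) :
    PolyB p (fun t =>
      ‖(lowerTerm (fun i => F i t) (fun z => h z t) k : Cn n → Cn n) z‖) := by
  have : ∀ j, ∃ u : ℝ → ℝ, j < k → PolyB p u ∧ (∀ t, 0 ≤ u t) ∧ ∀ t z, ‖z‖ ≤ 1 →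
      ‖(F j t : Cn n → Cn n) z‖ ≤ u t ∧ ‖fderiv ℂ (F j t : Cn n → Cn n) z‖ ≤ u t := fun j => by
    by_cases hj : j < k
    · obtain ⟨u, hu⟩ := exists_polyB_bound (hF j hj)
      exact ⟨u, fun _ => hu⟩
    · exact ⟨fun _ => 0, fun h => absurd h hj⟩
  choose u hu using this
  obtain ⟨C, hC, hCh⟩ := exists_bound_isInN hA (r := 1 / 2) (by norm_num)
  refine ((PolyB.sum (Finset.range k) fun j hj =>
    (hu j (Finset.mem_range.1 hj)).1).const_mul (c := C * (‖z‖ / (1 / 2)) ^ k)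
      (by positivity)).mono fun t ht => ?_
  have hd : DifferentiableOn ℂ (fun w => ∑ j ∈ Finset.range k, (F j t : Cn n → Cn n) w)
      (unitBall n) := (differentiable_sum_homPoly (fun j => F j t) k).differentiableOn
  refine (norm_taylorTerm_le (differentiableOn_fderiv_apply hd (hh.mem_N t ht).holomorphic)
    (r := 1 / 2) (M := (∑ j ∈ Finset.range k, u j t) * C) (by norm_num) (by norm_num)
    (fun w hw => ?_) k z).trans_eq (by ring)
  rw [fderiv_sum_homPoly (fun j => F j t)]
  refine (ContinuousLinearMap.le_opNorm _ _).trans ?_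
  refine mul_le_mul ?_ (hCh _ (hh.mem_N t ht) w hw) (norm_nonneg _)
    (Finset.sum_nonneg fun j hj => (hu j (Finset.mem_range.1 hj)).2.1 t)
  exact (norm_sum_le _ _).trans (Finset.sum_le_sum fun j hj =>
    ((hu j (Finset.mem_range.1 hj)).2.2 t w (by linarith)).2)

theorem aemeasurable_lowerTerm (hh : IsGenerator A h)
    {F : (j : ℕ) → ℝ → HomPoly n j} {k : ℕ}
    (hF : ∀ j < k, ∀ f : HomPoly n j →ₗ[ℂ] ℂ, ∀ T, LipOn (fun t => f (F j t)) 0 T)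
    (z : Cn n) :
    AEMeasurable (fun t => (lowerTerm (fun i => F i t) (fun z => h z t) k : Cn n → Cn n) z)
      (volume.restrict (Ici 0)) := by
  refine aemeasurable_taylorTerm ?_ (fun z hz => ?_) k z
  · filter_upwards [ae_restrict_mem measurableSet_Ici] with t ht
    exact differentiableOn_fderiv_apply
      (differentiable_sum_homPoly (fun j => F j t) k).differentiableOn
      (hh.mem_N t ht).holomorphic
  · have : (fun t => fderiv ℂ (fun w => ∑ j ∈ Finset.range k, (F j t : Cn n → Cn n) w) z (h z t)) =
        fun t => ∑ j ∈ Finset.range k, ∑ i, (finBasis ℂ (HomPoly n j)).coord i (F j t) •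
          fderiv ℂ (finBasis ℂ (HomPoly n j) i : Cn n → Cn n) z (h z t) := by
      funext t
      rw [fderiv_sum_homPoly (fun j => F j t), sum_apply]
      refine Finset.sum_congr rfl fun j _ => ?_
      rw [fderiv_eq_sum_coord, sum_apply]
      rfl
    rw [this]
    refine Finset.aemeasurable_fun_sum _ fun j hj => Finset.aemeasurable_fun_sum _ fun i _ => ?_
    refine AEMeasurable.smul
      (f := fun t => (finBasis ℂ (HomPoly n j)).coord i (F j t))
      (g := fun t => fderiv ℂ (finBasis ℂ (HomPoly n j) i : Cn n → Cn n) z (h z t)) ?_ ?_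
    · exact (continuousOn_Ici_of_lipOn (hF j (Finset.mem_range.1 hj) _)).aemeasurable
        measurableSet_Ici
    · exact (ContinuousLinearMap.measurable _).comp_aemeasurable (hh.measurable z hz)

theorem aemeasurable_functional {k : ℕ} {F : ℝ → HomPoly n k} {μ : Measure ℝ}
    (hF : ∀ z, AEMeasurable (fun t => (F t : Cn n → Cn n) z) μ) (f : HomPoly n k →ₗ[ℂ] ℂ) :
    AEMeasurable (fun t => f (F t)) μ := by
  obtain ⟨s, c, hf⟩ := exists_eval_repr f
  simp only [hf]
  refine Finset.aemeasurable_fun_sum _ fun x _ => AEMeasurable.const_mul ?_ _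
  exact (EuclideanSpace.proj x.2 : Cn n →L[ℂ] ℂ).measurable.comp_aemeasurable
    (hF x.1)

/-- The equations for the homogeneous terms can be solved recursively. -/
theorem exists_coeff (hA : 0 < lowerIndex A) (hh : IsGenerator A h)
    (hp : p → ∀ k, 2 ≤ k → ∀ μ, End.HasEigenvalue (opB A k) μ → μ.re ≠ 0)
    {Q : (k : ℕ) → HomPoly n k} (hQ : ∀ k, 2 ≤ k → projLE A k (Q k) = Q k) (K : ℕ) :
    ∃ F : (j : ℕ) → ℝ → HomPoly n j, (∀ t, F 0 t = 0) ∧ (∀ t, F 1 t = idPoly n) ∧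
      ∀ j < K, IsCoeff A h p F j ∧ (2 ≤ j → projLE A j (F j 0) = Q j) := by
  induction K with
  | zero =>
    -- The transport along `1 = j` merely puts the identity in degree `1`; all other degrees are
    -- zero so far.
    refine ⟨fun j _ => if hj : 1 = j then hj ▸ idPoly n else 0, fun t => by simp, fun t => by simp,
      fun j hj => absurd hj (Nat.not_lt_zero j)⟩
  | succ K ih =>
    obtain ⟨F, h0, h1, hF⟩ := ih
    rcases Nat.lt_or_ge K 2 with hK | hK
    · refine ⟨F, h0, h1, fun j hj => ⟨?_, fun h2 => by omega⟩⟩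
      obtain rfl | rfl : j = 0 ∨ j = 1 := by omega
      · exact isCoeff_zero h0
      · exact isCoeff_one h0 h1
    · obtain ⟨G, hG0, hG⟩ := exists_weak_polyB_solution (opB A K) (p := p)
        (fun hpp => hp hpp K hK)
        (N := fun t => lowerTerm (fun i => F i t) (fun z => h z t) K)
        (aemeasurable_functional
          (aemeasurable_lowerTerm hh fun j hj f => ((hF j hj).1 f).2.1))
        (polyB_functional (polyB_lowerTerm hA hh fun j hj f => ((hF j hj).1 f).1))
        (hQ K hK)
      have hne : ∀ j < K, F j = Function.update F K G j := fun j hj =>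
        (Function.update_of_ne hj.ne _ _).symm
      refine ⟨Function.update F K G, fun t => by rw [← hne 0 (by omega), h0],
        fun t => by rw [← hne 1 (by omega), h1], fun j hj => ?_⟩
      rcases Nat.lt_succ_iff_lt_or_eq.1 hj with hj | rfl
      · rw [← hne j hj]
        exact ⟨(hF j hj).1.congr fun i hi => hne i (hi.trans_lt hj), (hF j hj).2⟩
      · refine ⟨fun f => ?_, fun _ => by rw [Function.update_self]; exact hG0⟩
        have h2 : ∀ t, lowerTerm (fun i => Function.update F j G i t) (fun z => h z t) j =
            lowerTerm (fun i => F i t) (fun z => h z t) j := fun t =>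
          lowerTerm_congr (fun i hi => by rw [← hne i hi]) _
        simp only [h2, Function.update_self]
        exact hG f

end Coefficients

/-! ### Truncated solutions, their defect, and convergence of the approximations -/

section PartialSums

variable {n : ℕ} {A : Cn n →L[ℂ] Cn n} {h : Cn n → ℝ → Cn n} {p : Prop}
  {F : (j : ℕ) → ℝ → HomPoly n j} {N : ℕ}

/-- The polynomial mapping with the homogeneous terms `F j t`, `j < N`. -/
def partialSum (F : (j : ℕ) → ℝ → HomPoly n j) (N : ℕ) (t : ℝ) (z : Cn n) : Cn n :=
  ∑ j ∈ Finset.range N, (F j t : Cn n → Cn n) z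

/-- The right-hand side of the equation for `F j`. -/
def coeffDeriv (A : Cn n →L[ℂ] Cn n) (h : Cn n → ℝ → Cn n) (F : (j : ℕ) → ℝ → HomPoly n j)
    (j : ℕ) (t : ℝ) : HomPoly n j :=
  opB A j (F j t) + lowerTerm (fun i => F i t) (fun z => h z t) j

/-- The defect of `partialSum F N` in the Loewner equation. -/
def defect (A : Cn n →L[ℂ] Cn n) (h : Cn n → ℝ → Cn n) (F : (j : ℕ) → ℝ → HomPoly n j)
    (N : ℕ) (t : ℝ) (z : Cn n) : Cn n :=
  A (partialSum F N t z) + partialSum (coeffDeriv A h F) N t z -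
    fderiv ℂ (partialSum F N t) z (h z t)

theorem differentiable_partialSum (F : (j : ℕ) → ℝ → HomPoly n j) (N : ℕ) (t : ℝ) :
    Differentiable ℂ (partialSum F N t) :=
  differentiable_sum_homPoly (fun j => F j t) N

theorem taylorTerm_partialSum (F : (j : ℕ) → ℝ → HomPoly n j) {k N : ℕ} (hk : k < N) (t : ℝ) :
    taylorTerm (partialSum F N t) k = F k t :=
  taylorTerm_sum_homPoly (fun j => F j t) hk

theorem differentiableOn_defect (hh : IsGenerator A h) {t : ℝ} (ht : 0 ≤ t) :
    DifferentiableOn ℂ (defect A h F N t) (unitBall n) :=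
  ((A.differentiable.comp (differentiable_partialSum F N t)).differentiableOn.add
    (differentiable_partialSum _ N t).differentiableOn).sub
    (differentiableOn_fderiv_apply (differentiable_partialSum F N t).differentiableOn
      (hh.mem_N t ht).holomorphic)

/-- The right-hand sides `coeffDeriv` are exactly the homogeneous terms of `Dg h - A g`, so nothing
of degree below `N` remains. -/
theorem taylorTerm_defect (hh : IsGenerator A h) {t : ℝ} (ht : 0 ≤ t) {k : ℕ}
    (hk : k < N) : taylorTerm (defect A h F N t) k = 0 := by
  have hG := (differentiable_partialSum F N t).differentiableOn (s := unitBall n)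
  have dA : DifferentiableOn ℂ (fun z => A (partialSum F N t z)) (unitBall n) :=
    (A.differentiable.comp (differentiable_partialSum F N t)).differentiableOn
  have dS := (differentiable_partialSum (coeffDeriv A h F) N t).differentiableOn (s := unitBall n)
  have hv := (hh.mem_N t ht).holomorphic
  have dD := differentiableOn_fderiv_apply hG hv
  have h1 : taylorTerm (defect A h F N t) k = taylorTerm (fun z => A (partialSum F N t z)) k +
      taylorTerm (partialSum (coeffDeriv A h F) N t) k -
      taylorTerm (fun z => fderiv ℂ (partialSum F N t) z (h z t)) k := by
    rw [← taylorTerm_add dA dS, ← taylorTerm_sub (dA.fun_add dS) dD]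
    rfl
  rw [h1, taylorTerm_partialSum _ hk]
  ext1
  funext z
  have h2 := taylorTerm_fderiv_apply hG hv (hh.mem_N t ht).map_zero (hh.mem_N t ht).fderiv_zero k z
  have h3 : lowerTerm (taylorTerm (partialSum F N t)) (fun z => h z t) k =
      lowerTerm (fun i => F i t) (fun z => h z t) k :=
    lowerTerm_congr (fun i hi => taylorTerm_partialSum F (hi.trans hk) t) _
  rw [taylorTerm_partialSum _ hk, h3] at h2
  simp only [Submodule.coe_add, Submodule.coe_sub, Pi.add_apply, Pi.sub_apply, h2,
    taylorTerm_clm hG, taylorTerm_partialSum _ hk, coeffDeriv, Submodule.coe_zero, Pi.zero_apply]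
  abel

theorem polyB_coeffDeriv (hA : 0 < lowerIndex A) (hh : IsGenerator A h) {k : ℕ}
    (hF : ∀ j ≤ k, IsCoeff A h p F j) (f : HomPoly n k →ₗ[ℂ] ℂ) :
    PolyB p (fun t => ‖f (coeffDeriv A h F k t)‖) := by
  have h1 := ((hF k le_rfl) (f.comp (opB A k))).1
  have h2 := polyB_functional
    (polyB_lowerTerm hA hh fun j (hj : j < k) g => ((hF j hj.le) g).1) f
  refine (h1.add h2).mono fun t _ => ?_
  rw [coeffDeriv, map_add]
  exact norm_add_le _ _

theorem exists_polyB_partialSum {F : (j : ℕ) → ℝ → HomPoly n j} {N : ℕ}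
    (hF : ∀ j < N, ∀ f : HomPoly n j →ₗ[ℂ] ℂ, PolyB p (fun t => ‖f (F j t)‖)) :
    ∃ u : ℝ → ℝ, PolyB p u ∧ (∀ t, 0 ≤ u t) ∧ ∀ t z, ‖z‖ ≤ 1 →
      ‖partialSum F N t z‖ ≤ u t ∧ ‖fderiv ℂ (partialSum F N t) z‖ ≤ u t := by
  have : ∀ j, ∃ u : ℝ → ℝ, j < N → PolyB p u ∧ (∀ t, 0 ≤ u t) ∧ ∀ t z, ‖z‖ ≤ 1 →
      ‖(F j t : Cn n → Cn n) z‖ ≤ u t ∧ ‖fderiv ℂ (F j t : Cn n → Cn n) z‖ ≤ u t := fun j => by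
    by_cases hj : j < N
    · obtain ⟨u, hu⟩ := exists_polyB_bound (hF j hj)
      exact ⟨u, fun _ => hu⟩
    · exact ⟨fun _ => 0, fun h => absurd h hj⟩
  choose u hu using this
  refine ⟨fun t => ∑ j ∈ Finset.range N, u j t, PolyB.sum _ fun j hj =>
    (hu j (Finset.mem_range.1 hj)).1, fun t => Finset.sum_nonneg fun j hj =>
    (hu j (Finset.mem_range.1 hj)).2.1 t, fun t z hz => ⟨?_, ?_⟩⟩
  · exact (norm_sum_le _ _).trans (Finset.sum_le_sum fun j hj =>
      ((hu j (Finset.mem_range.1 hj)).2.2 t z hz).1)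
  · have : fderiv ℂ (partialSum F N t) z = _ := fderiv_sum_homPoly (fun j => F j t) N z
    rw [this]
    exact (norm_sum_le _ _).trans (Finset.sum_le_sum fun j hj =>
      ((hu j (Finset.mem_range.1 hj)).2.2 t z hz).2)

/-- Each part of the defect has the growth of the coefficients, since `h` is uniformly bounded on
smaller balls; Schwarz's lemma then supplies the factor `‖z‖ ^ N`. -/
theorem exists_norm_defect_le (hA : 0 < lowerIndex A) (hh : IsGenerator A h)
    (hF : ∀ j < N, IsCoeff A h p F j) {r : ℝ} (hr0 : 0 ≤ r) (hr : r < 1) :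
    ∃ (C : ℝ) (d : ℕ), 0 ≤ C ∧ (p → d = 0) ∧ ∀ t, 0 ≤ t → ∀ z, ‖z‖ ≤ r →
      ‖defect A h F N t z‖ ≤ C * (1 + t) ^ d * ‖z‖ ^ N := by
  obtain ⟨r', hrr', hr'1⟩ := exists_between hr
  have hr'0 : 0 < r' := hr0.trans_lt hrr'
  obtain ⟨u, hu, hu0, hub⟩ := exists_polyB_partialSum (N := N) fun j hj f => ((hF j hj) f).1
  obtain ⟨v, hv, hv0, hvb⟩ := exists_polyB_partialSum (N := N) (F := coeffDeriv A h F)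
    fun j hj f => polyB_coeffDeriv hA hh (fun i hi => hF i (hi.trans_lt hj)) f
  obtain ⟨C, hC, hCh⟩ := exists_bound_isInN hA hr'1
  obtain ⟨C₁, d, hC₁, hd, hb⟩ := ((hu.const_mul (norm_nonneg A)).add hv).add (hu.const_mul hC)
  refine ⟨C₁ / r' ^ N, d, by positivity, hd, fun t ht z hz => ?_⟩
  have h1 := norm_le_of_taylorTerm_eq_zero (differentiableOn_defect (F := F) (N := N) hh ht)
    hr'0 hr'1.le (M := C₁ * (1 + t) ^ d) (fun w hw => ?_)
    (fun j hj => taylorTerm_defect hh ht hj) (z := z) (by linarith)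
  · refine h1.trans_eq ?_
    rw [div_pow]; ring
  · refine le_trans ?_ (hb t ht)
    have hw1 : ‖w‖ ≤ 1 := by linarith
    refine (norm_sub_le _ _).trans (add_le_add ((norm_add_le _ _).trans (add_le_add ?_ ?_)) ?_)
    · exact (A.le_opNorm _).trans (mul_le_mul_of_nonneg_left (hub t w hw1).1 (norm_nonneg A))
    · exact (hvb t w hw1).1
    · refine (ContinuousLinearMap.le_opNorm _ _).trans ?_
      rw [mul_comm]
      exact mul_le_mul (hCh _ (hh.mem_N t ht) w hw.le) (hub t w hw1).2 (norm_nonneg _) hC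

theorem exists_lipschitzOnWith_homPoly {k : ℕ} (Q : HomPoly n k) :
    ∃ K, LipschitzOnWith K (Q : Cn n → Cn n) (unitBall n) := by
  have hc : ContDiffOn ℂ 1 (Q : Cn n → Cn n) univ :=
    (contDiffOn_of_differentiableOn_complex isOpen_univ
      (differentiable_homPoly Q).differentiableOn).of_le (by exact_mod_cast le_top)
  have hc' : ContDiff ℝ 1 (Q : Cn n → Cn n) := (contDiffOn_univ.1 hc).restrict_scalars ℝ
  obtain ⟨K, hK⟩ := hc'.contDiffOn.exists_lipschitzOnWith (s := closedBall 0 1) (by decide)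
    (convex_closedBall 0 1) (isCompact_closedBall 0 1)
  exact ⟨K, hK.mono ball_subset_closedBall⟩

theorem lipOn_partialSum_comp (hF : ∀ j < N, IsCoeff A h p F j) {s : ℝ} (hs : 0 ≤ s)
    {w : ℝ → Cn n} (hw : IsTrajectory h s w) (T : ℝ) :
    LipOn (fun t => partialSum F N t (w t)) s T := by
  have : (fun t => partialSum F N t (w t)) = fun t => ∑ j ∈ Finset.range N,
      ∑ i, (finBasis ℂ (HomPoly n j)).coord i (F j t) •
        (finBasis ℂ (HomPoly n j) i : Cn n → Cn n) (w t) :=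
    funext fun t => Finset.sum_congr rfl fun j _ => coe_eq_sum_coord _ _
  rw [this]
  refine LipOn.sum _ fun j hj => LipOn.sum _ fun i _ => ?_
  obtain ⟨K, hK⟩ := exists_lipschitzOnWith_homPoly (finBasis ℂ (HomPoly n j) i)
  exact LipOn.bilinear ((ContinuousLinearMap.lsmul ℝ ℂ : ℂ →L[ℝ] Cn n →L[ℝ] Cn n))
    (((hF j (Finset.mem_range.1 hj) _).2.1 T).mono (Icc_subset_Icc_left hs))
    (LipOn.comp_lipschitzOn hK (hw.lip T) fun x hx => hw.mem x hx.1)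

/-- In fixed bases the sum is a finite combination of scalar coefficients and fixed polynomials
along the path, so one null set suffices and the product rule applies. -/
theorem ae_hasDerivAt_partialSum_comp (hF : ∀ j < N, IsCoeff A h p F j) {s : ℝ} (hs : 0 ≤ s)
    {w : ℝ → Cn n} (hw : IsTrajectory h s w) :
    ∀ᵐ t, s < t → HasDerivAt (fun t => partialSum F N t (w t))
      (partialSum (coeffDeriv A h F) N t (w t) -
        fderiv ℂ (partialSum F N t) (w t) (h (w t) t)) t := by
  have h1 : ∀ᵐ t, ∀ j, j < N → ∀ i, 0 < t →
      HasDerivAt (fun t => (finBasis ℂ (HomPoly n j)).coord i (F j t))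
        ((finBasis ℂ (HomPoly n j)).coord i (coeffDeriv A h F j t)) t := by
    refine ae_all_iff.2 fun j => ?_
    by_cases hj : j < N
    · have : ∀ᵐ t, ∀ i, 0 < t → HasDerivAt (fun t => (finBasis ℂ (HomPoly n j)).coord i (F j t))
          ((finBasis ℂ (HomPoly n j)).coord i (coeffDeriv A h F j t)) t :=
        ae_all_iff.2 fun i => (hF j hj _).2.2
      filter_upwards [this] with t ht _ using ht
    · exact ae_of_all _ fun t h => absurd h hj
  filter_upwards [h1, hw.deriv] with t ht hwt hst
  have h0 : 0 < t := hs.trans_lt hst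
  have h2 : (fun t => partialSum F N t (w t)) = fun t => ∑ j ∈ Finset.range N,
      ∑ i, (finBasis ℂ (HomPoly n j)).coord i (F j t) •
        (finBasis ℂ (HomPoly n j) i : Cn n → Cn n) (w t) :=
    funext fun t => Finset.sum_congr rfl fun j _ => coe_eq_sum_coord _ _
  have h3 : HasDerivAt (fun t => ∑ j ∈ Finset.range N,
      ∑ i, (finBasis ℂ (HomPoly n j)).coord i (F j t) •
        (finBasis ℂ (HomPoly n j) i : Cn n → Cn n) (w t))
      (∑ j ∈ Finset.range N, ∑ i, ((finBasis ℂ (HomPoly n j)).coord i (F j t) •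
        (fderiv ℂ (finBasis ℂ (HomPoly n j) i : Cn n → Cn n) (w t) (-h (w t) t)) +
        (finBasis ℂ (HomPoly n j)).coord i (coeffDeriv A h F j t) •
        (finBasis ℂ (HomPoly n j) i : Cn n → Cn n) (w t))) t := by
    refine HasDerivAt.fun_sum fun j hj => HasDerivAt.fun_sum fun i _ => ?_
    have h4 : HasDerivAt (fun t => (finBasis ℂ (HomPoly n j) i : Cn n → Cn n) (w t))
        (fderiv ℂ (finBasis ℂ (HomPoly n j) i : Cn n → Cn n) (w t) (-h (w t) t)) t :=
      ((differentiable_homPoly (finBasis ℂ (HomPoly n j) i)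
        (w t)).hasFDerivAt.restrictScalars ℝ).comp_hasDerivAt t (hwt hst)
    exact (ht j (Finset.mem_range.1 hj) i h0).smul h4
  rw [h2]
  refine h3.congr_deriv ?_
  have h5 : fderiv ℂ (partialSum F N t) (w t) =
      ∑ j ∈ Finset.range N, fderiv ℂ (F j t : Cn n → Cn n) (w t) :=
    fderiv_sum_homPoly (fun j => F j t) N (w t)
  rw [h5, partialSum, sum_apply, ← Finset.sum_sub_distrib]
  refine Finset.sum_congr rfl fun j _ => ?_
  rw [Finset.sum_add_distrib, coe_eq_sum_coord (coeffDeriv A h F j t), fderiv_eq_sum_coord,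
    sum_apply, sub_eq_neg_add, ← Finset.sum_neg_distrib]
  congr 1
  refine Finset.sum_congr rfl fun i _ => ?_
  rw [map_neg, smul_neg]
  rfl

/-- An exact solution would be constant along trajectories after multiplication by `e^{tA}`; the
truncated one moves with its defect. -/
theorem ae_hasDerivAt_expL_partialSum_comp (hF : ∀ j < N, IsCoeff A h p F j) {s : ℝ}
    (hs : 0 ≤ s) {w : ℝ → Cn n} (hw : IsTrajectory h s w) :
    ∀ᵐ t, s < t → HasDerivAt (fun t => expOp A t (partialSum F N t (w t)))
      (expOp A t (defect A h F N t (w t))) t := by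
  filter_upwards [ae_hasDerivAt_partialSum_comp hF hs hw] with t ht hst
  refine (hasDerivAt_expL_apply A (ht hst)).congr_deriv ?_
  rw [← expL_apply_comm, ← map_add, expOp_eq_expL, defect]
  congr 1
  abel

/-- The approximations `e^{tA} (partialSum F N t) (v(z, s, t))` of the Loewner chain. -/
def approxChain (A : Cn n →L[ℂ] Cn n) (h : Cn n → ℝ → Cn n) (F : (j : ℕ) → ℝ → HomPoly n j)
    (N : ℕ) (t s : ℝ) (z : Cn n) : Cn n :=
  expOp A t (partialSum F N t (transition h s t z))

/-- The `t`-derivative is `e^{tA}` applied to the defect at `v_{s,t}(z)`, where `‖v‖^N` decays like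
`e^{-N m (t-s)}` while `e^{(t-s)A}` grows at most like `e^{k₊ (t-s)}` times a polynomial. With `N m
> k₊` the integral converges. The factor `e^{-sA}` keeps the dependence on `s` polynomial. -/
theorem exists_norm_approxChain_sub_le (hA : 0 < lowerIndex A) (hh : IsGenerator A h)
    (hF : ∀ j < N, IsCoeff A h p F j) (hN : upperIndex A < N * lowerIndex A) {r : ℝ}
    (hr0 : 0 ≤ r) (hr : r < 1) :
    ∃ (C c : ℝ) (d : ℕ), 0 ≤ C ∧ 0 < c ∧ (p → d = 0) ∧ ∀ s t t', 0 ≤ s → s ≤ t → t ≤ t' →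
      ∀ z, ‖z‖ ≤ r →
      ‖expOp A (-s) (approxChain A h F N t' s z - approxChain A h F N t s z)‖ ≤
        C * (1 + s) ^ d * Real.exp (-(c * (t - s))) * ‖z‖ ^ N := by
  obtain ⟨C₁, d₁, hC₁, h₁⟩ := exists_norm_expOp_le A
  obtain ⟨C₂, d, hC₂, hd, h₂⟩ := exists_norm_defect_le hA hh hF hr0 hr
  obtain ⟨C₃, hC₃, h₃⟩ := exists_norm_transition_decay hA hh hr
  -- Half of the gap is the final rate; the other half absorbs the polynomial factors in `x - s`.
  set c : ℝ := (N * lowerIndex A - upperIndex A) / 2 with hc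
  have hc0 : 0 < c := by rw [hc]; linarith
  obtain ⟨C₄, hC₄, h₄⟩ := exists_pow_mul_exp_le hc0 (d₁ + d)
  refine ⟨C₁ * C₂ * C₃ ^ N * C₄ / c, c, d, by positivity, hc0, hd,
    fun s t t' hs hst htt' z hz => ?_⟩
  have hzb : z ∈ unitBall n := mem_unitBall.2 (hz.trans_lt hr)
  obtain ⟨hw, hws⟩ := isTrajectory_transition hA hh hs hzb
  set K := C₁ * C₂ * C₃ ^ N * C₄ * (1 + s) ^ d * ‖z‖ ^ N with hK
  have hK0 : 0 ≤ K := by positivity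
  have hlip : LipOn (fun x => expOp A (-s) (approxChain A h F N x s z)) t t' := by
    have h1 := (LipOn.expL_apply A (lipOn_partialSum_comp hF hs hw t')).mono
      (Icc_subset_Icc_left hst)
    obtain ⟨L, hL⟩ := h1
    exact ⟨_, (expOp A (-s)).lipschitz.comp_lipschitzOnWith hL⟩
  have hB : ∀ x, HasDerivAt (fun x => -(K / c * Real.exp (-(c * (x - s)))))
      (K * Real.exp (-(c * (x - s)))) x := fun x => by
    have := ((((((hasDerivAt_id x).sub_const s).const_mul c).fun_neg).exp).const_mul
      (K / c)).fun_neg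
    refine this.congr_deriv ?_
    simp only [id]
    field_simp
  have key := norm_sub_le_of_ae_hasDerivAt (u := fun x => expOp A (-s) (approxChain A h F N x s z))
    (u' := fun x => expOp A (-s) (expOp A x (defect A h F N x (transition h s x z))))
    (B := fun x => -(K / c * Real.exp (-(c * (x - s)))))
    (B' := fun x => K * Real.exp (-(c * (x - s)))) htt' (hlip.absolutelyContinuous htt')
    ((LipOn.of_contDiff (by fun_prop) t t').absolutelyContinuous htt') (by
      filter_upwards [ae_hasDerivAt_expL_partialSum_comp hF hs hw] with x hx hxt
      have hsx : s < x := hst.trans_lt hxt.1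
      have hx0 : 0 ≤ x := hs.trans hsx.le
      refine ⟨((expOp A (-s)).restrictScalars ℝ).hasFDerivAt.comp_hasDerivAt x (hx hsx),
        hB x, ?_⟩
      have hσ : 0 ≤ x - s := sub_nonneg.2 hsx.le
      have e1 : expOp A (-s) (expOp A x (defect A h F N x (transition h s x z))) =
          expOp A (x - s) (defect A h F N x (transition h s x z)) := by
        rw [expOp_eq_expL, expOp_eq_expL, expOp_eq_expL, ← expL_add_apply]; congr 2; ring
      rw [e1]
      have hwr : ‖transition h s x z‖ ≤ r := (norm_transition_le hA hh hs hsx.le hzb).trans hz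
      have b1 := h₁ (x - s) hσ (defect A h F N x (transition h s x z))
      have b2 := h₂ x hx0 _ hwr
      have b3 := h₃ s x hs hsx.le z hz
      have b4 := h₄ (x - s) hσ
      have b5 : (1 + x) ^ d ≤ (1 + s) ^ d * (1 + (x - s)) ^ d := by
        rw [← mul_pow]
        have : 0 ≤ 1 + x := by linarith
        gcongr
        nlinarith
      have b6 : ‖transition h s x z‖ ^ N ≤
          C₃ ^ N * Real.exp (-(N * lowerIndex A * (x - s))) * ‖z‖ ^ N := by
        refine (pow_le_pow_left₀ (norm_nonneg _) b3 N).trans_eq ?_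
        rw [mul_pow, mul_pow, ← Real.exp_nat_mul]
        ring_nf
      have e2 : Real.exp (upperIndex A * (x - s)) * Real.exp (-(N * lowerIndex A * (x - s))) =
          Real.exp (-(c * (x - s))) * Real.exp (-(c * (x - s))) := by
        rw [← Real.exp_add, ← Real.exp_add, hc]; ring_nf
      calc _ ≤ C₁ * (1 + (x - s)) ^ d₁ * Real.exp (upperIndex A * (x - s)) *
            ‖defect A h F N x (transition h s x z)‖ := b1
        _ ≤ C₁ * (1 + (x - s)) ^ d₁ * Real.exp (upperIndex A * (x - s)) *
            (C₂ * ((1 + s) ^ d * (1 + (x - s)) ^ d) *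
              (C₃ ^ N * Real.exp (-(N * lowerIndex A * (x - s))) * ‖z‖ ^ N)) := by
          gcongr
          exact b2.trans (by gcongr)
        _ = C₁ * C₂ * C₃ ^ N * (1 + s) ^ d * ‖z‖ ^ N * (1 + (x - s)) ^ (d₁ + d) *
            (Real.exp (upperIndex A * (x - s)) * Real.exp (-(N * lowerIndex A * (x - s)))) := by
          rw [pow_add]; ring
        _ = C₁ * C₂ * C₃ ^ N * (1 + s) ^ d * ‖z‖ ^ N *
            ((1 + (x - s)) ^ (d₁ + d) * Real.exp (-(c * (x - s)))) *
              Real.exp (-(c * (x - s))) := by rw [e2]; ring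
        _ ≤ C₁ * C₂ * C₃ ^ N * (1 + s) ^ d * ‖z‖ ^ N * C₄ * Real.exp (-(c * (x - s))) := by
          gcongr
        _ = _ := by rw [hK]; ring)
  rw [map_sub]
  refine key.trans ?_
  have h5 : 0 ≤ K / c * Real.exp (-(c * (t' - s))) := by positivity
  calc _ ≤ K / c * Real.exp (-(c * (t - s))) := by linarith
    _ = _ := by rw [hK]; ring

end PartialSums

/-! ### The limit chain: flow invariance, coefficients, univalence -/

section Chain

variable {n : ℕ} {A : Cn n →L[ℂ] Cn n} {h : Cn n → ℝ → Cn n} {p : Prop}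
  {F : (j : ℕ) → ℝ → HomPoly n j} {N : ℕ}

/-- The Loewner chain with the homogeneous terms `F j t`, `j < N`. -/
def chain (A : Cn n →L[ℂ] Cn n) (h : Cn n → ℝ → Cn n) (F : (j : ℕ) → ℝ → HomPoly n j)
    (N : ℕ) (z : Cn n) (s : ℝ) : Cn n :=
  limUnder atTop fun t => approxChain A h F N t s z

theorem expOp_expOp_neg (A : Cn n →L[ℂ] Cn n) (t : ℝ) (v : Cn n) :
    expOp A t (expOp A (-t) v) = v := expL_apply_neg_apply A t v

theorem expOp_neg_expOp (A : Cn n →L[ℂ] Cn n) (t : ℝ) (v : Cn n) :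
    expOp A (-t) (expOp A t v) = v := expL_neg_apply_apply A t v

theorem tendsto_exp_neg_mul_sub {c : ℝ} (hc : 0 < c) (K s : ℝ) :
    Tendsto (fun t : ℝ => K * Real.exp (-(c * (t - s)))) atTop (𝓝 0) := by
  have h1 : Tendsto (fun t : ℝ => c * (t - s)) atTop atTop :=
    (tendsto_atTop_add_const_right _ (-s) tendsto_id).const_mul_atTop hc
  simpa using (Real.tendsto_exp_neg_atTop_nhds_zero.comp h1).const_mul K

theorem tendsto_approxChain (hA : 0 < lowerIndex A) (hh : IsGenerator A h)
    (hF : ∀ j < N, IsCoeff A h p F j) (hN : upperIndex A < N * lowerIndex A) {s : ℝ} (hs : 0 ≤ s)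
    {z : Cn n} (hz : z ∈ unitBall n) :
    Tendsto (fun t => approxChain A h F N t s z) atTop (𝓝 (chain A h F N z s)) := by
  refine CauchySeq.tendsto_limUnder ?_
  obtain ⟨C, c, d, hC, hc, -, hb⟩ := exists_norm_approxChain_sub_le hA hh hF hN (norm_nonneg z)
    (mem_unitBall.1 hz)
  rw [Metric.cauchySeq_iff']
  intro ε hε
  have hlim := tendsto_exp_neg_mul_sub hc (‖expOp A s‖ * (C * (1 + s) ^ d * ‖z‖ ^ N)) s
  obtain ⟨T, hT, hsT⟩ := ((hlim.eventually (gt_mem_nhds hε)).and (eventually_ge_atTop s)).exists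
  refine ⟨T, fun t ht => ?_⟩
  rw [dist_eq_norm, ← expOp_expOp_neg A s (_ - _)]
  refine ((expOp A s).le_opNorm _).trans_lt (lt_of_le_of_lt ?_ hT)
  have := hb s T t hs hsT ht z le_rfl
  calc _ ≤ ‖expOp A s‖ * (C * (1 + s) ^ d * Real.exp (-(c * (T - s))) * ‖z‖ ^ N) := by gcongr
    _ = _ := by ring

theorem exists_norm_chain_sub_approxChain_le (hA : 0 < lowerIndex A) (hh : IsGenerator A h)
    (hF : ∀ j < N, IsCoeff A h p F j) (hN : upperIndex A < N * lowerIndex A) {r : ℝ}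
    (hr0 : 0 ≤ r) (hr : r < 1) :
    ∃ (C c : ℝ) (d : ℕ), 0 ≤ C ∧ 0 < c ∧ (p → d = 0) ∧ ∀ s t, 0 ≤ s → s ≤ t →
      ∀ z, ‖z‖ ≤ r → ‖expOp A (-s) (chain A h F N z s - approxChain A h F N t s z)‖ ≤
        C * (1 + s) ^ d * Real.exp (-(c * (t - s))) * ‖z‖ ^ N := by
  obtain ⟨C, c, d, hC, hc, hd, hb⟩ := exists_norm_approxChain_sub_le hA hh hF hN hr0 hr
  refine ⟨C, c, d, hC, hc, hd, fun s t hs hst z hz => ?_⟩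
  have h1 := tendsto_approxChain hA hh hF hN hs (mem_unitBall.2 (hz.trans_lt hr))
  have h2 : Tendsto (fun t' => ‖expOp A (-s) (approxChain A h F N t' s z -
      approxChain A h F N t s z)‖) atTop
      (𝓝 ‖expOp A (-s) (chain A h F N z s - approxChain A h F N t s z)‖) :=
    (((expOp A (-s)).continuous.tendsto _).comp (h1.sub_const _)).norm
  exact le_of_tendsto h2 ((eventually_ge_atTop t).mono fun t' ht' => hb s t t' hs hst ht' z hz)

theorem differentiableOn_chain (hA : 0 < lowerIndex A) (hh : IsGenerator A h)
    (hF : ∀ j < N, IsCoeff A h p F j) (hN : upperIndex A < N * lowerIndex A) {s : ℝ} (hs : 0 ≤ s) :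
    DifferentiableOn ℂ (fun z => chain A h F N z s) (unitBall n) := by
  intro z hz
  obtain ⟨r, hzr, hr⟩ := exists_between (mem_unitBall.1 hz)
  have hr0 : 0 ≤ r := (norm_nonneg z).trans hzr.le
  obtain ⟨C, c, d, hC, hc, -, hb⟩ := exists_norm_chain_sub_approxChain_le hA hh hF hN hr0 hr
  have hsub : ∀ w ∈ ball z (r - ‖z‖), ‖w‖ < r := fun w hw => by
    rw [mem_ball, dist_eq_norm] at hw
    have := norm_le_norm_add_norm_sub' w z
    linarith
  refine (differentiableAt_of_tendstoUniformlyOn_ball (f := fun t => approxChain A h F N t s)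
    (l := atTop) (sub_pos.2 hzr) ?_ ?_).differentiableWithinAt
  · filter_upwards [eventually_ge_atTop s] with t ht
    refine ((expOp A t).differentiable.comp (differentiable_partialSum F N t)).comp_differentiableOn
      ((differentiableOn_transition hA hh hs ht).mono fun w hw => ?_)
    exact mem_unitBall.2 ((hsub w hw).trans hr)
  · rw [Metric.tendstoUniformlyOn_iff]
    intro ε hε
    have hlim := tendsto_exp_neg_mul_sub hc (‖expOp A s‖ * (C * (1 + s) ^ d)) s
    filter_upwards [hlim.eventually (gt_mem_nhds hε), eventually_ge_atTop s] with t ht hst w hw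
    rw [dist_eq_norm, ← expOp_expOp_neg A s (_ - _)]
    refine ((expOp A s).le_opNorm _).trans_lt (lt_of_le_of_lt ?_ ht)
    have hw1 := hsub w hw
    have h1 := hb s t hs hst w hw1.le
    have h2 : ‖w‖ ^ N ≤ 1 := pow_le_one₀ (norm_nonneg _) (by linarith)
    calc _ ≤ ‖expOp A s‖ * (C * (1 + s) ^ d * Real.exp (-(c * (t - s))) * 1) := by
          gcongr
          exact h1.trans (by gcongr)
      _ = _ := by ring

/-- The approximations at `z` from `s` and at `v_{s,t}(z)` from `t` coincide at all later times, by
the composition law of the transition maps. -/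
theorem chain_transition (hA : 0 < lowerIndex A) (hh : IsGenerator A h)
    (hF : ∀ j < N, IsCoeff A h p F j) (hN : upperIndex A < N * lowerIndex A) {s t : ℝ}
    (hs : 0 ≤ s) (hst : s ≤ t) {z : Cn n} (hz : z ∈ unitBall n) :
    chain A h F N z s = chain A h F N (transition h s t z) t := by
  have h1 := tendsto_approxChain hA hh hF hN hs hz
  have h2 := tendsto_approxChain hA hh hF hN (hs.trans hst) (transition_mem hA hh hs hst hz)
  refine tendsto_nhds_unique h1 (h2.congr' ?_)
  filter_upwards [eventually_ge_atTop t] with T hT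
  rw [approxChain, approxChain, transition_comp hA hh hs hst hT hz]

/-- The case `t = s` of the convergence estimate: there the approximation is `e^{sA}` applied to the
partial sum. -/
theorem exists_norm_chain_sub_partialSum_le (hA : 0 < lowerIndex A) (hh : IsGenerator A h)
    (hF : ∀ j < N, IsCoeff A h p F j) (hN : upperIndex A < N * lowerIndex A) {r : ℝ}
    (hr0 : 0 ≤ r) (hr : r < 1) :
    ∃ (C : ℝ) (d : ℕ), 0 ≤ C ∧ (p → d = 0) ∧ ∀ s, 0 ≤ s → ∀ z, ‖z‖ ≤ r →
      ‖expOp A (-s) (chain A h F N z s) - partialSum F N s z‖ ≤ C * (1 + s) ^ d * ‖z‖ ^ N := by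
  obtain ⟨C, c, d, hC, hc, hd, hb⟩ := exists_norm_chain_sub_approxChain_le hA hh hF hN hr0 hr
  refine ⟨C, d, hC, hd, fun s hs z hz => ?_⟩
  have h1 := hb s s hs le_rfl z hz
  rw [approxChain, (isTrajectory_transition hA hh hs (mem_unitBall.2 (hz.trans_lt hr))).2, map_sub,
    expOp_neg_expOp] at h1
  simpa using h1

theorem exists_norm_chain_le (hA : 0 < lowerIndex A) (hh : IsGenerator A h)
    (hF : ∀ j < N, IsCoeff A h p F j) (hN : upperIndex A < N * lowerIndex A) {r : ℝ} (hr : r < 1) :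
    ∃ (C : ℝ) (d : ℕ), 0 ≤ C ∧ (p → d = 0) ∧ ∀ s, 0 ≤ s → ∀ z, ‖z‖ ≤ r →
      ‖expOp A (-s) (chain A h F N z s)‖ ≤ C * (1 + s) ^ d := by
  rcases lt_or_ge r 0 with hr0 | hr0
  · exact ⟨0, 0, le_rfl, fun _ => rfl, fun s _ z hz => absurd (norm_nonneg z) (by linarith)⟩
  obtain ⟨C, d, hC, hd, hb⟩ := exists_norm_chain_sub_partialSum_le hA hh hF hN hr0 hr
  obtain ⟨u, hu, hu0, hub⟩ := exists_polyB_partialSum (N := N) fun j hj f => ((hF j hj) f).1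
  obtain ⟨C', d', hC', hd', hb'⟩ := hu.add (v := fun s => C * (1 + s) ^ d)
    ⟨C, d, hC, hd, fun t _ => le_rfl⟩
  refine ⟨C', d', hC', hd', fun s hs z hz => le_trans ?_ (hb' s hs)⟩
  have h1 := hb s hs z hz
  have h2 : ‖z‖ ^ N ≤ 1 := pow_le_one₀ (norm_nonneg _) (by linarith)
  have h3 := (hub s z (by linarith)).1
  have h4 := norm_le_norm_add_norm_sub' (expOp A (-s) (chain A h F N z s)) (partialSum F N s z)
  have h5 : C * (1 + s) ^ d * ‖z‖ ^ N ≤ C * (1 + s) ^ d * 1 := by gcongr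
  linarith

theorem differentiableOn_expOp_comp {g : Cn n → Cn n} (hg : DifferentiableOn ℂ g (unitBall n))
    (t : ℝ) : DifferentiableOn ℂ (fun z => expOp A t (g z)) (unitBall n) :=
  (expOp A t).differentiable.comp_differentiableOn hg

/-- `e^{-tA} f` differs from the partial sum by `O(‖z‖^N)`, which has no terms of degree below `N`.
-/
theorem coeffF_chain (hA : 0 < lowerIndex A) (hh : IsGenerator A h)
    (hF : ∀ j < N, IsCoeff A h p F j) (hN : upperIndex A < N * lowerIndex A) {t : ℝ}
    (ht : 0 ≤ t) {k : ℕ} (hk : k < N) : coeffF A (chain A h F N) k t = F k t := by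
  obtain ⟨C, d, hC, -, hb⟩ := exists_norm_chain_sub_partialSum_le hA hh hF hN
    (r := 1 / 2) (by norm_num) (by norm_num)
  have d1 := differentiableOn_expOp_comp (A := A) (differentiableOn_chain hA hh hF hN ht) (-t)
  have d2 := (differentiable_partialSum F N t).differentiableOn (s := unitBall n)
  have h1 := taylorTerm_eq_zero_of_norm_le (d1.fun_sub d2) (r := 1 / 2) (by norm_num)
    (fun z hz => hb t ht z hz.le) hk
  rw [taylorTerm_sub d1 d2, taylorTerm_partialSum F hk, sub_eq_zero] at h1
  exact h1

theorem taylorTerm_zero_apply (g : Cn n → Cn n) (z : Cn n) :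
    (taylorTerm g 0 : Cn n → Cn n) z = g 0 := by
  simp [taylorTerm]

theorem taylorTerm_one_apply (g : Cn n → Cn n) (z : Cn n) :
    (taylorTerm g 1 : Cn n → Cn n) z = fderiv ℂ g 0 z := by
  simp [taylorTerm]

theorem eq_zero_and_fderiv_eq_of_taylorTerm {g : Cn n → Cn n} {t : ℝ}
    (hg : DifferentiableOn ℂ g (unitBall n))
    (h0 : taylorTerm (fun z => expOp A (-t) (g z)) 0 = 0)
    (h1 : taylorTerm (fun z => expOp A (-t) (g z)) 1 = idPoly n) :
    g 0 = 0 ∧ fderiv ℂ g 0 = expOp A t := by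
  have e0 : expOp A (-t) (g 0) = 0 := by
    have := taylorTerm_zero_apply (fun z => expOp A (-t) (g z)) 0
    rw [h0] at this
    exact this.symm
  refine ⟨by rw [← expOp_expOp_neg A t (g 0), e0, map_zero], ?_⟩
  have hg0 : DifferentiableAt ℂ g 0 := hg.differentiableAt unitBall_mem_nhds
  have e1 : fderiv ℂ (fun z => expOp A (-t) (g z)) 0 = (expOp A (-t)).comp (fderiv ℂ g 0) :=
    ((expOp A (-t)).hasFDerivAt.comp 0 hg0.hasFDerivAt).fderiv
  ext1 z
  have e2 := taylorTerm_one_apply (fun z => expOp A (-t) (g z)) z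
  rw [h1, e1, idPoly_apply, ContinuousLinearMap.comp_apply] at e2
  rw [← expOp_expOp_neg A t (fderiv ℂ g 0 z), ← e2]

theorem chain_zero_and_fderiv (hA : 0 < lowerIndex A) (hh : IsGenerator A h)
    (hF : ∀ j < N, IsCoeff A h p F j) (hN : upperIndex A < N * lowerIndex A) (hN2 : 2 ≤ N)
    (hF0 : ∀ t, F 0 t = 0) (hF1 : ∀ t, F 1 t = idPoly n) {t : ℝ} (ht : 0 ≤ t) :
    chain A h F N 0 t = 0 ∧ fderiv ℂ (fun z => chain A h F N z t) 0 = expOp A t :=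
  eq_zero_and_fderiv_eq_of_taylorTerm (differentiableOn_chain hA hh hF hN ht)
    ((coeffF_chain hA hh hF hN ht (by omega)).trans (hF0 t))
    ((coeffF_chain hA hh hF hN ht (by omega)).trans (hF1 t))

/-- If the values at `z₁, z₂` agree at time `s`, flow invariance gives equal values at `v_{s,t}(z₁),
v_{s,t}(z₂)` for all later `t`. These points lie in a ball of exponentially small radius, on which
`e^{-tA} f(·,t)` is a small Lipschitz perturbation of the identity. Injectivity of the transition
maps then returns `z₁ = z₂`. -/
theorem injOn_chain (hA : 0 < lowerIndex A) (hh : IsGenerator A h)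
    (hF : ∀ j < N, IsCoeff A h p F j) (hN : upperIndex A < N * lowerIndex A) (hN2 : 2 ≤ N)
    (hF0 : ∀ t, F 0 t = 0) (hF1 : ∀ t, F 1 t = idPoly n) {s : ℝ} (hs : 0 ≤ s) :
    InjOn (fun z => chain A h F N z s) (unitBall n) := by
  intro z₁ hz₁ z₂ hz₂ heq
  obtain ⟨r, hr₁, hr⟩ := exists_between (max_lt (mem_unitBall.1 hz₁) (mem_unitBall.1 hz₂))
  obtain ⟨C, d, hC, -, hb⟩ := exists_norm_chain_le hA hh hF hN (r := 1 / 2) (by norm_num)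
  obtain ⟨C', hC', hdec⟩ := exists_norm_transition_decay hA hh hr
  set ρ : ℝ → ℝ := fun t => C' * Real.exp (-(lowerIndex A * (t - s))) with hρ
  have hρ0 : ∀ t, 0 < ρ t := fun t => by positivity
  have hlim1 : Tendsto ρ atTop (𝓝 0) := tendsto_exp_neg_mul_sub hA C' s
  obtain ⟨C₂, hC₂, hpe⟩ := exists_pow_mul_exp_le (half_pos hA) d
  have hlim2 : Tendsto (fun t => 128 * C * (1 + t) ^ d * ρ t) atTop (𝓝 0) := by
    have := tendsto_exp_neg_mul_sub (half_pos hA)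
      (128 * C * C' * C₂ * Real.exp (lowerIndex A / 2 * s)) s
    refine squeeze_zero' ((eventually_ge_atTop 0).mono fun t ht => by
      have := (hρ0 t).le; positivity) ((eventually_ge_atTop 0).mono fun t ht => ?_) this
    have h1 := hpe t ht
    have e1 : Real.exp (-(lowerIndex A * (t - s))) = Real.exp (-(lowerIndex A / 2 * t)) *
        Real.exp (lowerIndex A / 2 * s) * Real.exp (-(lowerIndex A / 2 * (t - s))) := by
      rw [← Real.exp_add, ← Real.exp_add]; ring_nf
    rw [hρ]
    simp only
    rw [e1]
    calc _ = 128 * C * C' * ((1 + t) ^ d * Real.exp (-(lowerIndex A / 2 * t))) *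
          Real.exp (lowerIndex A / 2 * s) * Real.exp (-(lowerIndex A / 2 * (t - s))) := by ring
      _ ≤ 128 * C * C' * C₂ *
          Real.exp (lowerIndex A / 2 * s) * Real.exp (-(lowerIndex A / 2 * (t - s))) := by gcongr
  -- `ρ t < 1 / 4` keeps the doubled ball inside radius `1 / 2`; the second condition makes the
  -- Lipschitz constant of the perturbation less than `1`.
  obtain ⟨t, ht1, ht2, hst⟩ := ((hlim1.eventually (gt_mem_nhds (show (0 : ℝ) < 1 / 4 by norm_num))).and
    ((hlim2.eventually (gt_mem_nhds one_pos)).and (eventually_ge_atTop s))).exists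
  have ht0 : 0 ≤ t := hs.trans hst
  refine transition_injOn hA hh hs hst hz₁ hz₂ ?_
  have hv : ∀ z, ‖z‖ ≤ r → ‖transition h s t z‖ ≤ ρ t := fun z hz => by
    refine (hdec s t hs hst z hz).trans ?_
    have := (hρ0 t).le
    nlinarith
  have hv₁ := hv z₁ ((le_max_left _ _).trans hr₁.le)
  have hv₂ := hv z₂ ((le_max_right _ _).trans hr₁.le)
  set g : Cn n → Cn n := fun z => expOp A (-t) (chain A h F N z t) with hg
  have hgd : DifferentiableOn ℂ g (unitBall n) :=
    differentiableOn_expOp_comp (differentiableOn_chain hA hh hF hN ht0) (-t)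
  obtain ⟨hc0, hc1⟩ := chain_zero_and_fderiv hA hh hF hN hN2 hF0 hF1 ht0
  have hg0 : g 0 = 0 := by rw [hg]; simp only; rw [hc0, map_zero]
  have hg1 : fderiv ℂ g 0 = ContinuousLinearMap.id ℂ (Cn n) := by
    ext1 z
    rw [← taylorTerm_one_apply g]
    have : taylorTerm g 1 = idPoly n := (coeffF_chain hA hh hF hN ht0 (by omega)).trans (hF1 t)
    rw [this]
    rfl
  set q : Cn n → Cn n := fun z => g z - z with hq
  have hqd : DifferentiableOn ℂ q (unitBall n) := hgd.fun_sub differentiableOn_id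
  have hqle : ∀ z, ‖z‖ < 2 * ρ t → ‖q z‖ ≤ C * (1 + t) ^ d * 64 * ρ t ^ 2 := fun z hz => by
    have hz2 : ‖z‖ < 1 / 2 := by linarith
    have := norm_sub_sub_fderiv_le (f := g) (c := 0) (r := 1 / 2) (M := C * (1 + t) ^ d)
      (by norm_num) (hgd.mono fun x hx => mem_unitBall.2 (by
        rw [mem_ball_zero_iff] at hx; linarith))
      (fun x hx => hb t ht0 x (mem_ball_zero_iff.1 hx).le) (mem_ball_zero_iff.2 hz2)
    rw [hg0, hg1, sub_zero, sub_zero] at this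
    have hz' : (‖z‖ / (1 / 2)) ^ 2 ≤ 16 * ρ t ^ 2 := by
      have : ‖z‖ / (1 / 2) ≤ 4 * ρ t := by linarith
      calc _ ≤ (4 * ρ t) ^ 2 := by gcongr
        _ = _ := by ring
    calc ‖q z‖ ≤ 4 * (C * (1 + t) ^ d) * (‖z‖ / (1 / 2)) ^ 2 := this
      _ ≤ 4 * (C * (1 + t) ^ d) * (16 * ρ t ^ 2) := by gcongr
      _ = _ := by ring
  have hlip := norm_sub_le_of_bounded hqd (r := ρ t) (r' := 2 * ρ t) (by linarith [hρ0 t])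
    (by linarith) hqle hv₁ hv₂
  have heq' : g (transition h s t z₁) = g (transition h s t z₂) := by
    rw [hg]
    simp only
    rw [← chain_transition hA hh hF hN hs hst hz₁, ← chain_transition hA hh hF hN hs hst hz₂]
    exact congrArg _ heq
  have e2 : 2 * (C * (1 + t) ^ d * 64 * ρ t ^ 2) / (2 * ρ t - ρ t) =
      128 * C * (1 + t) ^ d * ρ t := by
    have := (hρ0 t).ne'
    field_simp
    ring
  rw [e2] at hlip
  -- Equal values of `g = id + q` mean that `q` reproduces the distance of the two points,
  -- impossible for a strict contraction unless they coincide.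
  have e3 : q (transition h s t z₁) - q (transition h s t z₂) =
      -(transition h s t z₁ - transition h s t z₂) := by
    rw [hq]; simp only; rw [heq']; abel
  rw [e3, norm_neg] at hlip
  by_contra hne
  have hpos : 0 < ‖transition h s t z₁ - transition h s t z₂‖ := norm_pos_iff.2 (sub_ne_zero.2 hne)
  nlinarith

theorem isLoewnerChain_chain (hA : 0 < lowerIndex A) (hh : IsGenerator A h)
    (hF : ∀ j < N, IsCoeff A h p F j) (hN : upperIndex A < N * lowerIndex A) (hN2 : 2 ≤ N)
    (hF0 : ∀ t, F 0 t = 0) (hF1 : ∀ t, F 1 t = idPoly n) : IsLoewnerChain (chain A h F N) where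
  holomorphic _ ht := differentiableOn_chain hA hh hF hN ht
  injective _ ht := injOn_chain hA hh hF hN hN2 hF0 hF1 ht
  subordinate s t hs hst := ⟨transition h s t, differentiableOn_transition hA hh hs hst,
    fun _ hz => transition_mem hA hh hs hst hz, transition_zero hA hh hs hst,
    fun _ hz => chain_transition hA hh hF hN hs hst hz⟩

end Chain

/-! ### From flow invariance to the Loewner equation -/

section ChainEquation

variable {n : ℕ} {A : Cn n →L[ℂ] Cn n} {h : Cn n → ℝ → Cn n}

theorem locallyIntegrable_generator (hA : 0 < lowerIndex A) (hh : IsGenerator A h) {z : Cn n}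
    (hz : z ∈ unitBall n) : LocallyIntegrable ((Ici (0 : ℝ)).indicator (h z)) volume := by
  obtain ⟨C, hC, hCb⟩ := exists_bound_isInN hA (mem_unitBall.1 hz)
  refine (locallyIntegrable_const C).mono ?_ (ae_of_all _ fun t => ?_)
  · exact (aestronglyMeasurable_indicator_iff measurableSet_Ici).2
      (hh.measurable z hz).aestronglyMeasurable
  · rw [Real.norm_of_nonneg hC]
    rcases le_or_gt 0 t with ht | ht
    · rw [indicator_of_mem (mem_Ici.2 ht)]
      exact hCb _ (hh.mem_N t ht) z le_rfl
    · rw [indicator_of_notMem (by simpa using ht), norm_zero]; exact hC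

theorem ae_hasDerivAt_integral_generator (hA : 0 < lowerIndex A) (hh : IsGenerator A h) {z : Cn n}
    (hz : z ∈ unitBall n) :
    ∀ᵐ t, 0 < t → HasDerivAt (fun y => ∫ x in 0..y, h z x) (h z t) t := by
  filter_upwards [LocallyIntegrable.ae_hasDerivAt_integral (locallyIntegrable_generator hA hh hz)]
    with t ht ht0
  have h1 := ht 0
  rw [indicator_of_mem (mem_Ici.2 ht0.le)] at h1
  refine h1.congr_of_eventuallyEq ?_
  filter_upwards [lt_mem_nhds ht0] with y hy
  refine intervalIntegral.integral_congr fun x hx => ?_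
  rw [uIcc_of_le hy.le] at hx
  exact (indicator_of_mem (mem_Ici.2 hx.1) _).symm

/-- Almost every `t` is a Lebesgue point of all `h z`, `z ∈ Bⁿ`. -/
theorem ae_forall_hasDerivAt_integral_generator (hA : 0 < lowerIndex A) (hh : IsGenerator A h) :
    ∀ᵐ t, 0 < t → ∀ z ∈ unitBall n,
      HasDerivAt (fun y => ∫ x in 0..y, h z x) (h z t) t := by
  obtain ⟨D, hDc, hDd⟩ := TopologicalSpace.exists_countable_dense (Cn n)
  have h1 : ∀ᵐ t, ∀ z ∈ D, z ∈ unitBall n → 0 < t →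
      HasDerivAt (fun y => ∫ x in 0..y, h z x) (h z t) t := by
    refine (ae_ball_iff hDc).2 fun z _ => ?_
    by_cases hz : z ∈ unitBall n
    · filter_upwards [ae_hasDerivAt_integral_generator hA hh hz] with t ht _ using ht
    · exact ae_of_all _ fun t h => absurd h hz
  filter_upwards [h1] with t ht ht0 z hz
  obtain ⟨r, hzr, hr⟩ := exists_between (mem_unitBall.1 hz)
  obtain ⟨L, hL, hLb⟩ := exists_lipschitz_isInN hA hr
  rw [hasDerivAt_iff_isLittleO, Asymptotics.isLittleO_iff]
  intro ε hε
  -- Lebesgue points are known on a countable dense set; the Lipschitz bound uniform in time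
  -- transfers the property to `z`, each of three errors costing `ε / 3`.
  obtain ⟨z', hz'D, hz'⟩ := hDd.exists_dist_lt z
    (show 0 < min (r - ‖z‖) (ε / (3 * (L + 1))) from
      lt_min (sub_pos.2 hzr) (by positivity))
  rw [dist_eq_norm, lt_min_iff] at hz'
  have hz'r : ‖z'‖ ≤ r := by
    have := norm_le_norm_add_norm_sub' z' z
    rw [norm_sub_rev] at this
    linarith [hz'.1]
  have hLz : L * ‖z - z'‖ ≤ ε / 3 := by
    have h2 := hz'.2
    rw [lt_div_iff₀ (by positivity)] at h2
    nlinarith [norm_nonneg (z - z')]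
  have hz'b : z' ∈ unitBall n := mem_unitBall.2 (hz'r.trans_lt hr)
  have h2 := ht z' hz'D hz'b ht0
  rw [hasDerivAt_iff_isLittleO, Asymptotics.isLittleO_iff] at h2
  filter_upwards [h2 (show 0 < ε / 3 by positivity), lt_mem_nhds ht0] with y hy hy0
  have hi : ∀ w ∈ unitBall n, (∫ x in 0..y, h w x) - ∫ x in 0..t, h w x = ∫ x in t..y, h w x :=
    fun w hw => intervalIntegral.integral_interval_sub_left
      (intervalIntegrable_generator hA hh hw le_rfl hy0.le)
      (intervalIntegrable_generator hA hh hw le_rfl ht0.le)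
  rw [hi z' hz'b] at hy
  rw [hi z hz]
  have hd : ‖(∫ x in t..y, h z x) - ∫ x in t..y, h z' x‖ ≤ ε / 3 * |y - t| := by
    rw [← intervalIntegral.integral_sub (intervalIntegrable_generator hA hh hz ht0.le hy0.le)
      (intervalIntegrable_generator hA hh hz'b ht0.le hy0.le)]
    refine intervalIntegral.norm_integral_le_of_norm_le_const fun x hx => ?_
    have hx0 : 0 ≤ x := (le_min ht0.le hy0.le).trans hx.1.le
    exact (hLb _ (hh.mem_N x hx0) z z' hzr.le hz'r).trans hLz
  have hd' : ‖(y - t) • h z' t - (y - t) • h z t‖ ≤ ε / 3 * |y - t| := by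
    rw [← smul_sub, norm_smul, Real.norm_eq_abs, mul_comm, norm_sub_rev]
    exact mul_le_mul_of_nonneg_right
      ((hLb _ (hh.mem_N t ht0.le) z z' hzr.le hz'r).trans hLz) (abs_nonneg _)
  have e : (∫ x in t..y, h z x) - (y - t) • h z t =
      ((∫ x in t..y, h z x) - ∫ x in t..y, h z' x) +
      ((∫ x in t..y, h z' x) - (y - t) • h z' t) + ((y - t) • h z' t - (y - t) • h z t) := by abel
  rw [e]
  refine (norm_add₃_le).trans ?_
  rw [Real.norm_eq_abs] at hy ⊢
  linarith

variable {f : Cn n → ℝ → Cn n}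

/-- Since `f(z, s) = f(v_{s,t}(z), t)`, a difference in time is a difference in space at the single
time `t`. -/
theorem exists_lipschitz_of_subordinate (hA : 0 < lowerIndex A) (hh : IsGenerator A h)
    (hf : ∀ t, 0 ≤ t → DifferentiableOn ℂ (fun z => f z t) (unitBall n))
    (hsub : ∀ s t, 0 ≤ s → s ≤ t → ∀ z ∈ unitBall n, f z s = f (transition h s t z) t)
    (hb : ∀ r < 1, ∀ T, ∃ M, 0 ≤ M ∧ ∀ t, 0 ≤ t → t ≤ T → ∀ z, ‖z‖ ≤ r → ‖f z t‖ ≤ M)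
    {r : ℝ} (hr : r < 1) (T : ℝ) :
    ∃ L, 0 ≤ L ∧ ∀ s t, 0 ≤ s → s ≤ t → t ≤ T → ∀ z, ‖z‖ ≤ r →
      ‖f z t - f z s‖ ≤ L * (t - s) := by
  obtain ⟨r', hrr', hr'⟩ := exists_between hr
  obtain ⟨M, hM, hMb⟩ := hb r' hr' T
  obtain ⟨C, hC, hCb⟩ := exists_norm_transition_sub_le hA hh hr
  have hpos : 0 < r' - r := sub_pos.2 hrr'
  refine ⟨2 * M / (r' - r) * C, by positivity, fun s t hs hst htT z hz => ?_⟩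
  have hzb : z ∈ unitBall n := mem_unitBall.2 (hz.trans_lt hr)
  rw [hsub s t hs hst z hzb]
  have h1 := norm_sub_le_of_bounded (hf t (hs.trans hst)) hrr' hr'.le
    (fun w hw => hMb t (hs.trans hst) htT w hw.le) hz
    ((norm_transition_le hA hh hs hst hzb).trans hz)
  have h2 := hCb s t hs hst z hz
  rw [norm_sub_rev] at h2
  refine h1.trans ?_
  rw [mul_assoc]
  gcongr

theorem exists_norm_le_of_isCompact {K : Set (Cn n)} (hK : IsCompact K) (hKb : K ⊆ unitBall n) :
    ∃ r < 1, ∀ z ∈ K, ‖z‖ ≤ r := by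
  rcases K.eq_empty_or_nonempty with rfl | hne
  · exact ⟨0, one_pos, by simp⟩
  · obtain ⟨w, hw, hmax⟩ := hK.exists_isMaxOn hne continuous_norm.continuousOn
    exact ⟨‖w‖, mem_unitBall.1 (hKb hw), fun z hz => hmax hz⟩

theorem locallyAC_of_lipschitz
    (hL : ∀ r < 1, ∀ T, ∃ L, 0 ≤ L ∧ ∀ s t, 0 ≤ s → s ≤ t → t ≤ T → ∀ z, ‖z‖ ≤ r →
      ‖f z t - f z s‖ ≤ L * (t - s)) : LocallyAC f := by
  intro K hK hKb T hT ε hε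
  obtain ⟨r, hr, hKr⟩ := exists_norm_le_of_isCompact hK hKb
  obtain ⟨L, hL0, hLb⟩ := hL r hr T
  refine ⟨ε / (L + 1), by positivity, fun z hz I hI hlt => ?_⟩
  have hd : ∀ a ∈ uIcc 0 T, ∀ b ∈ uIcc 0 T, dist (f z a) (f z b) ≤ L * dist a b := by
    rw [uIcc_of_le hT]
    intro a ha b hb
    rcases le_total a b with hab | hab
    · have := hLb a b ha.1 hab hb.2 z (hKr z hz)
      rw [dist_comm, dist_comm a, dist_eq_norm, Real.dist_eq, abs_of_nonneg (sub_nonneg.2 hab)]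
      exact this
    · have := hLb b a hb.1 hab ha.2 z (hKr z hz)
      rw [dist_eq_norm, Real.dist_eq, abs_of_nonneg (sub_nonneg.2 hab)]
      exact this
  have h1 : ∑ i ∈ Finset.range I.1, dist (f z (I.2 i).1) (f z (I.2 i).2) ≤
      L * ∑ i ∈ Finset.range I.1, dist (I.2 i).1 (I.2 i).2 := by
    rw [Finset.mul_sum]
    exact Finset.sum_le_sum fun i hi => hd _ (hI.1 i hi).1 _ (hI.1 i hi).2
  rw [lt_div_iff₀ (by positivity)] at hlt
  have h2 : 0 ≤ ∑ i ∈ Finset.range I.1, dist (I.2 i).1 (I.2 i).2 :=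
    Finset.sum_nonneg fun i _ => dist_nonneg
  nlinarith

theorem hasDerivAt_of_norm_sub_le_sq {E : Type*} [NormedAddCommGroup E] [NormedSpace ℝ E]
    {u : ℝ → E} {t C : ℝ} (hu : ∀ᶠ y in 𝓝 t, ‖u y - u t‖ ≤ C * (y - t) ^ 2) :
    HasDerivAt u 0 t := by
  have h1 : (fun y => u y - u t) =O[𝓝 t] fun y => ‖y - t‖ ^ 2 := by
    refine Asymptotics.IsBigO.of_bound C (hu.mono fun y hy => ?_)
    simpa using hy
  have h2 := (h1.hasFDerivAt (by norm_num)).hasDerivAt.add_const (u t)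
  simpa using h2

/-- Second order expansion of `f(v_{s,y}(z), y)` around `z`, combined with `v_{s,y}(z) = z - ∫ h(z,
·) + O((y - s)²)`. -/
theorem exists_norm_sub_sub_integral_le (hA : 0 < lowerIndex A) (hh : IsGenerator A h)
    (hf : ∀ t, 0 ≤ t → DifferentiableOn ℂ (fun z => f z t) (unitBall n))
    (hsub : ∀ s t, 0 ≤ s → s ≤ t → ∀ z ∈ unitBall n, f z s = f (transition h s t z) t)
    (hb : ∀ r < 1, ∀ T, ∃ M, 0 ≤ M ∧ ∀ t, 0 ≤ t → t ≤ T → ∀ z, ‖z‖ ≤ r → ‖f z t‖ ≤ M)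
    {t : ℝ} (ht : 0 < t) {z : Cn n} (hz : z ∈ unitBall n) :
    ∃ C, ∀ᶠ y in 𝓝 t,
      ‖f z y - f z t - fderiv ℂ (fun w => f w t) z (∫ x in t..y, h z x)‖ ≤ C * (y - t) ^ 2 := by
  obtain ⟨r, hzr, hr⟩ := exists_between (mem_unitBall.1 hz)
  obtain ⟨M, hM, hMb⟩ := hb r hr (t + 1)
  obtain ⟨L, hL, hLb⟩ := exists_lipschitz_of_subordinate hA hh hf hsub hb hr (t + 1)
  obtain ⟨C₁, hC₁, h₁⟩ := exists_norm_transition_sub_le hA hh hr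
  obtain ⟨C₂, hC₂, h₂⟩ := exists_norm_transition_sub_integral_le hA hh hr
  obtain ⟨C₃, hC₃, h₃⟩ := exists_bound_isInN hA hr
  set ρ := r - ‖z‖ with hρ
  have hρ0 : 0 < ρ := sub_pos.2 hzr
  have hball : ∀ w ∈ ball z ρ, ‖w‖ < r := fun w hw => by
    rw [mem_ball, dist_eq_norm] at hw
    have := norm_le_norm_add_norm_sub' w z
    linarith
  have hsubs : ball z ρ ⊆ unitBall n := fun w hw => mem_unitBall.2 ((hball w hw).trans hr)
  have step : ∀ s y, 0 ≤ s → s ≤ y → y ≤ t + 1 → C₁ * (y - s) < ρ →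
      ‖f z s - f z y + fderiv ℂ (fun w => f w y) z (∫ x in s..y, h z x)‖ ≤
        (4 * M * (C₁ / ρ) ^ 2 + 2 * M / ρ * C₂) * (y - s) ^ 2 := fun s y hs hsy hyT hlt => by
    have hy0 := hs.trans hsy
    have hv := h₁ s y hs hsy z hzr.le
    have hvb : transition h s y z ∈ ball z ρ := by
      rw [mem_ball, dist_eq_norm]; linarith
    have q1 := norm_sub_sub_fderiv_le hρ0 ((hf y hy0).mono hsubs)
      (fun w hw => hMb y hy0 hyT w (hball w hw).le) hvb
    have q2 := norm_fderiv_le_of_bounded hρ0 ((hf y hy0).mono hsubs)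
      (fun w hw => hMb y hy0 hyT w (hball w hw).le)
    have q3 := h₂ s y hs hsy z hzr.le
    have e : f z s - f z y + fderiv ℂ (fun w => f w y) z (∫ x in s..y, h z x) =
        (f (transition h s y z) y - f z y -
          fderiv ℂ (fun w => f w y) z (transition h s y z - z)) +
        fderiv ℂ (fun w => f w y) z (transition h s y z - z + ∫ x in s..y, h z x) := by
      rw [hsub s y hs hsy z hz, map_add]; abel
    rw [e]
    have hys : 0 ≤ y - s := sub_nonneg.2 hsy
    calc _ ≤ 4 * M * (‖transition h s y z - z‖ / ρ) ^ 2 +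
          2 * M / ρ * (C₂ * (y - s) ^ 2) := by
          refine (norm_add_le _ _).trans (add_le_add q1 ?_)
          refine (ContinuousLinearMap.le_opNorm _ _).trans ?_
          gcongr
      _ ≤ 4 * M * (C₁ * (y - s) / ρ) ^ 2 + 2 * M / ρ * (C₂ * (y - s) ^ 2) := by gcongr
      _ = _ := by ring
  refine ⟨(4 * M * (C₁ / ρ) ^ 2 + 2 * M / ρ * C₂) + 2 * L / ρ * C₃, ?_⟩
  have hev : ∀ᶠ y in 𝓝 t, C₁ * |y - t| < ρ := by
    have : Tendsto (fun y : ℝ => C₁ * |y - t|) (𝓝 t) (𝓝 (C₁ * |t - t|)) :=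
      Continuous.tendsto (by fun_prop) t
    refine this.eventually (gt_mem_nhds ?_)
    simpa using hρ0
  filter_upwards [hev, lt_mem_nhds ht, gt_mem_nhds (show t < t + 1 by linarith)]
    with y hy hy0 hy1
  have hpos : 0 ≤ 2 * L / ρ * C₃ * (y - t) ^ 2 := by positivity
  have hpos' : 0 ≤ (4 * M * (C₁ / ρ) ^ 2 + 2 * M / ρ * C₂) * (y - t) ^ 2 := by positivity
  rcases le_total y t with hyt | hyt
  · rw [abs_of_nonpos (sub_nonpos.2 hyt), neg_sub] at hy
    have := step y t hy0.le hyt (by linarith) hy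
    rw [intervalIntegral.integral_symm, map_neg, sub_neg_eq_add]
    have e : (t - y) ^ 2 = (y - t) ^ 2 := by ring
    rw [e] at this
    linarith
  · have hyt0 : 0 ≤ y - t := sub_nonneg.2 hyt
    rw [abs_of_nonneg hyt0] at hy
    have q1 := step t y ht.le hyt hy1.le hy
    -- For `y > t` the expansion produces the derivative at time `y`. Cauchy's estimate applied to
    -- the Lipschitz bound in time moves it to `t` at the cost of another second order term.
    have q2 : ‖fderiv ℂ (fun w => f w y) z - fderiv ℂ (fun w => f w t) z‖ ≤
        2 * (L * (y - t)) / ρ := by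
      have hzn : unitBall n ∈ 𝓝 z := isOpen_unitBall.mem_nhds hz
      have d1 := (hf y hy0.le).differentiableAt hzn
      have d2 := (hf t ht.le).differentiableAt hzn
      have := norm_fderiv_le_of_bounded (f := fun w => f w y - f w t) hρ0
        (((hf y hy0.le).mono hsubs).fun_sub ((hf t ht.le).mono hsubs))
        (fun w hw => hLb t y ht.le hyt hy1.le w (hball w hw).le)
      rwa [fderiv_fun_sub d1 d2] at this
    have q3 : ‖∫ x in t..y, h z x‖ ≤ C₃ * (y - t) := by
      have := intervalIntegral.norm_integral_le_of_norm_le_const (a := t) (b := y) (f := h z)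
        (C := C₃) (fun x hx => h₃ _ (hh.mem_N x (by
          rw [uIoc_of_le hyt] at hx; exact ht.le.trans hx.1.le)) z hzr.le)
      rwa [abs_of_nonneg hyt0] at this
    have e : f z y - f z t - fderiv ℂ (fun w => f w t) z (∫ x in t..y, h z x) =
        -(f z t - f z y + fderiv ℂ (fun w => f w y) z (∫ x in t..y, h z x)) +
        (fderiv ℂ (fun w => f w y) z - fderiv ℂ (fun w => f w t) z) (∫ x in t..y, h z x) := by
      rw [sub_apply]; abel
    rw [e]
    refine (norm_add_le _ _).trans ?_
    rw [norm_neg, add_mul]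
    refine add_le_add q1 ((ContinuousLinearMap.le_opNorm _ _).trans ?_)
    calc _ ≤ 2 * (L * (y - t)) / ρ * (C₃ * (y - t)) := by gcongr
      _ = _ := by ring

/-- At a common Lebesgue point of all `h z` the integral in the second order expansion can be
differentiated. -/
theorem ae_equation_of_subordinate (hA : 0 < lowerIndex A) (hh : IsGenerator A h)
    (hf : ∀ t, 0 ≤ t → DifferentiableOn ℂ (fun z => f z t) (unitBall n))
    (hsub : ∀ s t, 0 ≤ s → s ≤ t → ∀ z ∈ unitBall n, f z s = f (transition h s t z) t)
    (hb : ∀ r < 1, ∀ T, ∃ M, 0 ≤ M ∧ ∀ t, 0 ≤ t → t ≤ T → ∀ z, ‖z‖ ≤ r → ‖f z t‖ ≤ M) :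
    ∀ᵐ t ∂(volume.restrict (Ici (0 : ℝ))), ∀ z ∈ unitBall n,
      HasDerivAt (f z) (fderiv ℂ (fun w => f w t) z (h z t)) t := by
  -- The endpoint `0` is a null set and is dropped, because the derivative is two-sided.
  rw [Measure.restrict_congr_set Ioi_ae_eq_Ici.symm, ae_restrict_iff' measurableSet_Ioi]
  filter_upwards [ae_forall_hasDerivAt_integral_generator hA hh] with t ht ht0 z hz
  have ht0 : 0 < t := ht0
  obtain ⟨C, hC⟩ := exists_norm_sub_sub_integral_le hA hh hf hsub hb ht0 hz
  set D := fderiv ℂ (fun w => f w t) z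
  have h1 : HasDerivAt (fun y => D (∫ x in 0..y, h z x)) (D (h z t)) t :=
    (D.restrictScalars ℝ).hasFDerivAt.comp_hasDerivAt t (ht ht0 z hz)
  have h2 : HasDerivAt (fun y => f z y - D (∫ x in 0..y, h z x)) 0 t := by
    refine hasDerivAt_of_norm_sub_le_sq (C := C) ?_
    filter_upwards [hC, lt_mem_nhds ht0] with y hy hy0
    have e : f z y - D (∫ x in 0..y, h z x) - (f z t - D (∫ x in 0..t, h z x)) =
        f z y - f z t - D (∫ x in t..y, h z x) := by
      rw [← intervalIntegral.integral_interval_sub_left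
        (intervalIntegrable_generator hA hh hz le_rfl hy0.le)
        (intervalIntegrable_generator hA hh hz le_rfl ht0.le), map_sub]
      abel
    rw [e]
    exact hy
  have h3 := h2.add h1
  simp only [zero_add] at h3
  refine h3.congr_of_eventuallyEq (Eventually.of_forall fun y => ?_)
  simp

end ChainEquation

/-! ### Coefficients of an arbitrary solution, and uniqueness -/

section Uniqueness

variable {n : ℕ} {A : Cn n →L[ℂ] Cn n} {h f g : Cn n → ℝ → Cn n}

theorem polyB_eval (C : ℝ) (P : ℝ[X]) : PolyB False (fun t => C * P.eval t) := by
  have h1 : PolyB False (fun t => ∑ i ∈ Finset.range (P.natDegree + 1), |P.coeff i| * t ^ i) :=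
    PolyB.sum _ fun i _ => ⟨|P.coeff i|, i, abs_nonneg _, False.elim, fun t ht =>
      mul_le_mul_of_nonneg_left (pow_le_pow_left₀ ht (by linarith) i) (abs_nonneg _)⟩
  refine (h1.const_mul (abs_nonneg C)).mono fun t ht => ?_
  refine (le_abs_self _).trans ?_
  rw [abs_mul, Polynomial.eval_eq_sum_range]
  refine mul_le_mul_of_nonneg_left ((Finset.abs_sum_le_sum_abs _ _).trans
    (Finset.sum_le_sum fun i _ => ?_)) (abs_nonneg C)
  rw [abs_mul, abs_of_nonneg (pow_nonneg ht i)]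

theorem PolynomiallyBounded.exists_bound (hg : PolynomiallyBounded A g) {r : ℝ} (hr : r < 1) :
    ∃ (C : ℝ) (d : ℕ), 0 ≤ C ∧ ∀ t, 0 ≤ t → ∀ z, ‖z‖ ≤ r →
      ‖expOp A (-t) (g z t)‖ ≤ C * (1 + t) ^ d := by
  obtain ⟨C, P, hCP⟩ := hg (closedBall 0 r) (isCompact_closedBall 0 r) (closedBall_subset_ball hr)
  obtain ⟨C', d, hC', -, hb⟩ := polyB_eval C P
  exact ⟨C', d, hC', fun t ht z hz =>
    (hCP z (mem_closedBall_zero_iff.2 hz) t ht).trans (hb t ht)⟩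

theorem exists_bound_of_expOp_neg {r C : ℝ} {d : ℕ} (hC : 0 ≤ C)
    (hb : ∀ t, 0 ≤ t → ∀ z, ‖z‖ ≤ r → ‖expOp A (-t) (g z t)‖ ≤ C * (1 + t) ^ d) (T : ℝ) :
    ∃ M, 0 ≤ M ∧ ∀ t, 0 ≤ t → t ≤ T → ∀ z, ‖z‖ ≤ r → ‖g z t‖ ≤ M := by
  obtain ⟨B, hB⟩ := (isCompact_Icc (a := (0 : ℝ)) (b := T)).exists_bound_of_continuousOn
    (continuous_expL A).continuousOn
  refine ⟨|B| * (C * (1 + |T|) ^ d), by positivity, fun t ht htT z hz => ?_⟩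
  rw [← expOp_expOp_neg A t (g z t)]
  refine ((expOp A t).le_opNorm _).trans ?_
  have h1 : ‖expOp A t‖ ≤ |B| := (hB t ⟨ht, htT⟩).trans (le_abs_self B)
  have h2 := hb t ht z hz
  have h3 : t ≤ |T| := htT.trans (le_abs_self T)
  gcongr
  exact h2.trans (by gcongr)

theorem LocallyAC.absolutelyContinuous (hg : LocallyAC g) {z : Cn n} (hz : z ∈ unitBall n)
    {s t : ℝ} (hs : 0 ≤ s) (hst : s ≤ t) : AbsolutelyContinuousOnInterval (g z) s t := by
  rw [absolutelyContinuousOnInterval_iff]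
  intro ε hε
  obtain ⟨δ, hδ, hb⟩ := hg {z} isCompact_singleton (by simpa using hz) t (hs.trans hst) ε hε
  refine ⟨δ, hδ, fun I hI => hb z rfl I (AbsolutelyContinuousOnInterval.disjWithin_mono ?_ hI)⟩
  rw [uIcc_of_le hst, uIcc_of_le (hs.trans hst)]
  exact Icc_subset_Icc_left hs

/-- Local boundedness and Cauchy's estimate bound `Df h`, and absolute continuity integrates this
bound. -/
theorem exists_lipschitz_of_isSolution (hA : 0 < lowerIndex A) (hh : IsGenerator A h)
    (hg : IsSolution h g)
    (hb : ∀ r < 1, ∀ T, ∃ M, 0 ≤ M ∧ ∀ t, 0 ≤ t → t ≤ T → ∀ z, ‖z‖ ≤ r → ‖g z t‖ ≤ M)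
    {r : ℝ} (hr : r < 1) (T : ℝ) :
    ∃ L, 0 ≤ L ∧ ∀ s t, 0 ≤ s → s ≤ t → t ≤ T → ∀ z, ‖z‖ ≤ r →
      ‖g z t - g z s‖ ≤ L * (t - s) := by
  obtain ⟨r', hrr', hr'⟩ := exists_between hr
  obtain ⟨M, hM, hMb⟩ := hb r' hr' T
  obtain ⟨C, hC, hCb⟩ := exists_bound_isInN hA hr
  have hpos : 0 < r' - r := sub_pos.2 hrr'
  refine ⟨2 * M / (r' - r) * C, by positivity, fun s t hs hst htT z hz => ?_⟩
  have hzb : z ∈ unitBall n := mem_unitBall.2 (hz.trans_lt hr)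
  have hball : ∀ w ∈ ball z (r' - r), ‖w‖ < r' := fun w hw => by
    rw [mem_ball, dist_eq_norm] at hw
    have := norm_le_norm_add_norm_sub' w z
    linarith
  have heq := hg.equation
  rw [ae_restrict_iff' measurableSet_Ici] at heq
  have := norm_sub_le_of_ae_hasDerivAt (u := g z)
    (u' := fun x => fderiv ℂ (fun w => g w x) z (h z x))
    (B := fun x => 2 * M / (r' - r) * C * x) (B' := fun _ => 2 * M / (r' - r) * C) hst
    (hg.locallyAC.absolutelyContinuous hzb hs hst)
    ((LipOn.of_contDiff (by fun_prop) s t).absolutelyContinuous hst) (by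
      filter_upwards [heq] with x hx hxst
      have hx0 : 0 ≤ x := hs.trans hxst.1.le
      refine ⟨hx hx0 z hzb, by simpa using (hasDerivAt_id x).const_mul (2 * M / (r' - r) * C), ?_⟩
      refine (ContinuousLinearMap.le_opNorm _ _).trans ?_
      have h1 := norm_fderiv_le_of_bounded hpos ((hg.holomorphic x hx0).mono fun w hw =>
        mem_unitBall.2 ((hball w hw).trans hr'))
        (fun w hw => hMb x hx0 (hxst.2.le.trans htT) w (hball w hw).le)
      have h2 := hCb _ (hh.mem_N x hx0) z hz
      gcongr)
  rw [mul_sub]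
  exact this

theorem taylorTerm_const_smul {g : Cn n → Cn n} (hg : DifferentiableOn ℂ g (unitBall n)) (c : ℂ)
    (k : ℕ) : taylorTerm (fun z => c • g z) k = c • taylorTerm g k := by
  ext1
  funext z
  exact taylorTerm_clm hg (c • ContinuousLinearMap.id ℂ (Cn n)) k z

theorem exists_lipschitz_expOp_neg (hA : 0 < lowerIndex A) (hh : IsGenerator A h)
    (hg : IsSolution h g)
    (hb : ∀ r < 1, ∀ T, ∃ M, 0 ≤ M ∧ ∀ t, 0 ≤ t → t ≤ T → ∀ z, ‖z‖ ≤ r → ‖g z t‖ ≤ M)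
    {r : ℝ} (hr : r < 1) (T : ℝ) :
    ∃ L, 0 ≤ L ∧ ∀ s t, 0 ≤ s → s ≤ t → t ≤ T → ∀ z, ‖z‖ ≤ r →
      ‖expOp A (-t) (g z t) - expOp A (-s) (g z s)‖ ≤ L * (t - s) := by
  obtain ⟨M, hM, hMb⟩ := hb r hr T
  obtain ⟨L, hL, hLb⟩ := exists_lipschitz_of_isSolution hA hh hg hb hr T
  obtain ⟨B, hB⟩ := (isCompact_Icc (a := (0 : ℝ)) (b := T)).exists_bound_of_continuousOn
    ((continuous_expL A).comp continuous_neg).continuousOn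
  obtain ⟨K, hK⟩ := LipOn.of_contDiff ((contDiff_expL A).comp contDiff_neg) 0 T
  refine ⟨|B| * L + K * M, by positivity, fun s t hs hst htT z hz => ?_⟩
  have e : expOp A (-t) (g z t) - expOp A (-s) (g z s) =
      expOp A (-t) (g z t - g z s) + (expOp A (-t) - expOp A (-s)) (g z s) := by
    rw [map_sub, sub_apply]; abel
  have ht0 := hs.trans hst
  have h1 : ‖expOp A (-t)‖ ≤ |B| := (hB t ⟨ht0, htT⟩).trans (le_abs_self B)
  have h2 := hLb s t hs hst htT z hz
  have h3 : ‖expOp A (-t) - expOp A (-s)‖ ≤ K * (t - s) := by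
    have := hK.dist_le_mul t ⟨ht0, htT⟩ s ⟨hs, hst.trans htT⟩
    rw [dist_eq_norm, Real.dist_eq, abs_of_nonneg (sub_nonneg.2 hst)] at this
    exact this
  have h4 := hMb s hs (hst.trans htT) z hz
  have h5 : 0 ≤ t - s := sub_nonneg.2 hst
  rw [e]
  calc _ ≤ ‖expOp A (-t)‖ * ‖g z t - g z s‖ + ‖expOp A (-t) - expOp A (-s)‖ * ‖g z s‖ :=
        (norm_add_le _ _).trans (add_le_add (ContinuousLinearMap.le_opNorm _ _)
          (ContinuousLinearMap.le_opNorm _ _))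
    _ ≤ |B| * (L * (t - s)) + K * (t - s) * M := by gcongr
    _ = _ := by ring

theorem lipOn_coeffF (hA : 0 < lowerIndex A) (hh : IsGenerator A h)
    (hg : IsSolution h g)
    (hb : ∀ r < 1, ∀ T, ∃ M, 0 ≤ M ∧ ∀ t, 0 ≤ t → t ≤ T → ∀ z, ‖z‖ ≤ r → ‖g z t‖ ≤ M)
    (k : ℕ) (z : Cn n) (T : ℝ) :
    LipOn (fun t => (coeffF A g k t : Cn n → Cn n) z) 0 T := by
  obtain ⟨L, hL, hLb⟩ := exists_lipschitz_expOp_neg hA hh hg hb (r := 1 / 2) (by norm_num) T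
  refine LipOn.of_dist_le (C := L * (‖z‖ / (1 / 2)) ^ k) fun x hx y hy hxy => ?_
  have d1 := differentiableOn_expOp_comp (A := A) (hg.holomorphic x hx.1) (-x)
  have d2 := differentiableOn_expOp_comp (A := A) (hg.holomorphic y hy.1) (-y)
  have h1 := norm_taylorTerm_le (d2.fun_sub d1) (r := 1 / 2) (by norm_num) (by norm_num)
    (fun w hw => hLb x y hx.1 hxy hy.2 w hw) k z
  rw [taylorTerm_sub d2 d1] at h1
  refine h1.trans_eq ?_
  ring

/-- Difference quotients of `e^{-tA} g` in time converge pointwise in `z` and stay bounded on a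
ball, so their homogeneous terms converge too; the limit is expanded by `taylorTerm_fderiv_apply`.
-/
theorem hasDerivAt_coeffF (hA : 0 < lowerIndex A) (hh : IsGenerator A h)
    (hg : IsSolution h g)
    (hb : ∀ r < 1, ∀ T, ∃ M, 0 ≤ M ∧ ∀ t, 0 ≤ t → t ≤ T → ∀ z, ‖z‖ ≤ r → ‖g z t‖ ≤ M)
    {t : ℝ} (ht : 0 < t)
    (heq : ∀ z ∈ unitBall n, HasDerivAt (g z) (fderiv ℂ (fun w => g w t) z (h z t)) t)
    (k : ℕ) (z : Cn n) :
    HasDerivAt (fun t => (coeffF A g k t : Cn n → Cn n) z)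
      ((coeffDeriv A h (coeffF A g) k t : Cn n → Cn n) z) t := by
  set G : ℝ → Cn n → Cn n := fun t z => expOp A (-t) (g z t) with hG
  have hGd : ∀ y, 0 ≤ y → DifferentiableOn ℂ (G y) (unitBall n) := fun y hy =>
    differentiableOn_expOp_comp (hg.holomorphic y hy) (-y)
  have hv := (hh.mem_N t ht.le).holomorphic
  have dD := differentiableOn_fderiv_apply (hGd t ht.le) hv
  have dA : DifferentiableOn ℂ (fun z => A (G t z)) (unitBall n) :=
    A.differentiable.comp_differentiableOn (hGd t ht.le)
  set E : Cn n → Cn n := fun z => fderiv ℂ (G t) z (h z t) - A (G t z) with hE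
  have hEd : DifferentiableOn ℂ E (unitBall n) := dD.fun_sub dA
  have hGE : ∀ w ∈ unitBall n, HasDerivAt (fun y => G y w) (E w) t := fun w hw => by
    refine (hasDerivAt_expL_neg_apply A (heq w hw)).congr_deriv ?_
    have hgw : DifferentiableAt ℂ (fun w => g w t) w :=
      (hg.holomorphic t ht.le).differentiableAt (isOpen_unitBall.mem_nhds hw)
    have e1 : fderiv ℂ (G t) w = (expOp A (-t)).comp (fderiv ℂ (fun w => g w t) w) :=
      ((expOp A (-t)).hasFDerivAt.comp w hgw.hasFDerivAt).fderiv
    rw [hE]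
    simp only
    rw [e1, map_sub, expL_apply_comm]
    rfl
  have hTE : (taylorTerm E k : Cn n → Cn n) z =
      (coeffDeriv A h (coeffF A g) k t : Cn n → Cn n) z := by
    rw [hE, taylorTerm_sub dD dA]
    have h2 := taylorTerm_fderiv_apply (hGd t ht.le) hv (hh.mem_N t ht.le).map_zero
      (hh.mem_N t ht.le).fderiv_zero k z
    simp only [Submodule.coe_sub, Pi.sub_apply, h2, taylorTerm_clm (hGd t ht.le),
      coeffDeriv, Submodule.coe_add, Pi.add_apply]
    rw [add_assoc, add_sub_cancel_left]
    rfl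
  rw [← hTE, hasDerivAt_iff_tendsto_slope, tendsto_iff_norm_sub_tendsto_zero]
  obtain ⟨L, hL, hLb⟩ := exists_lipschitz_expOp_neg hA hh hg hb (r := 1 / 2) (by norm_num) (t + 1)
  obtain ⟨M, hM, hMb⟩ := exists_bound_of_differentiableOn hEd (r := 1 / 2) (by norm_num)
  set q : ℝ → Cn n → Cn n := fun y w => ((y - t : ℝ) : ℂ)⁻¹ • (G y w - G t w) - E w with hq
  have hnear : ∀ᶠ y in 𝓝[≠] t, 0 < y ∧ y < t + 1 ∧ y ≠ t := by
    filter_upwards [nhdsWithin_le_nhds (lt_mem_nhds ht),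
      nhdsWithin_le_nhds (gt_mem_nhds (show t < t + 1 by linarith)), self_mem_nhdsWithin]
      with y h1 h2 h3 using ⟨h1, h2, h3⟩
  have hlim := tendsto_taylorTerm_zero (l := 𝓝[≠] t) (g := q) (r := 1 / 2) (M := L + M)
    (by norm_num) (by norm_num) ?_ ?_ ?_ k z
  · rw [tendsto_zero_iff_norm_tendsto_zero] at hlim
    refine hlim.congr' ?_
    filter_upwards [hnear] with y ⟨hy0, hy1, hyt⟩
    have ds := (hGd y hy0.le).fun_sub (hGd t ht.le)
    have e1 : taylorTerm (q y) k = ((y - t : ℝ) : ℂ)⁻¹ • (taylorTerm (G y) k - taylorTerm (G t) k) -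
        taylorTerm E k := by
      rw [hq, taylorTerm_sub (ds.fun_const_smul _) hEd, taylorTerm_const_smul ds,
        taylorTerm_sub (hGd y hy0.le) (hGd t ht.le)]
    rw [e1, slope_def_module]
    congr 1
    simp only [Submodule.coe_sub, Submodule.coe_smul, Pi.sub_apply, Pi.smul_apply]
    rw [← Complex.ofReal_inv, Complex.coe_smul]
    rfl
  · filter_upwards [hnear] with y ⟨hy0, hy1, hyt⟩
    exact (((hGd y hy0.le).fun_sub (hGd t ht.le)).fun_const_smul _).fun_sub hEd
  · filter_upwards [hnear] with y ⟨hy0, hy1, hyt⟩ w hw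
    refine (norm_sub_le _ _).trans (add_le_add ?_ (hMb w hw))
    have hpos : 0 < |y - t| := abs_pos.2 (sub_ne_zero.2 hyt)
    rw [norm_smul, norm_inv, Complex.norm_real, Real.norm_eq_abs, inv_mul_le_iff₀ hpos, mul_comm]
    rcases le_total y t with hle | hle
    · rw [abs_of_nonpos (sub_nonpos.2 hle), neg_sub, norm_sub_rev]
      exact hLb y t hy0.le hle (by linarith) w hw
    · rw [abs_of_nonneg (sub_nonneg.2 hle)]
      exact hLb t y ht.le hle hy1.le w hw
  · intro w hw
    have h1 := (hasDerivAt_iff_tendsto_slope.1 (hGE w hw)).sub_const (E w)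
    rw [sub_self] at h1
    refine h1.congr fun y => ?_
    rw [hq, slope_def_module]
    simp only
    rw [← Complex.ofReal_inv, Complex.coe_smul]

theorem lipOn_functional {k : ℕ} {F : ℝ → HomPoly n k} {a b : ℝ}
    (hF : ∀ z, LipOn (fun t => (F t : Cn n → Cn n) z) a b) (f : HomPoly n k →ₗ[ℂ] ℂ) :
    LipOn (fun t => f (F t)) a b := by
  obtain ⟨s, c, hf⟩ := exists_eval_repr f
  simp only [hf]
  refine LipOn.sum _ fun x _ => ?_
  set l : Cn n →L[ℂ] ℂ := c x • (EuclideanSpace.proj x.2 : Cn n →L[ℂ] ℂ)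
  have hl : ∀ v : Cn n, l v = c x * v x.2 := fun v => rfl
  have := LipOn.comp_lipschitzOn (q := l) (s := univ) l.lipschitz.lipschitzOnWith
    (hF x.1) fun _ _ => mem_univ _
  simpa only [hl] using this

theorem hasDerivAt_functional {k : ℕ} {F : ℝ → HomPoly n k} {F' : HomPoly n k} {t : ℝ}
    (hF : ∀ z, HasDerivAt (fun t => (F t : Cn n → Cn n) z) ((F' : Cn n → Cn n) z) t)
    (f : HomPoly n k →ₗ[ℂ] ℂ) : HasDerivAt (fun t => f (F t)) (f F') t := by
  obtain ⟨s, c, hf⟩ := exists_eval_repr f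
  simp only [hf]
  refine HasDerivAt.fun_sum fun x _ => ?_
  set l : Cn n →L[ℂ] ℂ := c x • (EuclideanSpace.proj x.2 : Cn n →L[ℂ] ℂ)
  have hl : ∀ v : Cn n, l v = c x * v x.2 := fun v => rfl
  have := (l.restrictScalars ℝ).hasFDerivAt.comp_hasDerivAt t (hF x.1)
  simp only [Function.comp_def, ContinuousLinearMap.coe_restrictScalars', hl] at this
  exact this

/-- Every polynomially bounded solution obeys the same triangular system. The switch is `False`,
since only polynomial growth is known. -/
theorem isCoeff_coeffF (hA : 0 < lowerIndex A) (hh : IsGenerator A h) (hg : IsSolution h g)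
    (hgb : PolynomiallyBounded A g) (k : ℕ) : IsCoeff A h False (coeffF A g) k := by
  have hb : ∀ r < 1, ∀ T, ∃ M, 0 ≤ M ∧ ∀ t, 0 ≤ t → t ≤ T → ∀ z, ‖z‖ ≤ r → ‖g z t‖ ≤ M :=
    fun r hr T => by
      obtain ⟨C, d, hC, hCb⟩ := hgb.exists_bound hr
      exact exists_bound_of_expOp_neg hC hCb T
  intro f
  refine ⟨polyB_functional (fun z => ?_) f, fun T => ?_, ?_⟩
  · obtain ⟨C, d, hC, hCb⟩ := hgb.exists_bound (r := 1 / 2) (by norm_num)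
    refine ⟨C * (‖z‖ / (1 / 2)) ^ k, d, by positivity, False.elim, fun t ht => ?_⟩
    refine (norm_taylorTerm_le (differentiableOn_expOp_comp (hg.holomorphic t ht) (-t))
      (r := 1 / 2) (by norm_num) (by norm_num) (hCb t ht) k z).trans_eq ?_
    ring
  · exact lipOn_functional (fun z => lipOn_coeffF hA hh hg hb k z T) f
  · have heq := hg.equation
    rw [ae_restrict_iff' measurableSet_Ici] at heq
    filter_upwards [heq] with t ht ht0
    exact hasDerivAt_functional (fun z => hasDerivAt_coeffF hA hh hg hb ht0 (ht ht0.le) k z) f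

theorem IsSolution.coeffF_zero_zero (hg : IsSolution h g) : coeffF A g 0 0 = 0 := by
  ext1
  funext z
  rw [coeffF, taylorTerm_zero_apply, hg.zero_zero, map_zero]
  rfl

theorem IsSolution.coeffF_one_zero (hg : IsSolution h g) : coeffF A g 1 0 = idPoly n := by
  have h0 : ∀ v, expOp A (-0) v = v := fun v => by
    rw [neg_zero, expOp_eq_expL, expL_zero]; rfl
  ext1
  funext z
  rw [coeffF]
  simp only [h0]
  rw [taylorTerm_one_apply, hg.fderiv_zero]
  rfl

/-- A polynomially bounded solution is determined by the stable parts of its coefficients of degree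
`2, …, n₀` at time `0`. -/
theorem eq_of_isSolution (hA : 0 < lowerIndex A) (hh : IsGenerator A h)
    (hf : IsSolution h f) (hfb : PolynomiallyBounded A f)
    (hg : IsSolution h g) (hgb : PolynomiallyBounded A g)
    (hfg : ∀ k ∈ Finset.Icc 2 (nZero A),
      projLE A k (coeffF A g k 0) = projLE A k (coeffF A f k 0))
    {z : Cn n} (hz : z ∈ unitBall n) {t : ℝ} (ht : 0 ≤ t) : g z t = f z t := by
  have key : ∀ k t, 0 ≤ t → coeffF A g k t = coeffF A f k t := by
    intro k
    induction k using Nat.strong_induction_on with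
    | _ k ih =>
      intro t ht
      rw [← sub_eq_zero]
      have cg := isCoeff_coeffF hA hh hg hgb k
      have cf := isCoeff_coeffF hA hh hf hfb k
      refine eq_zero_of_weak_polyB_solution (opB A k)
        (D := fun t => coeffF A g k t - coeffF A f k t) (fun l T => ?_) (fun l => ?_)
        (fun l => ?_) ?_ ht
      · simp only [map_sub]
        exact ((cg l).2.1 T).sub ((cf l).2.1 T)
      · filter_upwards [(cg l).2.2, (cf l).2.2] with x hxg hxf hx0
        simp only [map_sub]
        refine ((hxg hx0).sub (hxf hx0)).congr_deriv ?_
        -- By induction both solutions have the same lower coefficients, so the inhomogeneities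
        -- cancel and the difference solves `D' = B_k D`.
        rw [lowerTerm_congr (fun j hj => ih j hj x hx0.le) (fun z => h z x), map_add, map_add]
        abel
      · refine ((cg l).1.add (cf l).1).mono fun x _ => ?_
        rw [map_sub]
        exact norm_sub_le _ _
      · simp only [map_sub]
        rw [sub_eq_zero]
        -- Stable initial data agree in degrees `0` and `1` by normalization and in degrees `2, …,
        -- n₀` by hypothesis; beyond `n₀` the stable projection is zero.
        rcases Nat.lt_or_ge k 2 with hk | hk
        · obtain rfl | rfl : k = 0 ∨ k = 1 := by omega
          · rw [hg.coeffF_zero_zero, hf.coeffF_zero_zero]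
          · rw [hg.coeffF_one_zero, hf.coeffF_one_zero]
        · rcases Nat.lt_or_ge (nZero A) k with hk' | hk'
          · have h0 : stableProj (opB A k) = 0 := projLE_eq_zero hA hk'
            rw [h0]; rfl
          · exact hfg k (Finset.mem_Icc.2 ⟨hk, hk'⟩)
  have := eqOn_of_taylorTerm_eq (differentiableOn_expOp_comp (A := A) (hg.holomorphic t ht) (-t))
    (differentiableOn_expOp_comp (A := A) (hf.holomorphic t ht) (-t)) (fun k => key k t ht) hz
  rw [← expOp_expOp_neg A t (g z t), ← expOp_expOp_neg A t (f z t)]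
  exact congrArg _ this

end Uniqueness

/-! ### The chain is a solution of the required growth -/

section ChainSolution

variable {n : ℕ} {A : Cn n →L[ℂ] Cn n} {h : Cn n → ℝ → Cn n} {p : Prop}
  {F : (j : ℕ) → ℝ → HomPoly n j} {N : ℕ}

theorem polynomiallyBounded_chain (hA : 0 < lowerIndex A) (hh : IsGenerator A h)
    (hF : ∀ j < N, IsCoeff A h p F j) (hN : upperIndex A < N * lowerIndex A) :
    PolynomiallyBounded A (chain A h F N) := by
  intro K hK hKb
  obtain ⟨r, hr, hKr⟩ := exists_norm_le_of_isCompact hK hKb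
  obtain ⟨C, d, -, -, hb⟩ := exists_norm_chain_le hA hh hF hN hr
  exact ⟨C, (1 + Polynomial.X) ^ d, fun z hz t ht => by simpa using hb t ht z (hKr z hz)⟩

theorem locallyBounded_chain (hp : p) (hA : 0 < lowerIndex A) (hh : IsGenerator A h)
    (hF : ∀ j < N, IsCoeff A h p F j) (hN : upperIndex A < N * lowerIndex A) :
    LocallyBounded A (chain A h F N) := by
  intro K hK hKb
  obtain ⟨r, hr, hKr⟩ := exists_norm_le_of_isCompact hK hKb
  obtain ⟨C, d, -, hd, hb⟩ := exists_norm_chain_le hA hh hF hN hr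
  exact ⟨C, fun z hz t ht => by simpa [hd hp] using hb t ht z (hKr z hz)⟩

theorem isSolution_chain (hA : 0 < lowerIndex A) (hh : IsGenerator A h)
    (hF : ∀ j < N, IsCoeff A h p F j) (hN : upperIndex A < N * lowerIndex A) (hN2 : 2 ≤ N)
    (hF0 : ∀ t, F 0 t = 0) (hF1 : ∀ t, F 1 t = idPoly n) : IsSolution h (chain A h F N) := by
  have hd : ∀ t, 0 ≤ t → DifferentiableOn ℂ (fun z => chain A h F N z t) (unitBall n) :=
    fun t ht => differentiableOn_chain hA hh hF hN ht
  have hs : ∀ s t, 0 ≤ s → s ≤ t → ∀ z ∈ unitBall n,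
      chain A h F N z s = chain A h F N (transition h s t z) t :=
    fun s t hs hst z hz => chain_transition hA hh hF hN hs hst hz
  have hb : ∀ r < 1, ∀ T, ∃ M, 0 ≤ M ∧ ∀ t, 0 ≤ t → t ≤ T → ∀ z, ‖z‖ ≤ r →
      ‖chain A h F N z t‖ ≤ M := fun r hr T => by
    obtain ⟨C, d, hC, -, hCb⟩ := exists_norm_chain_le hA hh hF hN hr
    exact exists_bound_of_expOp_neg hC hCb T
  have h0 := chain_zero_and_fderiv hA hh hF hN hN2 hF0 hF1 le_rfl
  exact
    { holomorphic := hd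
      locallyAC := locallyAC_of_lipschitz fun r hr T =>
        exists_lipschitz_of_subordinate hA hh hd hs hb hr T
      equation := ae_equation_of_subordinate hA hh hd hs hb
      zero_zero := h0.1
      fderiv_zero := h0.2.trans (by rw [expOp_eq_expL, expL_zero]; rfl) }

end ChainSolution

end Loewner

end

/-! ### Assembly of the main theorem -/

theorem mainTheorem1 {n : ℕ} (A : Loewner.Cn n →L[ℂ] Loewner.Cn n)
    (hA : 0 < Loewner.lowerIndex A)
    (h : Loewner.Cn n → ℝ → Loewner.Cn n) (hh : Loewner.IsGenerator A h)
    (Q : (k : ℕ) → Loewner.HomPoly n k)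
    (hQ : ∀ k ∈ Finset.Icc 2 (Loewner.nZero A), Q k ∈ LinearMap.range (Loewner.projLE A k)) :
    ∃ f : Loewner.Cn n → ℝ → Loewner.Cn n,
      Loewner.IsLoewnerChain f ∧ Loewner.IsSolution h f ∧ Loewner.PolynomiallyBounded A f ∧
      (∀ t : ℝ, 0 ≤ t → f 0 t = 0 ∧ fderiv ℂ (fun z => f z t) 0 = Loewner.expOp A t) ∧
      (∀ k ∈ Finset.Icc 2 (Loewner.nZero A),
        Loewner.projLE A k (Loewner.coeffF A f k 0) = Q k) ∧
      (∀ g : Loewner.Cn n → ℝ → Loewner.Cn n,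
        Loewner.IsSolution h g → Loewner.PolynomiallyBounded A g →
        (∀ k ∈ Finset.Icc 2 (Loewner.nZero A),
          Loewner.projLE A k (Loewner.coeffF A g k 0) = Q k) →
        ∀ z ∈ Loewner.unitBall n, ∀ t : ℝ, 0 ≤ t → g z t = f z t) ∧
      (Loewner.ConjSumNonresonant A → Loewner.LocallyBounded A f) := by
  classical
  set N := Loewner.nZero A with hN
  -- Outside the prescribed degrees the data are set to zero, which lies in the range of the
  -- projection in every degree.
  set Q' : (k : ℕ) → Loewner.HomPoly n k := fun k => if k ∈ Finset.Icc 2 N then Q k else 0 with hQ'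
  have hQ'' : ∀ k, 2 ≤ k → Loewner.projLE A k (Q' k) = Q' k := fun k _ => by
    by_cases hk : k ∈ Finset.Icc 2 N
    · obtain ⟨q, hq⟩ := hQ k hk
      simp only [hQ', if_pos hk, ← hq]
      exact Loewner.spectralProjection_eq_self (Loewner.spectralProjection_mem _ _ q)
    · simp only [hQ', if_neg hk, map_zero]
  -- Taking nonresonance itself as the switch `p` makes one family of coefficients serve both growth
  -- claims. The order `n₀ + 1` retains exactly the degrees up to `n₀`.
  obtain ⟨F, hF0, hF1, hF⟩ := Loewner.exists_coeff (p := Loewner.ConjSumNonresonant A) hA hh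
    (fun hp k hk μ hμ => Loewner.re_ne_zero_of_conjSumNonresonant hp hk hμ) hQ'' (N + 1)
  have hc : ∀ j < N + 1, Loewner.IsCoeff A h (Loewner.ConjSumNonresonant A) F j :=
    fun j hj => (hF j hj).1
  have hN1 : Loewner.upperIndex A < ((N + 1 : ℕ) : ℝ) * Loewner.lowerIndex A :=
    Loewner.upperIndex_lt hA (Nat.lt_succ_self _)
  have hN2 : 2 ≤ N + 1 := Nat.succ_le_succ (Loewner.one_le_nZero hA)
  have hsol := Loewner.isSolution_chain hA hh hc hN1 hN2 hF0 hF1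
  have hbd := Loewner.polynomiallyBounded_chain hA hh hc hN1
  have hcoef : ∀ k ∈ Finset.Icc 2 N,
      Loewner.projLE A k (Loewner.coeffF A (Loewner.chain A h F (N + 1)) k 0) = Q k :=
    fun k hk => by
      have hk' := Finset.mem_Icc.1 hk
      rw [Loewner.coeffF_chain hA hh hc hN1 le_rfl (Nat.lt_succ_of_le hk'.2),
        (hF k (Nat.lt_succ_of_le hk'.2)).2 hk'.1]
      exact if_pos hk
  exact ⟨Loewner.chain A h F (N + 1), Loewner.isLoewnerChain_chain hA hh hc hN1 hN2 hF0 hF1, hsol,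
    hbd, fun t ht => Loewner.chain_zero_and_fderiv hA hh hc hN1 hN2 hF0 hF1 ht, hcoef,
    fun g hg hgb hgQ z hz t ht => Loewner.eq_of_isSolution hA hh hsol hbd hg hgb
      (fun k hk => (hgQ k hk).trans (hcoef k hk).symm) hz ht,
    fun hp => Loewner.locallyBounded_chain hp hA hh hc hN1⟩
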